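/- A triangle in $\mathbb{R}^3$ is the convex hull of three non-collinear points, and a line is tangent to a triangle if it meets one of its three (closed) edges. Let $t_1,t_2,t_3,t_4$ be any four triangles in $\mathbb{R}^3$ (no general-position assumption). Consider the set of lines in $\mathbb{R}^3$ tangent to all four triangles, with its topology as a subspace of the space of lines, where two common tangents belong to the same component if one can be moved continuously to the other through common tangents of the four triangles. Then this set has at most $162$ components. If the four triangles are pairwise disjoint, then it has at most $156$ components. -/

import Mathlib

/-- Euclidean three-space. -/
abbrev E3 : Type := EuclideanSpace ℝ (Fin 3)

/-- A line in three-space: an affine subspace whose direction has dimension one.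
(The empty affine subspace has zero-dimensional direction, so it is excluded.) -/
def Line3 : Type :=
  {L : AffineSubspace ℝ E3 // Module.finrank ℝ L.direction = 1}

/-- The line through `p` with nonzero direction vector `v`. -/
noncomputable def Line3.through (p : E3) (v : {v : E3 // v ≠ 0}) : Line3 :=
  ⟨AffineSubspace.mk' p (Submodule.span ℝ {v.1}), by
    rw [AffineSubspace.direction_mk']
    exact finrank_span_singleton v.2⟩

/-- Every line is given by a point and a nonzero direction vector, so the topology below is a
quotient topology. -/
theorem Line3.exists_through (L : Line3) : ∃ p v, Line3.through p v = L := by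
  obtain ⟨L, hL⟩ := L
  have hne : (L : Set E3).Nonempty := by
    by_contra h
    have : L = ⊥ := by
      rwa [AffineSubspace.nonempty_iff_ne_bot, not_not] at h
    rw [this, AffineSubspace.direction_bot, finrank_bot] at hL
    exact zero_ne_one hL
  obtain ⟨p, hp⟩ := hne
  obtain ⟨v, hv0, hv⟩ := finrank_eq_one_iff'.1 hL
  refine ⟨p, ⟨v.1, fun h => hv0 (Subtype.ext h)⟩, ?_⟩
  apply Subtype.ext
  have hs : Submodule.span ℝ {v.1} = L.direction := by
    apply le_antisymm
    · rw [Submodule.span_singleton_le_iff_mem]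
      exact v.2
    · intro w hw
      obtain ⟨c, hc⟩ := hv ⟨w, hw⟩
      exact Submodule.mem_span_singleton.2 ⟨c, congrArg Subtype.val hc⟩
  change AffineSubspace.mk' p (Submodule.span ℝ {v.1}) = L
  rw [hs]
  exact AffineSubspace.mk'_eq hp

/-- The usual topology on the space of lines: the quotient topology from pairs
(point, nonzero direction vector). -/
noncomputable instance : TopologicalSpace Line3 :=
  TopologicalSpace.coinduced (fun q : E3 × {v : E3 // v ≠ 0} => Line3.through q.1 q.2)
    inferInstance

/-- A triangle as a point set: the convex hull of its three (affinely independent) vertices. -/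
def triangleSet (t : Affine.Triangle ℝ E3) : Set E3 :=
  convexHull ℝ (Set.range t.points)

/-- A line is tangent to a triangle if it meets one of its three (closed) edges. -/
def IsTangent (L : Line3) (t : Affine.Triangle ℝ E3) : Prop :=
  ∃ i j : Fin 3, i ≠ j ∧ ∃ x ∈ segment ℝ (t.points i) (t.points j), x ∈ L.1

/-- The set of common tangent lines to four triangles. As a type it carries the subspace
topology. -/
def commonTangents (t : Fin 4 → Affine.Triangle ℝ E3) : Set Line3 :=
  {L | ∀ k, IsTangent L (t k)}

/-- The number (possibly infinite) of components of the space of common tangents. Two tangents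
are in the same component if one can be moved continuously to the other through common tangents;
`ZerothHomotopy` is the set of path components. -/
noncomputable def numTangentComponents (t : Fin 4 → Affine.Triangle ℝ E3) : ℕ∞ :=
  ENat.card (ZerothHomotopy (commonTangents t))

/-! Choosing one edge of each triangle splits the common tangents into 81 cells, each the set of
transversals of four segments. A component touched by `n` cells is charged `1 / n` to each of them,
so the number of components is the total charge. If a finite set of lines of a cell represents all
components that touch it, the cell pays at most the sum of `1 / mult` over this set. A line through
an end of a chosen edge also meets another edge of the same triangle, so it lies in two cells and
costs at most one half; a line through ends of edges of two triangles costs at most one quarter.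
`CellBound t e B` says that the cell `e` pays at most `B`, and `numTangentComponents_le` is the
double count.

The general bound is 81 times 2: every cell pays at most 2 (`cellBound_two`). For two skew edges,
barycentric coordinates (`Frame`) describe a transversal by its feet on the two base lines, and an
edge skew to both prescribes a projectivity between the feet. Two different projectivities agree at
no more than two feet, the roots of a binary quadratic form, which leaves two lines. If all of them
agree, the edges lie on lines of one regulus, and the transversals correspond to an intersection of
at most four arcs of the projective line; rotating inside it until an arc ends leads to a line
through an end of an edge, so at most four classes of weight one half remain. If two edges are
coplanar but not collinear, a transversal lies in their plane or passes through their common point,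
and pencils of lines again produce arcs with ends of small weight.

For disjoint triangles a total of 6 is saved. If edges of two triangles are coplanar, all
transversals of the cells concerned lie in a plane, and these cells pay at most 3/2, or 1 if no
other pair of the cell is coplanar. Otherwise edges of different triangles are pairwise skew, and a
sign count yields an edge of some triangle whose line misses two other triangles
(`exists_edge_missing_two`). Together with any edge of the fourth triangle it leaves nine cells,
hence nine quadratic forms in the foot. The forms of the three edges of one triangle satisfy a
linear relation, which makes their roots interlace. Seventeen transversals would force all eighteen
roots into the prescribed arcs, and interlacing along both families of arcs would then demand a
third root of one form (`nine_forms_contradiction`). So the nine cells pay 16 instead of 18. If some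
form vanishes identically, the four cells sharing exactly one of its two edges have a root at a
vertex and save one half each. Three choices of the fourth edge give the saving of 6. -/

namespace TriTangent

/-! ### Lines, their topology and their deformations -/

open Set

/-- The line through `p` with direction `v` (with a junk direction when `v = 0`). -/
noncomputable def ln (p v : E3) : Line3 :=
  if h : v ≠ 0 then Line3.through p ⟨v, h⟩
  else Line3.through p ⟨EuclideanSpace.single 0 1, by simp⟩

theorem mem_ln {p v x : E3} (hv : v ≠ 0) : x ∈ (ln p v).1 ↔ ∃ c : ℝ, x = p + c • v := by
  have : ln p v = Line3.through p ⟨v, hv⟩ := by simp [ln, hv]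
  rw [this]
  change x ∈ AffineSubspace.mk' p (Submodule.span ℝ {v}) ↔ _
  rw [AffineSubspace.mem_mk', Submodule.mem_span_singleton]
  constructor
  · rintro ⟨c, hc⟩
    exact ⟨c, by rw [hc]; simp⟩
  · rintro ⟨c, hc⟩
    exact ⟨c, by rw [hc]; simp⟩

theorem left_mem_ln {p v : E3} (hv : v ≠ 0) : p ∈ (ln p v).1 :=
  (mem_ln hv).2 ⟨0, by simp⟩

instance : Nonempty Line3 := ⟨ln 0 0⟩

theorem continuousOn_ln : ContinuousOn (fun q : E3 × E3 => ln q.1 q.2) {q | q.2 ≠ 0} := by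
  rw [continuousOn_iff_continuous_domRestrict]
  have h1 : Continuous (fun q : E3 × {v : E3 // v ≠ 0} => Line3.through q.1 q.2) :=
    continuous_coinduced_rng
  have h2 : Continuous (fun q : {q : E3 × E3 | q.2 ≠ 0} =>
      ((q.1.1, ⟨q.1.2, q.2⟩) : E3 × {v : E3 // v ≠ 0})) := by
    fun_prop
  refine (h1.comp h2).congr fun q => ?_
  have := q.2
  simp only [mem_ofPred_eq] at this
  simp [ln, this]

theorem eq_of_two_mem {L M : Line3} {p q : E3} (hpq : p ≠ q) (hp : p ∈ L.1) (hq : q ∈ L.1)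
    (hp' : p ∈ M.1) (hq' : q ∈ M.1) : L = M := by
  have key : ∀ L : Line3, p ∈ L.1 → q ∈ L.1 → L.1 = AffineSubspace.mk' p (Submodule.span ℝ {q - p}) := by
    intro L hp hq
    have hne : q - p ≠ 0 := sub_ne_zero.2 hpq.symm
    have hmem : q - p ∈ L.1.direction := AffineSubspace.vsub_mem_direction hq hp
    have hle : Submodule.span ℝ {q - p} ≤ L.1.direction := by
      rw [Submodule.span_singleton_le_iff_mem]; exact hmem
    have : Submodule.span ℝ {q - p} = L.1.direction := by
      apply Submodule.eq_of_le_of_finrank_eq hle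
      rw [finrank_span_singleton hne, L.2]
    rw [this]
    exact (AffineSubspace.mk'_eq hp).symm
  exact Subtype.ext ((key L hp hq).trans (key M hp' hq').symm)

theorem eq_ln {L : Line3} {p v : E3} (hv : v ≠ 0) (hp : p ∈ L.1) (hq : p + v ∈ L.1) :
    L = ln p v :=
  eq_of_two_mem (by simpa using hv) hp hq (left_mem_ln hv) ((mem_ln hv).2 ⟨1, by simp⟩)

theorem exists_eq_ln (L : Line3) : ∃ p v, v ≠ 0 ∧ L = ln p v := by
  obtain ⟨p, v, h⟩ := L.exists_through
  refine ⟨p, v.1, v.2, ?_⟩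
  rw [← h]
  have := v.2
  simp [ln, this]

theorem exists_eq_ln_of_mem {L : Line3} {p : E3} (hp : p ∈ L.1) : ∃ v, v ≠ 0 ∧ L = ln p v := by
  obtain ⟨q, v, hv, rfl⟩ := exists_eq_ln L
  obtain ⟨c, rfl⟩ := (mem_ln hv).1 hp
  exact ⟨v, hv, eq_ln hv hp ((mem_ln hv).2 ⟨c + 1, by module⟩)⟩

theorem mem_iff_of_two_mem {L : Line3} {p q x : E3} (hpq : p ≠ q) (hp : p ∈ L.1) (hq : q ∈ L.1) :
    x ∈ L.1 ↔ ∃ t : ℝ, x = p + t • (q - p) := by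
  have hv : q - p ≠ 0 := sub_ne_zero.2 hpq.symm
  rw [eq_ln hv hp (by simpa using hq), mem_ln hv]

/-- The line `L` meets the closed segment with ends `a` and `b`. -/
def Meets (L : Line3) (a b : E3) : Prop := ∃ x ∈ segment ℝ a b, x ∈ L.1

theorem Meets.symm {L : Line3} {a b : E3} (h : Meets L a b) : Meets L b a := by
  rwa [Meets, segment_symm]

/-- The tool behind most deformations below: once lines are described by a convex set of parameters
with nonvanishing direction, the segment between two parameters is a path of lines. -/
theorem joinedIn_ln_of_convex {W : Type*} [AddCommGroup W] [Module ℝ W] [TopologicalSpace W]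
    [ContinuousAdd W] [ContinuousSMul ℝ W] {S : Set W} (hS : Convex ℝ S) {p v : W → E3}
    (hp : ContinuousOn p S) (hvc : ContinuousOn v S) (hv : ∀ w ∈ S, v w ≠ 0) {T : Set Line3}
    (hT : ∀ w ∈ S, ln (p w) (v w) ∈ T) {x y : W} (hx : x ∈ S) (hy : y ∈ S) :
    JoinedIn T (ln (p x) (v x)) (ln (p y) (v y)) := by
  have h1 : JoinedIn S x y := (hS.isPathConnected ⟨x, hx⟩).joinedIn x hx y hy
  have hc : ContinuousOn (fun w => ln (p w) (v w)) S :=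
    continuousOn_ln.comp (hp.prodMk hvc) hv
  exact (h1.map_continuousOn hc).mono (by rintro _ ⟨w, hw, rfl⟩; exact hT w hw)

/-- The common transversals of four segments. -/
def Transv (a b : Fin 4 → E3) : Set Line3 := {L | ∀ k, Meets L (a k) (b k)}

end TriTangent

/-! ### Cells, multiplicities and the weighted count -/

namespace TriTangent

open Set

/-- First end of the chosen edges; the edge `m` is the one opposite to the vertex `m`. -/
def cellA (t : Fin 4 → Affine.Triangle ℝ E3) (e : Fin 4 → Fin 3) (k : Fin 4) : E3 :=
  (t k).points (e k + 1)

/-- Second end of the chosen edges. -/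
def cellB (t : Fin 4 → Affine.Triangle ℝ E3) (e : Fin 4 → Fin 3) (k : Fin 4) : E3 :=
  (t k).points (e k + 2)

/-- The lines meeting the chosen edge of each triangle. -/
def cell (t : Fin 4 → Affine.Triangle ℝ E3) (e : Fin 4 → Fin 3) : Set Line3 :=
  Transv (cellA t e) (cellB t e)

theorem isTangent_iff {L : Line3} {t : Affine.Triangle ℝ E3} :
    IsTangent L t ↔ ∃ m : Fin 3, Meets L (t.points (m + 1)) (t.points (m + 2)) := by
  constructor
  · rintro ⟨i, j, hij, h⟩
    have : ∀ i j : Fin 3, i ≠ j → ∃ m : Fin 3, (i = m + 1 ∧ j = m + 2) ∨ (j = m + 1 ∧ i = m + 2) := by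
      decide
    obtain ⟨m, ⟨rfl, rfl⟩ | ⟨rfl, rfl⟩⟩ := this i j hij
    · exact ⟨m, h⟩
    · exact ⟨m, Meets.symm h⟩
  · rintro ⟨m, h⟩
    exact ⟨m + 1, m + 2, by clear h; revert m; decide, h⟩

theorem mem_commonTangents_iff {L : Line3} {t : Fin 4 → Affine.Triangle ℝ E3} :
    L ∈ commonTangents t ↔ ∃ e, L ∈ cell t e := by
  simp only [commonTangents, mem_ofPred_eq, isTangent_iff, cell, Transv, cellA, cellB]
  exact Classical.skolem

theorem cell_subset {t : Fin 4 → Affine.Triangle ℝ E3} {e : Fin 4 → Fin 3} :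
    cell t e ⊆ commonTangents t := fun _ h => mem_commonTangents_iff.2 ⟨e, h⟩

open Classical in
/-- The number of cells that contain a line. -/
noncomputable def mult (t : Fin 4 → Affine.Triangle ℝ E3) (L : Line3) : ℕ :=
  (Finset.univ.filter fun e => L ∈ cell t e).card

/-- The lines of the cell fall into classes with total weight at most `B`. -/
def CellBound (t : Fin 4 → Affine.Triangle ℝ E3) (e : Fin 4 → Fin 3) (B : ℚ) : Prop :=
  ∃ R : Finset Line3, (∀ L ∈ R, L ∈ cell t e) ∧
    (∀ L ∈ cell t e, ∃ M ∈ R, JoinedIn (commonTangents t) L M) ∧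
    ∑ L ∈ R, (1 / mult t L : ℚ) ≤ B

theorem CellBound.mono {t : Fin 4 → Affine.Triangle ℝ E3} {e : Fin 4 → Fin 3} {B C : ℚ}
    (h : CellBound t e B) (hBC : B ≤ C) : CellBound t e C := by
  obtain ⟨R, h1, h2, h3⟩ := h
  exact ⟨R, h1, h2, h3.trans hBC⟩

-- Double counting of pairs of a component and a cell touching it, each pair weighted by the inverse
-- number of cells touching the component. The strict bound by `n + 1` suffices because the number
-- of components is an integer.
open Classical in
theorem numTangentComponents_le {t : Fin 4 → Affine.Triangle ℝ E3} {β : (Fin 4 → Fin 3) → ℚ}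
    (h : ∀ e, CellBound t e (β e)) {n : ℕ} (hn : ∑ e, β e < n + 1) :
    numTangentComponents t ≤ n := by
  choose R hR hcov hsum using h
  let Z := ZerothHomotopy (commonTangents t)
  have hfin : Finite Z := by
    -- Finiteness comes first: every component contains one of the finitely many representatives.
    have hs : Function.Surjective (fun x : (Σ e, R e) =>
        (ZerothHomotopy.mk ⟨x.2.1, cell_subset (hR x.1 x.2.1 x.2.2)⟩ : Z)) := by
      intro z
      obtain ⟨⟨L, hL⟩, rfl⟩ := ZerothHomotopy.mk_surjective z
      obtain ⟨e, he⟩ := mem_commonTangents_iff.1 hL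
      obtain ⟨M, hM, hj⟩ := hcov e L he
      exact ⟨⟨e, M, hM⟩, (Quotient.sound hj.joined_subtype).symm⟩
    exact Finite.of_surjective _ hs
  have : Fintype Z := Fintype.ofFinite Z
  let touch : Z → (Fin 4 → Fin 3) → Prop := fun C e =>
    ∃ (L : Line3) (hL : L ∈ cell t e), (ZerothHomotopy.mk ⟨L, cell_subset hL⟩ : Z) = C
  let num : Z → ℕ := fun C => (Finset.univ.filter fun e => touch C e).card
  have hnum : ∀ C, 0 < num C := by
    intro C
    obtain ⟨⟨L, hL⟩, rfl⟩ := ZerothHomotopy.mk_surjective C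
    obtain ⟨e, he⟩ := mem_commonTangents_iff.1 hL
    exact Finset.card_pos.2 ⟨e, by simpa [touch] using ⟨L, he, rfl⟩⟩
  -- Each component touching `e` is sent to a representative inside it. The map is injective because
  -- a line determines its component, and every cell containing that line touches the component, so
  -- the weight only grows.
  have hinner : ∀ e, ∑ C ∈ Finset.univ.filter (fun C => touch C e), (1 / num C : ℚ) ≤ β e := by
    intro e
    have hg : ∀ C : Z, touch C e → ∃ M ∈ R e, ∃ hM : M ∈ cell t e,
        (ZerothHomotopy.mk ⟨M, cell_subset hM⟩ : Z) = C := by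
      rintro C ⟨L, hL, rfl⟩
      obtain ⟨M, hM, hj⟩ := hcov e L hL
      exact ⟨M, hM, hR e M hM, (Quotient.sound hj.joined_subtype).symm⟩
    choose! g hgR hgc hgC using hg
    refine le_trans ?_ (hsum e)
    have h1 : ∀ C ∈ Finset.univ.filter (fun C => touch C e),
        (1 / num C : ℚ) ≤ 1 / mult t (g C) := by
      intro C hC
      have hC' : touch C e := by simpa using hC
      apply one_div_le_one_div_of_le
      · have : 0 < mult t (g C) := Finset.card_pos.2 ⟨e, by simpa using hgc C hC'⟩
        exact_mod_cast this
      · have : mult t (g C) ≤ num C := by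
          apply Finset.card_le_card
          intro e' he'
          simp only [Finset.mem_filter, Finset.mem_univ, true_and] at he' ⊢
          exact ⟨g C, he', hgC C hC'⟩
        exact_mod_cast this
    refine (Finset.sum_le_sum h1).trans ?_
    have hinj : Set.InjOn g ((Finset.univ.filter (fun C => touch C e) : Finset Z) : Set Z) := by
      intro C hC D hD hCD
      have hC' : touch C e := by simpa using hC
      have hD' : touch D e := by simpa using hD
      rw [← hgC C hC', ← hgC D hD']
      congr 2
    rw [← Finset.sum_image (f := fun L => (1 / mult t L : ℚ)) hinj]
    apply Finset.sum_le_sum_of_subset_of_nonneg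
    · intro L hL
      obtain ⟨C, hC, rfl⟩ := Finset.mem_image.1 hL
      exact hgR C (by simpa using hC)
    · intros; positivity
  have htot : (Fintype.card Z : ℚ) ≤ ∑ e, β e := by
    calc (Fintype.card Z : ℚ) = ∑ C : Z, (1 : ℚ) := by simp
      _ = ∑ C : Z, ∑ e ∈ Finset.univ.filter (fun e => touch C e), (1 / num C : ℚ) := by
        refine Finset.sum_congr rfl fun C _ => ?_
        rw [Finset.sum_const, nsmul_eq_mul]
        have : (num C : ℚ) ≠ 0 := by exact_mod_cast (hnum C).ne'
        change 1 = (num C : ℚ) * _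
        field_simp
      _ = ∑ e, ∑ C ∈ Finset.univ.filter (fun C => touch C e), (1 / num C : ℚ) := by
        simp only [Finset.sum_filter]
        exact Finset.sum_comm
      _ ≤ ∑ e, β e := Finset.sum_le_sum fun e _ => hinner e
  have hlt : (Fintype.card Z : ℚ) < n + 1 := htot.trans_lt hn
  have hle : Fintype.card Z ≤ n := by
    have : Fintype.card Z < n + 1 := by exact_mod_cast hlt
    omega
  change ENat.card Z ≤ n
  rw [ENat.card_eq_coe_fintype_card]
  exact_mod_cast hle

/-- The line passes through an end of the chosen edge of the triangle `k`. -/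
def ThroughEnd (t : Fin 4 → Affine.Triangle ℝ E3) (e : Fin 4 → Fin 3) (k : Fin 4)
    (L : Line3) : Prop := cellA t e k ∈ L.1 ∨ cellB t e k ∈ L.1

/-- An end of an edge is a vertex of the triangle, hence also an end of a second edge. -/
theorem ThroughEnd.exists_ne {t : Fin 4 → Affine.Triangle ℝ E3} {e : Fin 4 → Fin 3} {k : Fin 4}
    {L : Line3} (h : ThroughEnd t e k L) :
    ∃ m : Fin 3, m ≠ e k ∧ Meets L ((t k).points (m + 1)) ((t k).points (m + 2)) := by
  rcases h with h | h
  · refine ⟨e k + 2, by generalize e k = x; revert x; decide, (t k).points (e k + 1), ?_, h⟩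
    have : e k + 2 + 2 = e k + 1 := by generalize e k = x; revert x; decide
    rw [this]
    exact right_mem_segment ..
  · refine ⟨e k + 1, by generalize e k = x; revert x; decide, (t k).points (e k + 2), ?_, h⟩
    have : e k + 1 + 1 = e k + 2 := by generalize e k = x; revert x; decide
    rw [this]
    exact left_mem_segment ..

open Classical in
theorem mem_cell_update {t : Fin 4 → Affine.Triangle ℝ E3} {e : Fin 4 → Fin 3} {k : Fin 4}
    {L : Line3} (hL : L ∈ cell t e) {m : Fin 3}
    (hm : Meets L ((t k).points (m + 1)) ((t k).points (m + 2))) :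
    L ∈ cell t (Function.update e k m) := by
  intro j
  by_cases hj : j = k
  · subst hj
    simpa [cellA, cellB] using hm
  · simpa [cellA, cellB, hj] using hL j

/-- The source of the weights one half: replacing the edge by the other one at the same vertex gives
a second cell containing the line. -/
theorem two_le_mult {t : Fin 4 → Affine.Triangle ℝ E3} {e : Fin 4 → Fin 3} {k : Fin 4}
    {L : Line3} (hL : L ∈ cell t e) (h : ThroughEnd t e k L) : 2 ≤ mult t L := by
  classical
  obtain ⟨m, hm, hmm⟩ := h.exists_ne
  have h1 := mem_cell_update hL hmm
  have hne : e ≠ Function.update e k m := fun h => hm (by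
    have := congrFun h k
    simpa using this.symm)
  rw [mult, ← Finset.card_pair hne]
  apply Finset.card_le_card
  intro x hx
  rcases Finset.mem_insert.1 hx with rfl | hx
  · simpa using hL
  · rw [Finset.mem_singleton.1 hx]
    simpa using h1

/-- The replacements at two different triangles are independent, so four cells contain the line. -/
theorem four_le_mult {t : Fin 4 → Affine.Triangle ℝ E3} {e : Fin 4 → Fin 3} {k l : Fin 4}
    (hkl : k ≠ l) {L : Line3} (hL : L ∈ cell t e) (h : ThroughEnd t e k L)
    (h' : ThroughEnd t e l L) : 4 ≤ mult t L := by
  classical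
  obtain ⟨m, hm, hmm⟩ := h.exists_ne
  obtain ⟨n, hn, hnn⟩ := h'.exists_ne
  have h1 := mem_cell_update hL hmm
  have h2 := mem_cell_update hL hnn
  have h3 := mem_cell_update h1 hnn
  set e1 := Function.update e k m with he1
  set e2 := Function.update e l n with he2
  set e3 := Function.update e1 l n with he3
  have a0 : e1 k = m := by simp [he1]
  have a1 : e1 l = e l := by simp [he1, hkl.symm]
  have a2 : e2 k = e k := by simp [he2, hkl]
  have a3 : e2 l = n := by simp [he2]
  have a4 : e3 k = m := by simp [he3, hkl, a0]
  have a5 : e3 l = n := by simp [he3]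
  have n1 : e ≠ e1 := fun h => hm (by rw [← a0, ← h])
  have n2 : e ≠ e2 := fun h => hn (by rw [← a3, ← h])
  have n3 : e ≠ e3 := fun h => hm (by rw [← a4, ← h])
  have n4 : e1 ≠ e2 := fun h => hm (by rw [← a0, h, a2])
  have n5 : e1 ≠ e3 := fun h => hn (by rw [← a5, ← h, a1])
  have n6 : e2 ≠ e3 := fun h => hm (by rw [← a4, ← h, a2])
  have hc : ({e, e1, e2, e3} : Finset (Fin 4 → Fin 3)).card = 4 := by
    rw [Finset.card_insert_of_notMem (by simp [n1, n2, n3]),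
      Finset.card_insert_of_notMem (by simp [n4, n5]), Finset.card_pair n6]
  refine hc.symm.le.trans (Finset.card_le_card ?_)
  intro x hx
  simp only [Finset.mem_insert, Finset.mem_singleton] at hx
  simp only [Finset.mem_filter, Finset.mem_univ, true_and]
  rcases hx with rfl | rfl | rfl | rfl <;> assumption

theorem one_le_mult {t : Fin 4 → Affine.Triangle ℝ E3} {e : Fin 4 → Fin 3} {L : Line3}
    (hL : L ∈ cell t e) : 1 ≤ mult t L := by
  classical
  exact Finset.card_pos.2 ⟨e, by simpa using hL⟩

theorem sum_inv_mult_le {t : Fin 4 → Affine.Triangle ℝ E3} {R : Finset Line3} {n m : ℕ}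
    (hm : 0 < m) (hc : R.card ≤ n) (h : ∀ L ∈ R, m ≤ mult t L) :
    ∑ L ∈ R, (1 / mult t L : ℚ) ≤ n / m := by
  have h1 : ∑ L ∈ R, (1 / mult t L : ℚ) ≤ ∑ L ∈ R, (1 / m : ℚ) := by
    refine Finset.sum_le_sum fun L hL => one_div_le_one_div_of_le (by exact_mod_cast hm) ?_
    exact_mod_cast h L hL
  refine h1.trans ?_
  rw [Finset.sum_const, nsmul_eq_mul, mul_one_div]
  gcongr

theorem cellBound_of_card {t : Fin 4 → Affine.Triangle ℝ E3} {e : Fin 4 → Fin 3}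
    {R : Finset Line3} {n m : ℕ} (hm : 0 < m) (hc : R.card ≤ n) (hR : ∀ L ∈ R, L ∈ cell t e)
    (h : ∀ L ∈ R, m ≤ mult t L)
    (hcov : ∀ L ∈ cell t e, ∃ M ∈ R, JoinedIn (cell t e) L M) : CellBound t e (n / m) :=
  ⟨R, hR, fun L hL => by
    obtain ⟨M, hM, hj⟩ := hcov L hL
    exact ⟨M, hM, hj.mono cell_subset⟩, sum_inv_mult_le hm hc h⟩

end TriTangent

/-! ### Arcs of the projective line and rotation to their ends -/

namespace TriTangent

open Set

/-- The determinant of two plane vectors. -/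
def br (u v : ℝ × ℝ) : ℝ := u.1 * v.2 - u.2 * v.1

/-- Membership in the convex cone spanned by `a` and `b`. -/
def InCone (a b w : ℝ × ℝ) : Prop := ∃ r s : ℝ, 0 ≤ r ∧ 0 ≤ s ∧ w = r • a + s • b

/-- Membership in the double cone spanned by `a` and `b`, an arc of the projective line. -/
def InArc (a b w : ℝ × ℝ) : Prop := InCone a b w ∨ InCone a b (-w)

/-- The cone spanned by `a` and `b` is pointed. -/
def Pointed (a b : ℝ × ℝ) : Prop := ∀ r s : ℝ, 0 ≤ r → 0 ≤ s → r • a + s • b = 0 → r = 0 ∧ s = 0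

theorem InArc.neg {a b w : ℝ × ℝ} (h : InArc a b w) : InArc a b (-w) := by
  rcases h with h | h
  · exact Or.inr (by rwa [neg_neg])
  · exact Or.inl h

theorem InCone.symm {a b w : ℝ × ℝ} (h : InCone a b w) : InCone b a w := by
  obtain ⟨r, s, hr, hs, rfl⟩ := h
  exact ⟨s, r, hs, hr, add_comm _ _⟩

theorem InArc.symm {a b w : ℝ × ℝ} (h : InArc a b w) : InArc b a w :=
  h.imp InCone.symm InCone.symm

theorem Pointed.symm {a b : ℝ × ℝ} (h : Pointed a b) : Pointed b a := by
  intro r s hr hs he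
  obtain ⟨h1, h2⟩ := h s r hs hr (by rw [add_comm]; exact he)
  exact ⟨h2, h1⟩

theorem InCone.add {a b u v : ℝ × ℝ} (hu : InCone a b u) (hv : InCone a b v) :
    InCone a b (u + v) := by
  obtain ⟨r, s, hr, hs, rfl⟩ := hu
  obtain ⟨r', s', hr', hs', rfl⟩ := hv
  exact ⟨r + r', s + s', by positivity, by positivity, by module⟩

theorem InCone.smul {a b u : ℝ × ℝ} (hu : InCone a b u) {c : ℝ} (hc : 0 ≤ c) :
    InCone a b (c • u) := by
  obtain ⟨r, s, hr, hs, rfl⟩ := hu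
  exact ⟨c * r, c * s, by positivity, by positivity, by module⟩

theorem InCone.left (a b : ℝ × ℝ) : InCone a b a := ⟨1, 0, by simp, by simp, by simp⟩

theorem InArc.smul {a b w : ℝ × ℝ} (h : InArc a b w) (c : ℝ) : InArc a b (c • w) := by
  rcases le_total 0 c with hc | hc
  · rcases h with h | h
    · exact Or.inl (h.smul hc)
    · refine Or.inr ?_
      have := h.smul hc
      rwa [smul_neg] at this
  · have hc' : 0 ≤ -c := by linarith
    rcases h with h | h
    · refine Or.inr ?_
      have := h.smul hc'
      rwa [neg_smul] at this
    · refine Or.inl ?_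
      have := h.smul hc'
      rwa [smul_neg, neg_smul, neg_neg] at this

theorem pointed_of_br_ne {a b : ℝ × ℝ} (h : br a b ≠ 0) : Pointed a b := by
  intro r s _ _ he
  have h1 := congrArg Prod.fst he
  have h2 := congrArg Prod.snd he
  simp only [Prod.fst_add, Prod.smul_fst, smul_eq_mul, Prod.fst_zero, Prod.snd_add,
    Prod.smul_snd, Prod.snd_zero] at h1 h2
  unfold br at h
  constructor
  · apply (mul_eq_zero.1 (_ : r * (a.1 * b.2 - a.2 * b.1) = 0)).resolve_right h
    linear_combination b.2 * h1 - b.1 * h2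
  · apply (mul_eq_zero.1 (_ : s * (a.1 * b.2 - a.2 * b.1) = 0)).resolve_right h
    linear_combination a.1 * h2 - a.2 * h1

theorem Pointed.left_ne {a b : ℝ × ℝ} (h : Pointed a b) : a ≠ 0 := by
  rintro rfl
  have := h 1 0 (by simp) (by simp) (by simp)
  simp at this

theorem sq_add_sq_pos {u : ℝ × ℝ} (hu : u ≠ 0) : 0 < u.1 ^ 2 + u.2 ^ 2 := by
  by_contra h
  apply hu
  have h1 : u.1 = 0 := by nlinarith [sq_nonneg u.1, sq_nonneg u.2]
  have h2 : u.2 = 0 := by nlinarith [sq_nonneg u.1, sq_nonneg u.2]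
  exact Prod.ext h1 h2

theorem eq_smul_of_br_eq_zero {u v : ℝ × ℝ} (hu : u ≠ 0) (h : br u v = 0) :
    v = ((u.1 * v.1 + u.2 * v.2) / (u.1 ^ 2 + u.2 ^ 2)) • u := by
  have h0 := (sq_add_sq_pos hu).ne'
  unfold br at h
  ext
  · simp only [Prod.smul_fst, smul_eq_mul]
    field_simp
    linear_combination (-u.2) * h
  · simp only [Prod.smul_snd, smul_eq_mul]
    field_simp
    linear_combination u.1 * h

/-- Rotating a direction inside an intersection of arcs until it hits the first end of one
of the arcs. -/
theorem exists_rotate_oriented {ι : Type*} [Finite ι] [Nonempty ι] {a b : ι → ℝ × ℝ}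
    (hp : ∀ i, Pointed (a i) (b i)) (hor : ∀ i, 0 ≤ br (a i) (b i)) {u : ℝ × ℝ} (hu : u ≠ 0)
    (h : ∀ i, InCone (a i) (b i) u) :
    ∃ i, ∀ z ∈ segment ℝ u (a i), z ≠ 0 ∧ ∀ j, InCone (a j) (b j) z := by
  have hc : ∀ i, 0 ≤ br (a i) u := by
    intro i
    obtain ⟨r, s, hr, hs, rfl⟩ := h i
    have : br (a i) (r • a i + s • b i) = s * br (a i) (b i) := by simp [br]; ring
    rw [this]
    exact mul_nonneg hs (hor i)
  -- If `u` is already parallel to a first end, pointedness makes the factor positive and the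
  -- segment stays on one ray.
  by_cases h0 : ∃ i, br (a i) u = 0
  · obtain ⟨i, hi⟩ := h0
    obtain ⟨κ, hκ, hku⟩ : ∃ κ : ℝ, 0 < κ ∧ a i = κ • u := by
      have ha := (hp i).left_ne
      obtain hv := eq_smul_of_br_eq_zero ha hi
      set c := ((a i).1 * u.1 + (a i).2 * u.2) / ((a i).1 ^ 2 + (a i).2 ^ 2) with hcdef
      obtain ⟨r, s, hr, hs, hrs⟩ := h i
      rcases lt_trichotomy c 0 with hneg | hz | hpos
      · have := hp i (r - c) s (by linarith) hs (by
          rw [sub_smul]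
          have : r • a i + s • b i = c • a i := by rw [← hrs]; exact hv
          rw [sub_add_eq_add_sub, this, sub_self])
        linarith [this.1]
      · rw [hz, zero_smul] at hv
        exact absurd hv hu
      · refine ⟨c⁻¹, by positivity, ?_⟩
        rw [hv, smul_smul, inv_mul_cancel₀ hpos.ne', one_smul]
    refine ⟨i, ?_⟩
    rintro z ⟨r, s, hr, hs, hrs, rfl⟩
    have hz : r • u + s • a i = (r + s * κ) • u := by rw [hku]; module
    have hpos : 0 < r + s * κ := by
      rcases hr.eq_or_lt with hr0 | hr0
      · have : s = 1 := by linarith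
        rw [this, ← hr0]; simpa using hκ
      · have := mul_nonneg hs hκ.le
        linarith
    rw [hz]
    exact ⟨smul_ne_zero hpos.ne' hu, fun j => (h j).smul hpos.le⟩
  · push Not at h0
    have hc' : ∀ i, 0 < br (a i) u := fun i => lt_of_le_of_ne (hc i) (Ne.symm (h0 i))
    -- The cotangent of the angle from `a i` to `u`. Its maximum belongs to the first end that is
    -- met first when `u` is turned clockwise.
    let f : ι → ℝ := fun i => ((a i).1 * u.1 + (a i).2 * u.2) / br (a i) u
    obtain ⟨i, hi⟩ := Finite.exists_max f
    have hcone : ∀ j, InCone (a j) (b j) (a i) := by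
      intro j
      have hn := sq_add_sq_pos hu
      have hij := hi j
      simp only [f] at hij
      have hk1 := hc' i
      have hk2 := hc' j
      rw [div_le_div_iff₀ hk2 hk1] at hij
      -- The nearest first end lies between `a j` and `u`, so it is a combination of these two with
      -- nonnegative coefficients.
      have key : a i = (br (a i) u / br (a j) u) • a j +
          ((((a i).1 * u.1 + (a i).2 * u.2) * br (a j) u - ((a j).1 * u.1 + (a j).2 * u.2) * br (a i) u) /
            (br (a j) u * (u.1 ^ 2 + u.2 ^ 2))) • u := by
        ext
        · simp only [Prod.fst_add, Prod.smul_fst, smul_eq_mul]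
          field_simp
          simp only [br]; ring
        · simp only [Prod.snd_add, Prod.smul_snd, smul_eq_mul]
          field_simp
          simp only [br]; ring
      rw [key]
      refine ((InCone.left _ _).smul (by positivity)).add ((h j).smul ?_)
      apply div_nonneg
      · linarith
      · positivity
    refine ⟨i, ?_⟩
    rintro z ⟨r, s, hr, hs, hrs, rfl⟩
    refine ⟨?_, fun j => ((h j).smul hr).add ((hcone j).smul hs)⟩
    intro hz
    have h1 : br (r • u + s • a i) u = s * br (a i) u := by simp [br]; ring
    rw [hz] at h1
    have h2 : s * br (a i) u = 0 := by rw [← h1]; simp [br]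
    have hs0 : s = 0 := (mul_eq_zero.1 h2).resolve_right (hc' i).ne'
    have hr1 : r = 1 := by linarith
    rw [hs0, hr1] at hz
    simp at hz
    exact hu hz

/-- A nonzero vector in all the arcs. -/
def ArcDom {ι : Type*} (a b : ι → ℝ × ℝ) : Set (ℝ × ℝ) :=
  {z | z ≠ 0 ∧ ∀ j, InArc (a j) (b j) z}

theorem ArcDom.neg {ι : Type*} {a b : ι → ℝ × ℝ} {z : ℝ × ℝ} (h : z ∈ ArcDom a b) :
    -z ∈ ArcDom a b := ⟨neg_ne_zero.2 h.1, fun j => (h.2 j).neg⟩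

/-- Turning always in the same direction stops at the first end of an arc in counterclockwise order.
This end depends only on the arc, so each arc contributes a single candidate instead of two. -/
theorem exists_rotate {ι : Type*} [Finite ι] [Nonempty ι] {a b : ι → ℝ × ℝ}
    (hp : ∀ i, Pointed (a i) (b i)) :
    ∃ c : ι → ℝ × ℝ, (∀ i, c i = a i ∨ c i = b i) ∧ ∀ u ∈ ArcDom a b,
      ∃ i, ∃ z, (z = c i ∨ z = -c i) ∧ segment ℝ u z ⊆ ArcDom a b := by
  classical
  let c : ι → ℝ × ℝ := fun i => if 0 ≤ br (a i) (b i) then a i else b i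
  let d : ι → ℝ × ℝ := fun i => if 0 ≤ br (a i) (b i) then b i else a i
  have hcd : ∀ i, (c i = a i ∧ d i = b i) ∨ (c i = b i ∧ d i = a i) := by
    intro i
    by_cases hi : 0 ≤ br (a i) (b i)
    · left; simp [c, d, hi]
    · right; simp [c, d, hi]
  have hor : ∀ i, 0 ≤ br (c i) (d i) := by
    intro i
    by_cases hi : 0 ≤ br (a i) (b i)
    · simp [c, d, hi]
    · have : br (b i) (a i) = - br (a i) (b i) := by simp [br]; ring
      simp only [c, d, hi, if_false, this]
      linarith
  have hpc : ∀ i, Pointed (c i) (d i) := by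
    intro i
    rcases hcd i with ⟨h1, h2⟩ | ⟨h1, h2⟩ <;> rw [h1, h2]
    · exact hp i
    · exact (hp i).symm
  refine ⟨c, fun i => (hcd i).imp And.left And.left, ?_⟩
  rintro u ⟨hu, h⟩
  have harc : ∀ i, InArc (c i) (d i) u := by
    intro i
    rcases hcd i with ⟨h1, h2⟩ | ⟨h1, h2⟩ <;> rw [h1, h2]
    · exact h i
    · exact (h i).symm
  -- A double cone is replaced by that one of its two halves which contains `u`.
  have hsgn : ∀ i, ∃ s : ℝ, (s = 1 ∨ s = -1) ∧ InCone (s • c i) (s • d i) u := by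
    intro i
    rcases harc i with hi | hi
    · exact ⟨1, Or.inl rfl, by simpa using hi⟩
    · refine ⟨-1, Or.inr rfl, ?_⟩
      obtain ⟨r, s, hr, hs, he⟩ := hi
      exact ⟨r, s, hr, hs, by
        rw [← neg_neg u, he]; module⟩
  choose s hs hsu using hsgn
  have hss : ∀ i, s i * s i = 1 := fun i => by rcases hs i with h | h <;> rw [h] <;> norm_num
  obtain ⟨i, hi⟩ := exists_rotate_oriented (a := fun i => s i • c i) (b := fun i => s i • d i)
    (fun i r q hr hq he => by
      apply hpc i r q hr hq
      have : r • c i + q • d i = s i • (r • s i • c i + q • s i • d i) := by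
        rcases hs i with h | h <;> rw [h] <;> module
      rw [this, he, smul_zero])
    (fun i => by
      have : br (s i • c i) (s i • d i) = s i * s i * br (c i) (d i) := by simp [br]; ring
      rw [this, hss, one_mul]; exact hor i) hu hsu
  refine ⟨i, s i • c i, ?_, ?_⟩
  · rcases hs i with h | h <;> rw [h] <;> simp
  · intro z hz
    obtain ⟨hz0, hzc⟩ := hi z hz
    refine ⟨hz0, fun j => ?_⟩
    have h1 : InArc (c j) (d j) z := by
      obtain ⟨r, q, hr, hq, he⟩ := hzc j
      rcases hs j with h | h
      · left; exact ⟨r, q, hr, hq, by rw [he, h]; simp⟩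
      · right; exact ⟨r, q, hr, hq, by rw [he, h]; module⟩
    rcases hcd j with ⟨e1, e2⟩ | ⟨e1, e2⟩
    · rwa [e1, e2] at h1
    · rw [e1, e2] at h1; exact h1.symm

/-- A family of lines over an intersection of arcs falls into at most as many classes as
there are arcs, represented by ends of the arcs. -/
theorem exists_arc_representatives {ι : Type*} [Fintype ι] [Nonempty ι] {a b : ι → ℝ × ℝ}
    (hp : ∀ i, Pointed (a i) (b i)) {Γ : ℝ × ℝ → Line3} {T : Set Line3}
    (hc : ContinuousOn Γ (ArcDom a b)) (hT : ∀ z ∈ ArcDom a b, Γ z ∈ T)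
    (hneg : ∀ z, z ≠ 0 → Γ (-z) = Γ z) :
    ∃ R : Finset Line3, R.card ≤ Fintype.card ι ∧
      (∀ M ∈ R, ∃ i, ∃ z, (z = a i ∨ z = b i) ∧ z ∈ ArcDom a b ∧ M = Γ z) ∧
      ∀ u ∈ ArcDom a b, ∃ M ∈ R, JoinedIn T (Γ u) M := by
  classical
  obtain ⟨c, hc1, hc2⟩ := exists_rotate hp
  refine ⟨(Finset.univ.filter fun i => c i ∈ ArcDom a b).image (fun i => Γ (c i)), ?_, ?_, ?_⟩
  · exact Finset.card_image_le.trans (Finset.card_le_univ _)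
  · intro M hM
    obtain ⟨i, hi, rfl⟩ := Finset.mem_image.1 hM
    exact ⟨i, c i, hc1 i, by simpa using hi, rfl⟩
  · intro u hu
    obtain ⟨i, z, hz, hseg⟩ := hc2 u hu
    have hzd : z ∈ ArcDom a b := hseg (right_mem_segment ..)
    have hcd : c i ∈ ArcDom a b := by
      rcases hz with rfl | rfl
      · exact hzd
      · simpa using ArcDom.neg hzd
    have hΓ : Γ z = Γ (c i) := by
      rcases hz with rfl | rfl
      · rfl
      · exact hneg _ hcd.1
    refine ⟨Γ (c i), Finset.mem_image.2 ⟨i, by simpa using hcd, rfl⟩, ?_⟩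
    rw [← hΓ]
    have hpc : IsPathConnected (segment ℝ u z) :=
      (convex_segment u z).isPathConnected ⟨u, left_mem_segment ..⟩
    have := (hpc.joinedIn u (left_mem_segment ..) z (right_mem_segment ..)).map_continuousOn
      (hc.mono hseg)
    exact this.mono (by rintro _ ⟨w, hw, rfl⟩; exact hT w (hseg hw))

end TriTangent

/-! ### Pencils of lines through a point -/

namespace TriTangent

open Set

theorem joinedIn_star {p : E3} {T : Set Line3} (h : ∀ v ≠ 0, ln p v ∈ T) {v w : E3}
    (hv : v ≠ 0) (hw : w ≠ 0) : JoinedIn T (ln p v) (ln p w) := by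
  have hpc : IsPathConnected ({0}ᶜ : Set E3) := by
    apply isPathConnected_compl_singleton_of_one_lt_rank
    rw [← Module.finrank_eq_rank]
    simp
  have hc : ContinuousOn (fun x => ln p x) ({0}ᶜ : Set E3) :=
    continuousOn_ln.comp (f := fun x => (p, x)) (by fun_prop) (fun x hx => hx)
  exact ((hpc.joinedIn v hv w hw).map_continuousOn hc).mono
    (by rintro _ ⟨x, hx, rfl⟩; exact h x hx)

/-- Seen from `p`, the segment spans the cone of `α` and `β`, and a line through `p` meets it in one
of its two directions. As `p` is off the segment, the meeting point is a nonzero multiple of the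
direction away from `p`. -/
theorem meets_pencil_iff {p : E3} {f : ℝ × ℝ →ₗ[ℝ] E3} (hf : Function.Injective f) {a b : E3}
    {α β : ℝ × ℝ} (ha : a = p + f α) (hb : b = p + f β) (hp : p ∉ segment ℝ a b) {w : ℝ × ℝ}
    (hw : w ≠ 0) : Meets (ln p (f w)) a b ↔ InArc α β w := by
  have hfw : f w ≠ 0 := fun h => hw (hf (by simpa using h))
  constructor
  · rintro ⟨x, ⟨r, s, hr, hs, hrs, rfl⟩, hx⟩
    obtain ⟨c, hc⟩ := (mem_ln hfw).1 hx
    have h1 : f (r • α + s • β) = f (c • w) := by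
      have : r • a + s • b = p + f (r • α + s • β) := by
        rw [ha, hb, map_add, map_smul, map_smul]
        have : p = (r + s) • p := by rw [hrs, one_smul]
        nth_rw 3 [this]
        module
      rw [this] at hc
      rw [add_left_cancel hc, map_smul]
    have h2 := hf h1
    have hc0 : c ≠ 0 := by
      rintro rfl
      apply hp
      exact ⟨r, s, hr, hs, hrs, by rw [hc]; simp⟩
    have h3 : w = (c⁻¹ * r) • α + (c⁻¹ * s) • β := by
      rw [mul_smul, mul_smul, ← smul_add, h2, smul_smul, inv_mul_cancel₀ hc0, one_smul]
    rcases hc0.lt_or_gt with hneg | hpos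
    · right
      have : c⁻¹ < 0 := inv_neg''.2 hneg
      exact ⟨-(c⁻¹ * r), -(c⁻¹ * s), by nlinarith, by nlinarith, by rw [h3]; module⟩
    · left
      exact ⟨c⁻¹ * r, c⁻¹ * s, by positivity, by positivity, h3⟩
  · have key : ∀ u : ℝ × ℝ, u ≠ 0 → InCone α β u → ∃ x ∈ segment ℝ a b, ∃ c : ℝ, x = p + c • f u := by
      rintro u hu ⟨r, s, hr, hs, rfl⟩
      have hpos : 0 < r + s := by
        rcases (add_nonneg hr hs).eq_or_lt with h | h
        · have hr0 : r = 0 := by linarith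
          have hs0 : s = 0 := by linarith
          simp [hr0, hs0] at hu
        · exact h
      refine ⟨(r / (r + s)) • a + (s / (r + s)) • b,
        ⟨_, _, by positivity, by positivity, by field_simp, rfl⟩, (r + s)⁻¹, ?_⟩
      rw [ha, hb, map_add, map_smul, map_smul]
      have : p = (r / (r + s) + s / (r + s)) • p := by
        rw [← add_div, div_self hpos.ne', one_smul]
      nth_rw 3 [this]
      module
    rintro (h | h)
    · obtain ⟨x, hx, c, hc⟩ := key w hw h
      exact ⟨x, hx, (mem_ln hfw).2 ⟨c, hc⟩⟩
    · obtain ⟨x, hx, c, hc⟩ := key (-w) (neg_ne_zero.2 hw) h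
      exact ⟨x, hx, (mem_ln hfw).2 ⟨-c, by rw [hc, map_neg]; module⟩⟩

theorem pointed_of_notMem_segment {p : E3} {f : ℝ × ℝ →ₗ[ℝ] E3} {a b : E3}
    {α β : ℝ × ℝ} (ha : a = p + f α) (hb : b = p + f β) (hp : p ∉ segment ℝ a b) :
    Pointed α β := by
  intro r s hr hs h
  by_contra hne
  have hpos : 0 < r + s := by
    rcases (add_nonneg hr hs).eq_or_lt with h | h
    · exact absurd ⟨by linarith, by linarith⟩ hne
    · exact h
  apply hp
  refine ⟨r / (r + s), s / (r + s), by positivity, by positivity, by field_simp, ?_⟩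
  have h1 : r • f α + s • f β = 0 := by rw [← map_smul, ← map_smul, ← map_add, h, map_zero]
  calc (r / (r + s)) • a + (s / (r + s)) • b
      = (r / (r + s) + s / (r + s)) • p + (r + s)⁻¹ • (r • f α + s • f β) := by
        rw [ha, hb]; module
    _ = p := by rw [h1, ← add_div, div_self hpos.ne']; simp

theorem ln_smul {p v : E3} (hv : v ≠ 0) {c : ℝ} (hc : c ≠ 0) : ln p (c • v) = ln p v :=
  eq_ln hv (left_mem_ln (smul_ne_zero hc hv))
    ((mem_ln (smul_ne_zero hc hv)).2 ⟨c⁻¹, by rw [smul_smul, inv_mul_cancel₀ hc, one_smul]⟩)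

theorem ln_neg {p v : E3} (hv : v ≠ 0) : ln p (-v) = ln p v := by
  rw [← neg_one_smul ℝ v, ln_smul hv (by norm_num)]

/-- A segment containing `p` imposes no condition, and each other segment imposes an arc of
directions. An end of an arc is the direction towards an end of a segment, whence the multiplicity
two. -/
theorem exists_pencil_representatives {t : Fin 4 → Affine.Triangle ℝ E3} {e : Fin 4 → Fin 3}
    {p : E3} {f : ℝ × ℝ →ₗ[ℝ] E3} (hf : Function.Injective f) {I : Finset (Fin 4)}
    (hI : I.Nonempty) {α β : Fin 4 → ℝ × ℝ} (hα : ∀ k ∈ I, cellA t e k = p + f (α k))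
    (hβ : ∀ k ∈ I, cellB t e k = p + f (β k))
    (hin : ∀ k ∈ I, p ∉ segment ℝ (cellA t e k) (cellB t e k))
    (hout : ∀ k ∉ I, p ∈ segment ℝ (cellA t e k) (cellB t e k)) :
    ∃ R : Finset Line3, R.card ≤ I.card ∧ (∀ M ∈ R, M ∈ cell t e ∧ 2 ≤ mult t M ∧ p ∈ M.1) ∧
      ∀ w ≠ 0, ln p (f w) ∈ cell t e → ∃ M ∈ R, JoinedIn (cell t e) (ln p (f w)) M := by
  have hf0 : ∀ w : ℝ × ℝ, w ≠ 0 → f w ≠ 0 := fun w hw h => hw (hf (by simpa using h))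
  have : Nonempty I := hI.to_subtype
  have hmem : ∀ w : ℝ × ℝ, w ≠ 0 → (ln p (f w) ∈ cell t e ↔
      w ∈ ArcDom (fun k : I => α k) (fun k : I => β k)) := by
    intro w hw
    constructor
    · intro h
      exact ⟨hw, fun k => (meets_pencil_iff hf (hα k k.2) (hβ k k.2) (hin k k.2) hw).1 (h k)⟩
    · intro h k
      by_cases hk : k ∈ I
      · exact (meets_pencil_iff hf (hα k hk) (hβ k hk) (hin k hk) hw).2 (h.2 ⟨k, hk⟩)
      · exact ⟨p, hout k hk, left_mem_ln (hf0 w hw)⟩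
  obtain ⟨R, h1, h2, h3⟩ := exists_arc_representatives (a := fun k : I => α k)
    (b := fun k : I => β k) (Γ := fun w => ln p (f w)) (T := cell t e)
    (fun k => pointed_of_notMem_segment (hα k k.2) (hβ k k.2) (hin k k.2))
    (continuousOn_ln.comp (f := fun w => (p, f w))
      (by have := f.continuous_of_finiteDimensional; fun_prop) (fun w hw => hf0 w hw.1))
    (fun z hz => (hmem z hz.1).2 hz)
    (fun z hz => by rw [map_neg, ln_neg (hf0 z hz)])
  refine ⟨R, by simpa using h1, ?_, fun w hw h => h3 w ((hmem w hw).1 h)⟩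
  intro M hM
  obtain ⟨i, z, hz, hzd, rfl⟩ := h2 M hM
  have hc := (hmem z hzd.1).2 hzd
  refine ⟨hc, two_le_mult hc (k := i) ?_, left_mem_ln (hf0 z hzd.1)⟩
  rcases hz with rfl | rfl
  · left
    rw [hα i i.2, mem_ln (hf0 _ hzd.1)]
    exact ⟨1, by simp⟩
  · right
    rw [hβ i i.2, mem_ln (hf0 _ hzd.1)]
    exact ⟨1, by simp⟩

/-! ### Coordinates adapted to two skew segments -/

/-- Four points lie in a common plane. -/
def Cop (a b c d : E3) : Prop :=
  ∃ f : E3 →ₗ[ℝ] ℝ, f ≠ 0 ∧ ∃ k : ℝ, f a = k ∧ f b = k ∧ f c = k ∧ f d = k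

/-- Barycentric coordinates with respect to four points, split into two pairs. -/
structure Frame (a b c d : E3) where
  Y : E3 →ᵃ[ℝ] ℝ × ℝ
  W : E3 →ᵃ[ℝ] ℝ × ℝ
  sum : ∀ x, (Y x).1 + (Y x).2 + (W x).1 + (W x).2 = 1
  comb : ∀ x, x = (Y x).1 • a + (Y x).2 • b + (W x).1 • c + (W x).2 • d
  Ya : Y a = (1, 0)
  Yb : Y b = (0, 1)
  Yc : Y c = 0
  Yd : Y d = 0
  Wa : W a = 0
  Wb : W b = 0
  Wc : W c = (1, 0)
  Wd : W d = (0, 1)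

theorem Frame.exists_of_not_cop {a b c d : E3} (h : ¬ Cop a b c d) : Nonempty (Frame a b c d) := by
  have hli : LinearIndependent ℝ ![b - a, c - a, d - a] := by
    by_contra hli
    apply h
    have hne : Submodule.span ℝ (Set.range ![b - a, c - a, d - a]) ≠ ⊤ := by
      intro htop
      exact hli (linearIndependent_of_top_le_span_of_card_eq_finrank htop.ge (by simp))
    obtain ⟨f, hf, hle⟩ := Submodule.exists_le_ker_of_lt_top _ (lt_top_iff_ne_top.2 hne)
    have hz : ∀ i : Fin 3, f (![b - a, c - a, d - a] i) = 0 := fun i =>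
      hle (Submodule.subset_span ⟨i, rfl⟩)
    have h0 := hz 0
    have h1 := hz 1
    have h2 := hz 2
    simp only [Matrix.cons_val_zero, Matrix.cons_val_one, Matrix.cons_val, map_sub] at h0 h1 h2
    exact ⟨f, hf, f a, rfl, by linarith, by linarith, by linarith⟩
  let B := basisOfLinearIndependentOfCardEqFinrank hli (by simp)
  have hB0 : B 0 = b - a := by simp [B]
  have hB1 : B 1 = c - a := by simp [B]
  have hB2 : B 2 = d - a := by simp [B]
  let ly : E3 →ₗ[ℝ] ℝ × ℝ := (-(B.coord 0 + B.coord 1 + B.coord 2)).prod (B.coord 0)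
  let lw : E3 →ₗ[ℝ] ℝ × ℝ := (B.coord 1).prod (B.coord 2)
  have co : ∀ i j : Fin 3, B.coord i (B j) = if j = i then 1 else 0 := by
    intro i j
    rw [Module.Basis.coord_apply, Module.Basis.repr_self, Finsupp.single_apply]
  let Y : E3 →ᵃ[ℝ] ℝ × ℝ := ⟨fun x => ly (x - a) + (1, 0), ly, fun p v => by
    simp only [vadd_eq_add]; rw [add_sub_assoc, map_add]; abel⟩
  let W : E3 →ᵃ[ℝ] ℝ × ℝ := ⟨fun x => lw (x - a), lw, fun p v => by
    simp only [vadd_eq_add]; rw [add_sub_assoc, map_add]⟩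
  have hY : ∀ x, Y x = ly (x - a) + (1, 0) := fun _ => rfl
  have hW : ∀ x, W x = lw (x - a) := fun _ => rfl
  have hly : ∀ v, ly v = (-(B.repr v 0 + B.repr v 1 + B.repr v 2), B.repr v 0) := fun _ => rfl
  have hlw : ∀ v, lw v = (B.repr v 1, B.repr v 2) := fun _ => rfl
  refine ⟨⟨Y, W, ?_, ?_, ?_, ?_, ?_, ?_, ?_, ?_, ?_, ?_⟩⟩
  · intro x
    simp only [hY, hW, hly, hlw, Prod.fst_add, Prod.snd_add]
    ring
  · intro x
    have h1 := B.sum_repr (x - a)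
    rw [Fin.sum_univ_three, hB0, hB1, hB2] at h1
    have h2 : x = a + (x - a) := by abel
    nth_rw 1 [h2]
    nth_rw 1 [← h1]
    simp only [hY, hW, hly, hlw, Prod.fst_add, Prod.snd_add]
    module
  · rw [hY, sub_self, map_zero, zero_add]
  · rw [hY, ← hB0]
    simp [ly, co]
  · rw [hY, ← hB1]
    simp [ly, co]
  · rw [hY, ← hB2]
    simp [ly, co]
  · rw [hW, sub_self, map_zero]
  · rw [hW, ← hB0]
    simp [lw, co]
  · rw [hW, ← hB1]
    simp [lw, co]
  · rw [hW, ← hB2]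
    simp [lw, co]

namespace Frame

variable {a b c d : E3} (F : Frame a b c d)

theorem Y_comb {r₁ r₂ r₃ r₄ : ℝ} (h : r₁ + r₂ + r₃ + r₄ = 1) :
    F.Y (r₁ • a + r₂ • b + r₃ • c + r₄ • d) = (r₁, r₂) := by
  have key : ∀ x, F.Y x = F.Y.linear x + F.Y 0 := fun x => congrFun F.Y.decomp x
  have ha := F.Ya; have hb := F.Yb; have hc := F.Yc; have hd := F.Yd
  rw [key] at ha hb hc hd ⊢
  simp only [map_add, map_smul]
  have : F.Y 0 = r₁ • F.Y 0 + r₂ • F.Y 0 + r₃ • F.Y 0 + r₄ • F.Y 0 := by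
    rw [← add_smul, ← add_smul, ← add_smul, h, one_smul]
  rw [this]
  calc _ = r₁ • (F.Y.linear a + F.Y 0) + r₂ • (F.Y.linear b + F.Y 0) +
        r₃ • (F.Y.linear c + F.Y 0) + r₄ • (F.Y.linear d + F.Y 0) := by module
    _ = _ := by rw [ha, hb, hc, hd]; simp

theorem W_comb {r₁ r₂ r₃ r₄ : ℝ} (h : r₁ + r₂ + r₃ + r₄ = 1) :
    F.W (r₁ • a + r₂ • b + r₃ • c + r₄ • d) = (r₃, r₄) := by
  have key : ∀ x, F.W x = F.W.linear x + F.W 0 := fun x => congrFun F.W.decomp x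
  have ha := F.Wa; have hb := F.Wb; have hc := F.Wc; have hd := F.Wd
  rw [key] at ha hb hc hd ⊢
  simp only [map_add, map_smul]
  have : F.W 0 = r₁ • F.W 0 + r₂ • F.W 0 + r₃ • F.W 0 + r₄ • F.W 0 := by
    rw [← add_smul, ← add_smul, ← add_smul, h, one_smul]
  rw [this]
  calc _ = r₁ • (F.W.linear a + F.W 0) + r₂ • (F.W.linear b + F.W 0) +
        r₃ • (F.W.linear c + F.W 0) + r₄ • (F.W.linear d + F.W 0) := by module
    _ = _ := by rw [ha, hb, hc, hd]; simp

theorem affine_comb (f : E3 →ᵃ[ℝ] ℝ × ℝ) {r s : ℝ} (h : r + s = 1) (u v : E3) :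
    f (r • u + s • v) = r • f u + s • f v := by
  have key : ∀ x, f x = f.linear x + f 0 := fun x => congrFun f.decomp x
  rw [key, key u, key v, map_add, map_smul, map_smul]
  have : f 0 = r • f 0 + s • f 0 := by rw [← add_smul, h, one_smul]
  nth_rw 1 [this]
  module

/-- Parallel vectors `F.Y u` and `F.Y v` lie on a line through the origin. Its preimage under `F.Y`
is a plane, which contains `c` and `d` because `F.Y` vanishes there. -/
theorem cop_right_of_br_eq_zero {u v : E3} (h : br (F.Y u) (F.Y v) = 0) : Cop u v c d := by
  obtain ⟨m, hm, h1, h2⟩ : ∃ m : ℝ × ℝ, m ≠ 0 ∧ m.1 * (F.Y u).1 + m.2 * (F.Y u).2 = 0 ∧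
      m.1 * (F.Y v).1 + m.2 * (F.Y v).2 = 0 := by
    unfold br at h
    by_cases hu : F.Y u = 0
    · by_cases hv : F.Y v = 0
      · exact ⟨(1, 0), by simp, by simp [hu], by simp [hv]⟩
      · refine ⟨((F.Y v).2, -(F.Y v).1), fun h0 => hv ?_, by simp [hu], by ring⟩
        rw [Prod.mk_eq_zero] at h0
        exact Prod.ext (by simpa using h0.2) h0.1
    · refine ⟨((F.Y u).2, -(F.Y u).1), fun h0 => hu ?_, by ring, by linarith⟩
      rw [Prod.mk_eq_zero] at h0
      exact Prod.ext (by simpa using h0.2) h0.1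
  have key : ∀ x, F.Y x = F.Y.linear x + F.Y 0 := fun x => congrFun F.Y.decomp x
  let φ : ℝ × ℝ →ₗ[ℝ] ℝ := m.1 • LinearMap.fst ℝ ℝ ℝ + m.2 • LinearMap.snd ℝ ℝ ℝ
  have hφ : ∀ z, φ z = m.1 * z.1 + m.2 * z.2 := fun z => by simp [φ]
  have hval : ∀ x, φ (F.Y.linear x) = φ (F.Y x) - φ (F.Y 0) := fun x => by
    rw [key x, map_add]; ring
  refine ⟨φ.comp F.Y.linear, ?_, -φ (F.Y 0), ?_, ?_, ?_, ?_⟩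
  · intro h0
    have hall : ∀ x, φ (F.Y x) = φ (F.Y 0) := fun x => by
      have := hval x
      rw [← LinearMap.comp_apply, h0, LinearMap.zero_apply] at this
      linarith
    have e1 := hall a
    have e2 := hall b
    have e3 := hall c
    rw [F.Ya, hφ] at e1
    rw [F.Yb, hφ] at e2
    rw [F.Yc, hφ] at e3
    simp only [Prod.fst_zero, Prod.snd_zero, mul_zero, add_zero, mul_one, zero_add] at e1 e2 e3
    exact hm (Prod.ext (by rw [e1, ← e3]; rfl) (by rw [e2, ← e3]; rfl))
  · rw [LinearMap.comp_apply, hval, hφ (F.Y u), h1, zero_sub]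
  · rw [LinearMap.comp_apply, hval, hφ (F.Y v), h2, zero_sub]
  · rw [LinearMap.comp_apply, hval, F.Yc, map_zero, zero_sub]
  · rw [LinearMap.comp_apply, hval, F.Yd, map_zero, zero_sub]

/-- Exchanging the two pairs. -/
def swap : Frame c d a b where
  Y := F.W
  W := F.Y
  sum x := by have := F.sum x; linarith
  comb x := by have := F.comb x; nth_rw 1 [this]; module
  Ya := F.Wc
  Yb := F.Wd
  Yc := F.Wa
  Yd := F.Wb
  Wa := F.Yc
  Wb := F.Yd
  Wc := F.Ya
  Wd := F.Yb

theorem cop_left_of_br_eq_zero {u v : E3} (h : br (F.W u) (F.W v) = 0) : Cop u v a b :=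
  F.swap.cop_right_of_br_eq_zero h

/-- The point of the line `ab` with homogeneous coordinates `y`. -/
noncomputable def pt (a b : E3) (y : ℝ × ℝ) : E3 := (y.1 + y.2)⁻¹ • (y.1 • a + y.2 • b)

theorem Y_pt_left {y : ℝ × ℝ} (hy : y.1 + y.2 ≠ 0) : F.Y (pt a b y) = (y.1 + y.2)⁻¹ • y := by
  have : pt a b y = ((y.1 + y.2)⁻¹ * y.1) • a + ((y.1 + y.2)⁻¹ * y.2) • b + (0 : ℝ) • c +
      (0 : ℝ) • d := by rw [pt]; module
  rw [this, F.Y_comb (by field_simp; ring)]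
  rfl

theorem W_pt_left {y : ℝ × ℝ} (hy : y.1 + y.2 ≠ 0) : F.W (pt a b y) = 0 := by
  have : pt a b y = ((y.1 + y.2)⁻¹ * y.1) • a + ((y.1 + y.2)⁻¹ * y.2) • b + (0 : ℝ) • c +
      (0 : ℝ) • d := by rw [pt]; module
  rw [this, F.W_comb (by field_simp; ring)]
  rfl

theorem Y_pt_right {w : ℝ × ℝ} (hw : w.1 + w.2 ≠ 0) : F.Y (pt c d w) = 0 := F.swap.W_pt_left hw

theorem W_pt_right {w : ℝ × ℝ} (hw : w.1 + w.2 ≠ 0) : F.W (pt c d w) = (w.1 + w.2)⁻¹ • w :=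
  F.swap.Y_pt_left hw

theorem pt_sub_pt_ne (F : Frame a b c d) {y w : ℝ × ℝ} (hy : y.1 + y.2 ≠ 0) (hw : w.1 + w.2 ≠ 0) :
    pt c d w - pt a b y ≠ 0 := by
  intro h
  have h1 := congrArg F.Y (sub_eq_zero.1 h)
  rw [F.Y_pt_left hy, F.Y_pt_right hw] at h1
  have h2 := (smul_eq_zero.1 h1.symm).resolve_left (inv_ne_zero hy)
  rw [h2] at hy
  simp at hy

/-- The line joining the points with homogeneous coordinates `y` and `w` of the two base lines. -/
noncomputable def join (a b c d : E3) (y w : ℝ × ℝ) : Line3 :=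
  ln (pt a b y) (pt c d w - pt a b y)

/-- Incidence becomes linear: on a line with feet `y` and `w`, the `F.Y` part stays proportional to
`y` and the `F.W` part to `w`, and barycentric coordinates recover the point. -/
theorem mem_join {y w : ℝ × ℝ} (hy : y.1 + y.2 ≠ 0) (hw : w.1 + w.2 ≠ 0) {x : E3} :
    x ∈ (join a b c d y w).1 ↔ ∃ r s : ℝ, F.Y x = r • y ∧ F.W x = s • w := by
  rw [join, mem_ln (F.pt_sub_pt_ne hy hw)]
  constructor
  · rintro ⟨τ, rfl⟩
    have : pt a b y + τ • (pt c d w - pt a b y) = (1 - τ) • pt a b y + τ • pt c d w := by module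
    rw [this, affine_comb _ (by ring), affine_comb _ (by ring), F.Y_pt_left hy, F.W_pt_left hy,
      F.Y_pt_right hw, F.W_pt_right hw]
    exact ⟨(1 - τ) * (y.1 + y.2)⁻¹, τ * (w.1 + w.2)⁻¹, by module, by module⟩
  · rintro ⟨r, s, hr, hs⟩
    have hsum := F.sum x
    rw [hr, hs] at hsum
    simp only [Prod.smul_fst, Prod.smul_snd, smul_eq_mul] at hsum
    refine ⟨s * (w.1 + w.2), ?_⟩
    have h1 : pt a b y + (s * (w.1 + w.2)) • (pt c d w - pt a b y) =
        (1 - s * (w.1 + w.2)) • pt a b y + (s * (w.1 + w.2)) • pt c d w := by module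
    have h2 : 1 - s * (w.1 + w.2) = r * (y.1 + y.2) := by linarith
    have h3 : (r * (y.1 + y.2)) * (y.1 + y.2)⁻¹ = r := by field_simp
    have h4 : (s * (w.1 + w.2)) * (w.1 + w.2)⁻¹ = s := by field_simp
    rw [h1, h2, pt, pt, smul_smul, smul_smul, h3, h4]
    have := F.comb x
    rw [hr, hs] at this
    rw [this]
    simp only [Prod.smul_fst, Prod.smul_snd, smul_eq_mul]
    module

theorem join_eq {y y' w w' : ℝ × ℝ} (hy : y.1 + y.2 ≠ 0) (hw : w.1 + w.2 ≠ 0)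
    {r s : ℝ} (hr : r ≠ 0) (hs : s ≠ 0) (h1 : y' = r • y) (h2 : w' = s • w) :
    join a b c d y' w' = join a b c d y w := by
  have hy' : y'.1 + y'.2 = r * (y.1 + y.2) := by rw [h1]; simp; ring
  have hw' : w'.1 + w'.2 = s * (w.1 + w.2) := by rw [h2]; simp; ring
  have e1 : pt a b y' = pt a b y := by
    rw [pt, pt, hy', h1]
    simp only [Prod.smul_fst, Prod.smul_snd, smul_eq_mul, mul_smul, ← smul_add]
    rw [smul_smul, mul_inv]
    congr 1
    field_simp
  have e2 : pt c d w' = pt c d w := by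
    rw [pt, pt, hw', h2]
    simp only [Prod.smul_fst, Prod.smul_snd, smul_eq_mul, mul_smul, ← smul_add]
    rw [smul_smul, mul_inv]
    congr 1
    field_simp
  rw [join, join, e1, e2]

/-- A transversal of the two base segments in normal form. -/
theorem exists_eq_join (F : Frame a b c d) {L : Line3} (h1 : Meets L a b) (h2 : Meets L c d) :
    ∃ y w : ℝ × ℝ, 0 ≤ y.1 ∧ 0 ≤ y.2 ∧ y.1 + y.2 = 1 ∧ 0 ≤ w.1 ∧ 0 ≤ w.2 ∧ w.1 + w.2 = 1 ∧
      L = join a b c d y w := by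
  obtain ⟨P, ⟨r, s, hr, hs, hrs, hP⟩, hPL⟩ := h1
  obtain ⟨Q, ⟨r', s', hr', hs', hrs', hQ⟩, hQL⟩ := h2
  refine ⟨(r, s), (r', s'), hr, hs, hrs, hr', hs', hrs', ?_⟩
  have e1 : pt a b (r, s) = P := by simp [pt, hrs, hP]
  have e2 : pt c d (r', s') = Q := by simp [pt, hrs', hQ]
  have hne := F.pt_sub_pt_ne (y := (r, s)) (w := (r', s')) (by simp [hrs]) (by simp [hrs'])
  rw [join]
  refine eq_ln hne (by rwa [e1]) ?_
  rw [add_sub_cancel, e2]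
  exact hQL

end Frame

end TriTangent

/-! ### Projectivities between feet, quadratic forms and reguli -/

namespace TriTangent

open Set

theorem br_self (u : ℝ × ℝ) : br u u = 0 := by simp [br]; ring

theorem ne_zero_of_br_ne_left {u v : ℝ × ℝ} (h : br u v ≠ 0) : u ≠ 0 := by
  rintro rfl; simp [br] at h

theorem ne_zero_of_br_ne_right {u v : ℝ × ℝ} (h : br u v ≠ 0) : v ≠ 0 := by
  rintro rfl; simp [br] at h

theorem exists_smul_of_br_eq_zero {u v : ℝ × ℝ} (hu : u ≠ 0) (h : br u v = 0) :
    ∃ c : ℝ, v = c • u := ⟨_, eq_smul_of_br_eq_zero hu h⟩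

namespace Frame

variable {a b c d : E3} (F : Frame a b c d)

theorem join_neg (y w : ℝ × ℝ) : join a b c d (-y) (-w) = join a b c d y w := by
  have : ∀ (a b : E3) (y : ℝ × ℝ), pt a b (-y) = pt a b y := by
    intro a b y
    simp only [pt, Prod.fst_neg, Prod.snd_neg]
    rw [← neg_add, inv_neg]
    module
  rw [join, join, this, this]

theorem eq_pt_of_mem_join {y w : ℝ × ℝ} (hy : y.1 + y.2 ≠ 0) (hw : w.1 + w.2 ≠ 0) {x : E3}
    (hx : x ∈ (join a b c d y w).1) (hW : F.W x = 0) : x = pt a b y := by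
  obtain ⟨r, s, hr, hs⟩ := (F.mem_join hy hw).1 hx
  have h1 := F.sum x
  have h2 := F.comb x
  rw [hW, hr] at h1 h2
  simp only [Prod.smul_fst, Prod.smul_snd, smul_eq_mul, Prod.fst_zero, Prod.snd_zero, add_zero,
    zero_smul] at h1 h2
  have h3 : r = (y.1 + y.2)⁻¹ := by
    field_simp; linarith
  rw [h2, pt, ← h3]
  module

theorem eq_pt_of_mem_join' {y w : ℝ × ℝ} (hy : y.1 + y.2 ≠ 0) (hw : w.1 + w.2 ≠ 0) {x : E3}
    (hx : x ∈ (join a b c d y w).1) (hY : F.Y x = 0) : x = pt c d w := by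
  obtain ⟨r, s, hr, hs⟩ := (F.mem_join hy hw).1 hx
  have h1 := F.sum x
  have h2 := F.comb x
  rw [hY, hs] at h1 h2
  simp only [Prod.smul_fst, Prod.smul_snd, smul_eq_mul, Prod.fst_zero, Prod.snd_zero, zero_add,
    zero_smul] at h1 h2
  have h3 : s = (w.1 + w.2)⁻¹ := by
    field_simp; linarith
  rw [h2, pt, ← h3]
  module

/-- The projectivity `w ↦ y` such that the line joining `y` and `w` meets the line `uv`. -/
noncomputable def pj (u v : E3) : ℝ × ℝ →ₗ[ℝ] ℝ × ℝ where
  toFun w := br w (F.W v) • F.Y u + br (F.W u) w • F.Y v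
  map_add' w z := by
    ext <;> simp [br] <;> ring
  map_smul' r w := by
    ext <;> simp [br] <;> ring

theorem pj_apply (u v : E3) (w : ℝ × ℝ) :
    F.pj u v w = br w (F.W v) • F.Y u + br (F.W u) w • F.Y v := rfl

theorem pj_comb (u v : E3) (r s : ℝ) : F.pj u v (r • F.W u + s • F.W v) =
    br (F.W u) (F.W v) • (r • F.Y u + s • F.Y v) := by
  rw [pj_apply]
  ext <;> simp [br] <;> ring

theorem pj_left (u v : E3) : F.pj u v (F.W u) = br (F.W u) (F.W v) • F.Y u := by
  have := F.pj_comb u v 1 0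
  simpa using this

theorem pj_right (u v : E3) : F.pj u v (F.W v) = br (F.W u) (F.W v) • F.Y v := by
  have := F.pj_comb u v 0 1
  simpa using this

/-- The determinant of the projectivity: it is invertible exactly when the segment `uv` is coplanar
with neither base segment. -/
theorem br_pj (u v : E3) (p q : ℝ × ℝ) : br (F.pj u v p) (F.pj u v q) =
    br (F.W u) (F.W v) * br (F.Y u) (F.Y v) * br p q := by
  rw [pj_apply, pj_apply]
  simp [br]
  ring

theorem pj_injective {u v : E3} (hW : br (F.W u) (F.W v) ≠ 0) (hY : br (F.Y u) (F.Y v) ≠ 0) :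
    Function.Injective (F.pj u v) := by
  rw [injective_iff_map_eq_zero]
  intro p hp
  by_contra hne
  have h1 : ∀ q, br p q = 0 := by
    intro q
    have := F.br_pj u v p q
    rw [hp] at this
    have h0 : br (0 : ℝ × ℝ) (F.pj u v q) = 0 := by simp [br]
    rw [h0] at this
    exact (mul_eq_zero.1 this.symm).resolve_left (mul_ne_zero hW hY)
  have e1 := h1 (1, 0)
  have e2 := h1 (0, 1)
  simp [br] at e1 e2
  exact hne (Prod.ext e2 e1)

/-- A line in normal form meeting a segment skew to both base lines. -/
theorem of_meets_join {u v : E3} (hW : br (F.W u) (F.W v) ≠ 0) (hY : br (F.Y u) (F.Y v) ≠ 0)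
    {y w : ℝ × ℝ} (hy : y.1 + y.2 ≠ 0) (hw : w.1 + w.2 ≠ 0)
    (h : Meets (join a b c d y w) u v) :
    InArc (F.W u) (F.W v) w ∧ ∃ κ : ℝ, κ ≠ 0 ∧ F.pj u v w = κ • y := by
  obtain ⟨x, ⟨r, s, hr, hs, hrs, rfl⟩, hx⟩ := h
  obtain ⟨ρ, σ, h1, h2⟩ := (F.mem_join hy hw).1 hx
  rw [affine_comb _ hrs] at h1 h2
  have hσ : σ ≠ 0 := by
    rintro rfl
    rw [zero_smul] at h2
    have := pointed_of_br_ne hW r s hr hs h2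
    linarith [this.1, this.2]
  have hρ : ρ ≠ 0 := by
    rintro rfl
    rw [zero_smul] at h1
    have := pointed_of_br_ne hY r s hr hs h1
    linarith [this.1, this.2]
  have hwe : w = σ⁻¹ • (r • F.W u + s • F.W v) := by
    rw [h2, smul_smul, inv_mul_cancel₀ hσ, one_smul]
  constructor
  · rw [hwe]
    exact InArc.smul (Or.inl ⟨r, s, hr, hs, rfl⟩) _
  -- The meeting point has the same coefficients in both parts of the coordinates, and `pj` carries
  -- the `F.W` part to the `F.Y` part up to the determinant.
  · refine ⟨σ⁻¹ * br (F.W u) (F.W v) * ρ, by positivity, ?_⟩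
    rw [hwe, map_smul, pj_comb, h1, smul_smul, smul_smul]

end Frame

theorem exists_finset_of_no_three {S : Set Line3}
    (h : ∀ a ∈ S, ∀ b ∈ S, ∀ c ∈ S, a = b ∨ a = c ∨ b = c) :
    ∃ R : Finset Line3, R.card ≤ 2 ∧ (∀ L ∈ R, L ∈ S) ∧ ∀ L ∈ S, L ∈ R := by
  classical
  rcases S.eq_empty_or_nonempty with rfl | ⟨a, ha⟩
  · exact ⟨∅, by simp, by simp, by simp⟩
  by_cases hb : ∃ b ∈ S, a ≠ b
  · obtain ⟨b, hb, hab⟩ := hb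
    refine ⟨{a, b}, Finset.card_le_two, by simp [ha, hb], ?_⟩
    intro c hc
    rcases h a ha b hb c hc with h | h | h
    · exact absurd h hab
    · simp [h]
    · simp [h]
  · push Not at hb
    exact ⟨{a}, by simp, by simpa using ha, fun L hL => by simp [← hb L hL]⟩

/-- A nonzero binary quadratic form has at most two roots up to scaling. -/
theorem quadratic_eq_zero_of_three {A B C : ℝ} {u v w : ℝ × ℝ} (huv : br u v ≠ 0)
    (huw : br u w ≠ 0) (hvw : br v w ≠ 0) (hu : A * u.1 ^ 2 + B * u.1 * u.2 + C * u.2 ^ 2 = 0)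
    (hv : A * v.1 ^ 2 + B * v.1 * v.2 + C * v.2 ^ 2 = 0)
    (hw : A * w.1 ^ 2 + B * w.1 * w.2 + C * w.2 ^ 2 = 0) : A = 0 ∧ B = 0 ∧ C = 0 := by
  -- The polar form of `u` and `v` vanishes: expand the form at `br u v • w = br w v • u + br u w •
  -- v`. The three coefficients are then recovered in the basis `u`, `v`.
  have hP : 2 * A * u.1 * v.1 + B * (u.1 * v.2 + u.2 * v.1) + 2 * C * u.2 * v.2 = 0 := by
    have : br u w * br w v * (2 * A * u.1 * v.1 + B * (u.1 * v.2 + u.2 * v.1) + 2 * C * u.2 * v.2)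
        = 0 := by
      have : br u w * br w v * (2 * A * u.1 * v.1 + B * (u.1 * v.2 + u.2 * v.1)
          + 2 * C * u.2 * v.2) = br u v ^ 2 * (A * w.1 ^ 2 + B * w.1 * w.2 + C * w.2 ^ 2)
          - br w v ^ 2 * (A * u.1 ^ 2 + B * u.1 * u.2 + C * u.2 ^ 2)
          - br u w ^ 2 * (A * v.1 ^ 2 + B * v.1 * v.2 + C * v.2 ^ 2) := by
        simp only [br]; ring
      rw [this, hu, hv, hw]; ring
    have hwv : br w v ≠ 0 := by
      have : br w v = - br v w := by simp [br]; ring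
      rw [this]; exact neg_ne_zero.2 hvw
    exact (mul_eq_zero.1 this).resolve_left (mul_ne_zero huw hwv)
  have h2 : br u v ^ 2 ≠ 0 := pow_ne_zero 2 huv
  refine ⟨?_, ?_, ?_⟩
  · apply (mul_eq_zero.1 (_ : br u v ^ 2 * A = 0)).resolve_left h2
    have : br u v ^ 2 * A = v.2 ^ 2 * (A * u.1 ^ 2 + B * u.1 * u.2 + C * u.2 ^ 2)
      - u.2 * v.2 * (2 * A * u.1 * v.1 + B * (u.1 * v.2 + u.2 * v.1) + 2 * C * u.2 * v.2)
      + u.2 ^ 2 * (A * v.1 ^ 2 + B * v.1 * v.2 + C * v.2 ^ 2) := by simp only [br]; ring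
    rw [this, hu, hv, hP]; ring
  · apply (mul_eq_zero.1 (_ : br u v ^ 2 * B = 0)).resolve_left h2
    have : br u v ^ 2 * B = -2 * v.1 * v.2 * (A * u.1 ^ 2 + B * u.1 * u.2 + C * u.2 ^ 2)
      + (u.1 * v.2 + u.2 * v.1) * (2 * A * u.1 * v.1 + B * (u.1 * v.2 + u.2 * v.1)
        + 2 * C * u.2 * v.2)
      - 2 * u.1 * u.2 * (A * v.1 ^ 2 + B * v.1 * v.2 + C * v.2 ^ 2) := by simp only [br]; ring
    rw [this, hu, hv, hP]; ring
  · apply (mul_eq_zero.1 (_ : br u v ^ 2 * C = 0)).resolve_left h2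
    have : br u v ^ 2 * C = v.1 ^ 2 * (A * u.1 ^ 2 + B * u.1 * u.2 + C * u.2 ^ 2)
      - u.1 * v.1 * (2 * A * u.1 * v.1 + B * (u.1 * v.2 + u.2 * v.1) + 2 * C * u.2 * v.2)
      + u.1 ^ 2 * (A * v.1 ^ 2 + B * v.1 * v.2 + C * v.2 ^ 2) := by simp only [br]; ring
    rw [this, hu, hv, hP]; ring

theorem bilinear_eq_zero_of_three (M N : ℝ × ℝ →ₗ[ℝ] ℝ × ℝ) {u v w : ℝ × ℝ} (huv : br u v ≠ 0)
    (huw : br u w ≠ 0) (hvw : br v w ≠ 0) (hu : br (M u) (N u) = 0) (hv : br (M v) (N v) = 0)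
    (hw : br (M w) (N w) = 0) (z : ℝ × ℝ) : br (M z) (N z) = 0 := by
  have key : ∀ z : ℝ × ℝ, br (M z) (N z) = br (M (1, 0)) (N (1, 0)) * z.1 ^ 2 +
      (br (M (1, 0)) (N (0, 1)) + br (M (0, 1)) (N (1, 0))) * z.1 * z.2 +
      br (M (0, 1)) (N (0, 1)) * z.2 ^ 2 := by
    intro z
    have hz : z = z.1 • (1, 0) + z.2 • (0, 1) := by ext <;> simp
    have e1 : M z = z.1 • M (1, 0) + z.2 • M (0, 1) := by
      rw [← map_smul, ← map_smul, ← map_add, ← hz]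
    have e2 : N z = z.1 • N (1, 0) + z.2 • N (0, 1) := by
      rw [← map_smul, ← map_smul, ← map_add, ← hz]
    rw [e1, e2]
    simp [br]
    ring
  rw [key] at hu hv hw ⊢
  obtain ⟨h1, h2, h3⟩ := quadratic_eq_zero_of_three huv huw hvw hu hv hw
  rw [h1, h2, h3]; ring

/-- Injective endomorphisms of the plane that are everywhere parallel are proportional. -/
theorem exists_smul_of_forall_parallel {M N : ℝ × ℝ →ₗ[ℝ] ℝ × ℝ} (hM : Function.Injective M)
    (hN : Function.Injective N) (h : ∀ z, br (M z) (N z) = 0) :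
    ∃ κ : ℝ, κ ≠ 0 ∧ ∀ z, N z = κ • M z := by
  have hM0 : ∀ z, z ≠ 0 → M z ≠ 0 := fun z hz h => hz (hM (by simpa using h))
  have hN0 : ∀ z, z ≠ 0 → N z ≠ 0 := fun z hz h => hz (hN (by simpa using h))
  obtain ⟨k1, h1⟩ := exists_smul_of_br_eq_zero (hM0 (1, 0) (by simp)) (h (1, 0))
  obtain ⟨k2, h2⟩ := exists_smul_of_br_eq_zero (hM0 (0, 1) (by simp)) (h (0, 1))
  obtain ⟨k3, h3⟩ := exists_smul_of_br_eq_zero (hM0 (1, 1) (by simp)) (h (1, 1))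
  have e : ((1, 1) : ℝ × ℝ) = (1, 0) + (0, 1) := by simp
  -- Proportionality factors on the two basis vectors and on their sum must coincide, since `M` is
  -- injective.
  have h4 : M ((k1 - k3) • (1, 0) + (k2 - k3) • (0, 1)) = 0 := by
    rw [e, map_add, map_add, h1, h2] at h3
    rw [map_add, map_smul, map_smul]
    have : (k1 - k3) • M (1, 0) + (k2 - k3) • M (0, 1) =
      (k1 • M (1, 0) + k2 • M (0, 1)) - k3 • (M (1, 0) + M (0, 1)) := by module
    rw [this, h3, sub_self]
  have h5 := hM (h4.trans (map_zero M).symm)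
  simp [Prod.ext_iff] at h5
  refine ⟨k3, ?_, ?_⟩
  · rintro rfl
    rw [zero_smul] at h3
    exact hN0 (1, 1) (by simp) h3
  · intro z
    have hz : z = z.1 • (1, 0) + z.2 • (0, 1) := by ext <;> simp
    rw [hz, map_add, map_add, map_smul, map_smul, map_smul, map_smul, h1, h2]
    rw [show k1 = k3 by linarith [h5.1], show k2 = k3 by linarith [h5.2]]
    module

section Regulus

variable {t : Fin 4 → Affine.Triangle ℝ E3} {e : Fin 4 → Fin 3}

/-- Four segments on lines of one regulus: the transversals form at most four arcs, each of
them containing a line through an end of a segment. -/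
theorem cellBound_of_regulus {i l : Fin 4}
    (F : Frame (cellA t e i) (cellB t e i) (cellA t e l) (cellB t e l))
    {M : ℝ × ℝ →ₗ[ℝ] ℝ × ℝ} (hM : Function.Injective M) {c d : Fin 4 → ℝ} {p q : Fin 4 → ℝ × ℝ}
    (hcd : ∀ k, c k ≠ 0 ∨ d k ≠ 0) (hpq : ∀ k, br (p k) (q k) ≠ 0)
    (hYA : ∀ k, F.Y (cellA t e k) = c k • M (p k)) (hWA : ∀ k, F.W (cellA t e k) = d k • p k)
    (hYB : ∀ k, F.Y (cellB t e k) = c k • M (q k)) (hWB : ∀ k, F.W (cellB t e k) = d k • q k)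
    {j : Fin 4} (hcj : c j ≠ 0) (hdj : d j ≠ 0) : CellBound t e 2 := by
  have hM0 : ∀ z, z ≠ 0 → M z ≠ 0 := fun z hz h => hz (hM (by simpa using h))
  have hp0 : ∀ k, p k ≠ 0 := fun k => ne_zero_of_br_ne_left (hpq k)
  -- The data at the base edges are forced: one of the two scalars vanishes there, and the other one
  -- normalizes `M` and the parameters.
  have hdi : d i = 0 := by
    have := hWA i
    rw [F.Wa] at this
    exact (smul_eq_zero.1 this.symm).resolve_right (hp0 i)
  have hci : c i ≠ 0 := (hcd i).resolve_right (by simpa using hdi)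
  have hcl : c l = 0 := by
    have := hYA l
    rw [F.Yc] at this
    exact (smul_eq_zero.1 this.symm).resolve_right (hM0 _ (hp0 l))
  have hdl : d l ≠ 0 := (hcd l).resolve_left (by simpa using hcl)
  have eMp : c i • M (p i) = (1, 0) := by rw [← hYA, F.Ya]
  have eMq : c i • M (q i) = (0, 1) := by rw [← hYB, F.Yb]
  have ep : d l • p l = (1, 0) := by rw [← hWA, F.Wc]
  have eq : d l • q l = (0, 1) := by rw [← hWB, F.Wd]
  have hpos : ∀ k, ∀ r s : ℝ, 0 ≤ r → 0 ≤ s → r • p k + s • q k ≠ 0 → 0 < r + s := by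
    intro k r s hr hs h
    rcases (add_nonneg hr hs).eq_or_lt with h0 | h0
    · have hr0 : r = 0 := by linarith
      have hs0 : s = 0 := by linarith
      simp [hr0, hs0] at h
    · exact h0
  -- A parameter in the arc of a base segment has its foot on the segment itself, so the foot is not
  -- at infinity and the line is well defined.
  have hsumw : ∀ w ∈ ArcDom p q, w.1 + w.2 ≠ 0 := by
    have key : ∀ w, w ≠ 0 → InCone (p l) (q l) w → w.1 + w.2 ≠ 0 := by
      rintro w hw ⟨r, s, hr, hs, rfl⟩ h0
      have h1 := hpos l r s hr hs hw
      have h2 : d l • (r • p l + s • q l) = (r, s) := by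
        rw [smul_add, smul_comm _ r, smul_comm _ s, ep, eq]; simp
      have h3 : d l * ((r • p l + s • q l).1 + (r • p l + s • q l).2) = r + s := by
        have e1 := congrArg Prod.fst h2
        have e2 := congrArg Prod.snd h2
        rw [Prod.smul_fst, smul_eq_mul] at e1
        rw [Prod.smul_snd, smul_eq_mul] at e2
        rw [mul_add, e1, e2]
      rw [h0, mul_zero] at h3
      linarith
    intro w hw
    rcases hw.2 l with h | h
    · exact key w hw.1 h
    · have := key (-w) (neg_ne_zero.2 hw.1) h
      intro h0
      apply this
      simp only [Prod.fst_neg, Prod.snd_neg]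
      linarith
  have hsumy : ∀ w ∈ ArcDom p q, (M w).1 + (M w).2 ≠ 0 := by
    have key : ∀ w, w ≠ 0 → InCone (p i) (q i) w → (M w).1 + (M w).2 ≠ 0 := by
      rintro w hw ⟨r, s, hr, hs, rfl⟩ h0
      have h1 := hpos i r s hr hs hw
      have h2 : c i • M (r • p i + s • q i) = (r, s) := by
        rw [map_add, map_smul, map_smul, smul_add, smul_comm _ r, smul_comm _ s, eMp, eMq]; simp
      have h3 : c i * ((M (r • p i + s • q i)).1 + (M (r • p i + s • q i)).2) = r + s := by
        have e1 := congrArg Prod.fst h2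
        have e2 := congrArg Prod.snd h2
        rw [Prod.smul_fst, smul_eq_mul] at e1
        rw [Prod.smul_snd, smul_eq_mul] at e2
        rw [mul_add, e1, e2]
      rw [h0, mul_zero] at h3
      linarith
    intro w hw
    rcases hw.2 i with h | h
    · exact key w hw.1 h
    · have := key (-w) (neg_ne_zero.2 hw.1) h
      intro h0
      apply this
      rw [map_neg]
      simp only [Prod.fst_neg, Prod.snd_neg]
      linarith
  -- The ruling opposite to the regulus of the edges: the feet `M w` and `w` run along the base
  -- lines simultaneously.
  let Γ : ℝ × ℝ → Line3 := fun w =>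
    Frame.join (cellA t e i) (cellB t e i) (cellA t e l) (cellB t e l) (M w) w
  have hmeets : ∀ w, w.1 + w.2 ≠ 0 → (M w).1 + (M w).2 ≠ 0 → ∀ k,
      (Meets (Γ w) (cellA t e k) (cellB t e k) ↔ InArc (p k) (q k) w) := by
    intro w hw hy k
    constructor
    · rintro ⟨x, ⟨r, s, hr, hs, hrs, rfl⟩, hx⟩
      obtain ⟨ρ, σ, h1, h2⟩ := (F.mem_join hy hw).1 hx
      rw [Frame.affine_comb _ hrs, hYA, hYB] at h1
      rw [Frame.affine_comb _ hrs, hWA, hWB] at h2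
      set z := r • p k + s • q k with hz
      have hz0 : z ≠ 0 := by
        intro h0
        have := pointed_of_br_ne (hpq k) r s hr hs h0
        linarith [this.1, this.2]
      have e1 : c k • M z = ρ • M w := by
        rw [← h1, hz, map_add, map_smul, map_smul]; module
      have e2 : d k • z = σ • w := by rw [← h2, hz]; module
      obtain ⟨κ, hκ⟩ : ∃ κ : ℝ, z = κ • w := by
        rcases hcd k with h | h
        · refine ⟨(c k)⁻¹ * ρ, hM ?_⟩
          rw [map_smul, mul_smul, ← e1, smul_smul, inv_mul_cancel₀ h, one_smul]
        · refine ⟨(d k)⁻¹ * σ, ?_⟩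
          rw [mul_smul, ← e2, smul_smul, inv_mul_cancel₀ h, one_smul]
      have hκ0 : κ ≠ 0 := by
        rintro rfl
        rw [zero_smul] at hκ
        exact hz0 hκ
      have hwz : w = κ⁻¹ • z := by rw [hκ, smul_smul, inv_mul_cancel₀ hκ0, one_smul]
      rw [hwz]
      exact InArc.smul (Or.inl ⟨r, s, hr, hs, rfl⟩) _
    · intro h
      obtain ⟨ε, hε, z, hz0, hzw, r, s, hr, hs, hz⟩ : ∃ ε : ℝ, ε ≠ 0 ∧ ∃ z, z ≠ 0 ∧ z = ε • w ∧
          InCone (p k) (q k) z := by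
        have hw0 : w ≠ 0 := by rintro rfl; simp at hw
        rcases h with h | h
        · exact ⟨1, by simp, w, hw0, by simp, h⟩
        · exact ⟨-1, by simp, -w, neg_ne_zero.2 hw0, by simp, h⟩
      have h1 := hpos k r s hr hs (hz ▸ hz0)
      refine ⟨(r / (r + s)) • cellA t e k + (s / (r + s)) • cellB t e k,
        ⟨_, _, by positivity, by positivity, by field_simp, rfl⟩, (F.mem_join hy hw).2
        ⟨c k * (ε / (r + s)), d k * (ε / (r + s)), ?_, ?_⟩⟩
      · rw [Frame.affine_comb _ (by field_simp), hYA, hYB]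
        calc _ = (c k * (r + s)⁻¹) • M (r • p k + s • q k) := by
              rw [map_add, map_smul, map_smul]; module
          _ = _ := by rw [← hz, hzw, map_smul]; module
      · rw [Frame.affine_comb _ (by field_simp), hWA, hWB]
        calc _ = (d k * (r + s)⁻¹) • (r • p k + s • q k) := by module
          _ = _ := by rw [← hz, hzw]; module
  have hmeets' : ∀ w ∈ ArcDom p q, Γ w ∈ cell t e := fun w hw k =>
    (hmeets w (hsumw w hw) (hsumy w hw) k).2 (hw.2 k)
  have hMc : Continuous M := M.continuous_of_finiteDimensional
  obtain ⟨R, h1, h2, h3⟩ := exists_arc_representatives (a := p) (b := q) (Γ := Γ) (T := cell t e)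
    (fun k => pointed_of_br_ne (hpq k))
    (by
      have hpt : ∀ (a b : E3) (g : ℝ × ℝ → ℝ × ℝ), Continuous g →
          (∀ w ∈ ArcDom p q, (g w).1 + (g w).2 ≠ 0) →
          ContinuousOn (fun w => Frame.pt a b (g w)) (ArcDom p q) := by
        intro a b g hg h0
        unfold Frame.pt
        refine ContinuousOn.smul (ContinuousOn.inv₀ (by fun_prop) h0) (by fun_prop)
      have c1 := hpt (cellA t e i) (cellB t e i) M hMc hsumy
      have c2 := hpt (cellA t e l) (cellB t e l) id continuous_id hsumw
      exact continuousOn_ln.comp (c1.prodMk (c2.sub c1))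
        (fun w hw => F.pt_sub_pt_ne (hsumy w hw) (hsumw w hw)))
    hmeets'
    (fun z _ => by simp only [Γ, map_neg]; exact Frame.join_neg _ _)
  -- Four arcs, one for each edge, leave at most four representatives of weight one half.
  have hb := cellBound_of_card (t := t) (e := e) (n := 4) (m := 2) (by norm_num) (by simpa using h1)
    (fun L hL => by
      obtain ⟨k, z, hz, hzd, rfl⟩ := h2 L hL
      exact hmeets' z hzd)
    (fun L hL => by
      obtain ⟨k, z, hz, hzd, rfl⟩ := h2 L hL
      refine two_le_mult (hmeets' z hzd) (k := k) ?_
      rcases hz with rfl | rfl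
      · exact Or.inl ((F.mem_join (hsumy _ hzd) (hsumw _ hzd)).2 ⟨_, _, hYA k, hWA k⟩)
      · exact Or.inr ((F.mem_join (hsumy _ hzd) (hsumw _ hzd)).2 ⟨_, _, hYB k, hWB k⟩))
    (by
      intro L hL
      obtain ⟨y, w, hy1, hy2, hys, hw1, hw2, hws, rfl⟩ := F.exists_eq_join (hL i) (hL l)
      have hy0 : y.1 + y.2 ≠ 0 := by rw [hys]; exact one_ne_zero
      have hw0 : w.1 + w.2 ≠ 0 := by rw [hws]; exact one_ne_zero
      -- The edge `j` lies on neither base line, so meeting it ties the two feet together and places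
      -- the transversal in the ruling.
      obtain ⟨x, ⟨r, s, hr, hs, hrs, rfl⟩, hx⟩ := hL j
      obtain ⟨ρ, σ, e1, e2⟩ := (F.mem_join hy0 hw0).1 hx
      rw [Frame.affine_comb _ hrs, hYA, hYB] at e1
      rw [Frame.affine_comb _ hrs, hWA, hWB] at e2
      set z := r • p j + s • q j with hz
      have hz0 : z ≠ 0 := by
        intro h0
        have := pointed_of_br_ne (hpq j) r s hr hs h0
        linarith [this.1, this.2]
      have f1 : c j • M z = ρ • y := by
        rw [← e1, hz, map_add, map_smul, map_smul]; module
      have f2 : d j • z = σ • w := by rw [← e2, hz]; module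
      have g1 : M z = ((c j)⁻¹ * ρ) • y := by
        rw [mul_smul, ← f1, smul_smul, inv_mul_cancel₀ hcj, one_smul]
      have g2 : z = ((d j)⁻¹ * σ) • w := by
        rw [mul_smul, ← f2, smul_smul, inv_mul_cancel₀ hdj, one_smul]
      have k1 : (c j)⁻¹ * ρ ≠ 0 := by
        intro h0; rw [h0, zero_smul] at g1; exact hM0 z hz0 g1
      have k2 : (d j)⁻¹ * σ ≠ 0 := by
        intro h0; rw [h0, zero_smul] at g2; exact hz0 g2
      have hΓ := Frame.join_eq (a := cellA t e i) (b := cellB t e i) (c := cellA t e l)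
        (d := cellB t e l) hy0 hw0 k1 k2 g1 g2
      have hL' : Γ z ∈ cell t e := by rw [← hΓ] at hL; exact hL
      have s1 : z.1 + z.2 ≠ 0 := by
        rw [g2]; simp only [Prod.smul_fst, Prod.smul_snd, smul_eq_mul, ← mul_add, hws, mul_one]
        exact k2
      have s2 : (M z).1 + (M z).2 ≠ 0 := by
        rw [g1]; simp only [Prod.smul_fst, Prod.smul_snd, smul_eq_mul, ← mul_add, hys, mul_one]
        exact k1
      have := h3 z ⟨hz0, fun k => (hmeets z s1 s2 k).1 (hL' k)⟩
      rw [← hΓ]; exact this)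
  norm_num at hb
  exact hb

end Regulus

end TriTangent

/-! ### Cells containing a skew pair of edges -/

namespace TriTangent

open Set

variable {t : Fin 4 → Affine.Triangle ℝ E3} {e : Fin 4 → Fin 3}

theorem cellA_ne_cellB (t : Fin 4 → Affine.Triangle ℝ E3) (e : Fin 4 → Fin 3) (k : Fin 4) :
    cellA t e k ≠ cellB t e k := by
  intro h
  have := (t k).independent.injective h
  revert this
  generalize e k = x
  revert x
  decide

theorem cellBound_of_joinedIn
    (h : ∀ L ∈ cell t e, ∀ M ∈ cell t e, JoinedIn (commonTangents t) L M) : CellBound t e 1 := by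
  rcases (cell t e).eq_empty_or_nonempty with h0 | ⟨M, hM⟩
  · exact ⟨∅, by simp, by simp [h0], by simp⟩
  · refine ⟨{M}, by simpa using hM, fun L hL => ⟨M, by simp, h L hL M hM⟩, ?_⟩
    have : (1 : ℚ) ≤ mult t M := by exact_mod_cast one_le_mult hM
    simpa using inv_le_one_of_one_le₀ this

theorem cellBound_of_no_three
    (h : ∀ a ∈ cell t e, ∀ b ∈ cell t e, ∀ c ∈ cell t e, a = b ∨ a = c ∨ b = c) :
    CellBound t e 2 := by
  obtain ⟨R, h1, h2, h3⟩ := exists_finset_of_no_three h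
  have := cellBound_of_card (m := 1) (by norm_num) h1 h2 (fun L hL => one_le_mult (h2 L hL))
    (fun L hL => ⟨L, h3 L hL, JoinedIn.refl hL⟩)
  simpa using this

theorem Frame.eq_of_Y_eq_zero {a b c d : E3} (F : Frame a b c d) {u v : E3} (hu : F.Y u = 0)
    (hv : F.Y v = 0) (h : br (F.W u) (F.W v) = 0) : u = v := by
  have e1 := F.sum u
  have e2 := F.sum v
  have e3 := F.comb u
  have e4 := F.comb v
  rw [hu] at e1 e3
  rw [hv] at e2 e4
  simp only [Prod.fst_zero, Prod.snd_zero, zero_add, zero_smul] at e1 e2 e3 e4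
  unfold br at h
  have h1 : (F.W u).1 = (F.W v).1 := by linear_combination (F.W v).1 * e1 - (F.W u).1 * e2 + h
  have h2 : (F.W u).2 = (F.W v).2 := by linarith
  rw [e3, e4, h1, h2]

theorem Frame.eq_of_W_eq_zero {a b c d : E3} (F : Frame a b c d) {u v : E3} (hu : F.W u = 0)
    (hv : F.W v = 0) (h : br (F.Y u) (F.Y v) = 0) : u = v :=
  F.swap.eq_of_Y_eq_zero hu hv h

/-- The foot on one base line determines the transversal, because the projectivity supplies the
other foot. -/
theorem Frame.join_eq_of_pj {a b c d : E3} (F : Frame a b c d) {u v : E3} {y w y' w' : ℝ × ℝ}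
    {κ κ' : ℝ} (hy : y.1 + y.2 = 1) (hw : w.1 + w.2 = 1) (hw' : w'.1 + w'.2 = 1) (hκ : κ ≠ 0)
    (hκ' : κ' ≠ 0) (h : F.pj u v w = κ • y) (h' : F.pj u v w' = κ' • y') (hb : br w w' = 0) :
    join a b c d y' w' = join a b c d y w := by
  have hw0 : w ≠ 0 := by rintro rfl; simp at hw
  obtain ⟨r, hr⟩ := exists_smul_of_br_eq_zero hw0 hb
  have hr0 : r ≠ 0 := by
    rintro rfl
    rw [hr] at hw'
    simp at hw'
  refine Frame.join_eq (by rw [hy]; exact one_ne_zero) (by rw [hw]; exact one_ne_zero)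
    (r := κ'⁻¹ * r * κ) (by positivity) hr0 ?_ hr
  rw [hr, map_smul, h] at h'
  rw [mul_smul, mul_smul, h', smul_smul, inv_mul_cancel₀ hκ', one_smul]

/-- Two segments in general position with respect to the base segments. -/
theorem no_three_of_br_ne {i j k l : Fin 4}
    (F : Frame (cellA t e i) (cellB t e i) (cellA t e l) (cellB t e l))
    (hWj : br (F.W (cellA t e j)) (F.W (cellB t e j)) ≠ 0)
    (hYj : br (F.Y (cellA t e j)) (F.Y (cellB t e j)) ≠ 0)
    (hWk : br (F.W (cellA t e k)) (F.W (cellB t e k)) ≠ 0)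
    (hYk : br (F.Y (cellA t e k)) (F.Y (cellB t e k)) ≠ 0) {z : ℝ × ℝ}
    (hz : br (F.pj (cellA t e j) (cellB t e j) z) (F.pj (cellA t e k) (cellB t e k) z) ≠ 0) :
    ∀ a ∈ cell t e, ∀ b ∈ cell t e, ∀ c ∈ cell t e, a = b ∨ a = c ∨ b = c := by
  -- The two projectivities must give the same second foot, so the first foot is a root of a
  -- quadratic form, which `hz` makes nonzero.
  have key : ∀ L ∈ cell t e, ∃ y w : ℝ × ℝ, ∃ κ : ℝ, y.1 + y.2 = 1 ∧ w.1 + w.2 = 1 ∧ κ ≠ 0 ∧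
      L = Frame.join (cellA t e i) (cellB t e i) (cellA t e l) (cellB t e l) y w ∧
      F.pj (cellA t e j) (cellB t e j) w = κ • y ∧
      br (F.pj (cellA t e j) (cellB t e j) w) (F.pj (cellA t e k) (cellB t e k) w) = 0 := by
    intro L hL
    obtain ⟨y, w, -, -, hy, -, -, hw, rfl⟩ := F.exists_eq_join (hL i) (hL l)
    have hy0 : y.1 + y.2 ≠ 0 := by rw [hy]; exact one_ne_zero
    have hw0 : w.1 + w.2 ≠ 0 := by rw [hw]; exact one_ne_zero
    obtain ⟨-, κ, hκ, h1⟩ := F.of_meets_join hWj hYj hy0 hw0 (hL j)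
    obtain ⟨-, κ', hκ', h2⟩ := F.of_meets_join hWk hYk hy0 hw0 (hL k)
    refine ⟨y, w, κ, hy, hw, hκ, rfl, h1, ?_⟩
    rw [h1, h2]
    simp [br]; ring
  intro a ha b hb c hc
  obtain ⟨y1, w1, κ1, hy1, hw1, hκ1, e1, p1, q1⟩ := key a ha
  obtain ⟨y2, w2, κ2, hy2, hw2, hκ2, e2, p2, q2⟩ := key b hb
  obtain ⟨y3, w3, κ3, hy3, hw3, hκ3, e3, p3, q3⟩ := key c hc
  by_contra hne
  push Not at hne
  apply hz
  refine bilinear_eq_zero_of_three _ _ (u := w1) (v := w2) (w := w3) ?_ ?_ ?_ q1 q2 q3 z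
  · intro h0
    exact hne.1 (by rw [e1, e2]; exact (F.join_eq_of_pj hy1 hw1 hw2 hκ1 hκ2 p1 p2 h0).symm)
  · intro h0
    exact hne.2.1 (by rw [e1, e3]; exact (F.join_eq_of_pj hy1 hw1 hw3 hκ1 hκ3 p1 p3 h0).symm)
  · intro h0
    exact hne.2.2 (by rw [e2, e3]; exact (F.join_eq_of_pj hy2 hw2 hw3 hκ2 hκ3 p2 p3 h0).symm)

/-- If every segment lies on one of two skew lines, the transversals form a connected set. -/
theorem joinedIn_of_two_lines {i l : Fin 4}
    (F : Frame (cellA t e i) (cellB t e i) (cellA t e l) (cellB t e l))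
    (h : ∀ k, (F.W (cellA t e k) = 0 ∧ F.W (cellB t e k) = 0) ∨
      (F.Y (cellA t e k) = 0 ∧ F.Y (cellB t e k) = 0)) {L M : Line3} (hL : L ∈ cell t e)
    (hM : M ∈ cell t e) : JoinedIn (cell t e) L M := by
  -- The feet can be chosen independently: each runs through the intersection of the segments on its
  -- base line, which is convex.
  let S₁ : Set E3 := {x | ∀ k, F.W (cellA t e k) = 0 ∧ F.W (cellB t e k) = 0 →
    x ∈ segment ℝ (cellA t e k) (cellB t e k)}
  let S₂ : Set E3 := {x | ∀ k, F.Y (cellA t e k) = 0 ∧ F.Y (cellB t e k) = 0 →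
    x ∈ segment ℝ (cellA t e k) (cellB t e k)}
  have hS₁ : Convex ℝ S₁ := by
    intro x hx y hy r s hr hs hrs k hk
    exact convex_segment _ _ (hx k hk) (hy k hk) hr hs hrs
  have hS₂ : Convex ℝ S₂ := by
    intro x hx y hy r s hr hs hrs k hk
    exact convex_segment _ _ (hx k hk) (hy k hk) hr hs hrs
  have hW : ∀ u v : E3, F.W u = 0 → F.W v = 0 → ∀ x ∈ segment ℝ u v, F.W x = 0 := by
    rintro u v hu hv x ⟨r, s, hr, hs, hrs, rfl⟩
    rw [Frame.affine_comb _ hrs, hu, hv]; simp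
  have hY : ∀ u v : E3, F.Y u = 0 → F.Y v = 0 → ∀ x ∈ segment ℝ u v, F.Y x = 0 := by
    rintro u v hu hv x ⟨r, s, hr, hs, hrs, rfl⟩
    rw [Frame.affine_comb _ hrs, hu, hv]; simp
  have hWS : ∀ x ∈ S₁, F.W x = 0 := fun x hx => hW _ _ F.Wa F.Wb x (hx i ⟨F.Wa, F.Wb⟩)
  have hYS : ∀ x ∈ S₂, F.Y x = 0 := fun x hx => hY _ _ F.Yc F.Yd x (hx l ⟨F.Yc, F.Yd⟩)
  have key : ∀ L ∈ cell t e, ∃ x ∈ S₁ ×ˢ S₂, L = ln x.1 (x.2 - x.1) := by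
    intro L hL
    obtain ⟨y, w, -, -, hy, -, -, hw, rfl⟩ := F.exists_eq_join (hL i) (hL l)
    have hy0 : y.1 + y.2 ≠ 0 := by rw [hy]; exact one_ne_zero
    have hw0 : w.1 + w.2 ≠ 0 := by rw [hw]; exact one_ne_zero
    refine ⟨(Frame.pt (cellA t e i) (cellB t e i) y, Frame.pt (cellA t e l) (cellB t e l) w),
      ⟨?_, ?_⟩, rfl⟩
    · intro k hk
      obtain ⟨x, hx, hxL⟩ := hL k
      rw [← F.eq_pt_of_mem_join hy0 hw0 hxL (hW _ _ hk.1 hk.2 x hx)]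
      exact hx
    · intro k hk
      obtain ⟨x, hx, hxL⟩ := hL k
      rw [← F.eq_pt_of_mem_join' hy0 hw0 hxL (hY _ _ hk.1 hk.2 x hx)]
      exact hx
  have hne : ∀ x ∈ S₁ ×ˢ S₂, x.2 - x.1 ≠ 0 := by
    rintro ⟨x, y⟩ ⟨hx, hy⟩ h0
    have hxy : y = x := sub_eq_zero.1 h0
    have h1 := F.sum x
    rw [hWS x hx, ← hxy, hYS y hy] at h1
    simp at h1
  obtain ⟨x, hx, rfl⟩ := key L hL
  obtain ⟨y, hy, rfl⟩ := key M hM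
  refine joinedIn_ln_of_convex (hS₁.prod hS₂) (p := fun x => x.1) (v := fun x => x.2 - x.1)
    (by fun_prop) (by fun_prop) hne ?_ hx hy
  intro z hz k
  rcases h k with hk | hk
  · exact ⟨z.1, hz.1 k hk, left_mem_ln (hne z hz)⟩
  · exact ⟨z.2, hz.2 k hk, (mem_ln (hne z hz)).2 ⟨1, by simp⟩⟩

/-- Every edge lies on a base line or is skew to both. Without a skew edge the transversals are
connected. With one, either another edge gives a different projectivity and at most two lines
remain, or all edges belong to one regulus. -/
theorem cellBound_of_frame {i l : Fin 4}
    (F : Frame (cellA t e i) (cellB t e i) (cellA t e l) (cellB t e l))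
    (h : ∀ k, (F.W (cellA t e k) = 0 ∧ F.W (cellB t e k) = 0) ∨
      (F.Y (cellA t e k) = 0 ∧ F.Y (cellB t e k) = 0) ∨
      (br (F.W (cellA t e k)) (F.W (cellB t e k)) ≠ 0 ∧
        br (F.Y (cellA t e k)) (F.Y (cellB t e k)) ≠ 0)) : CellBound t e 2 := by
  by_cases hj : ∃ j, br (F.W (cellA t e j)) (F.W (cellB t e j)) ≠ 0 ∧
        br (F.Y (cellA t e j)) (F.Y (cellB t e j)) ≠ 0
  · obtain ⟨j, hWj, hYj⟩ := hj
    by_cases hk : ∃ k, br (F.W (cellA t e k)) (F.W (cellB t e k)) ≠ 0 ∧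
        br (F.Y (cellA t e k)) (F.Y (cellB t e k)) ≠ 0 ∧ ∃ z,
        br (F.pj (cellA t e j) (cellB t e j) z) (F.pj (cellA t e k) (cellB t e k) z) ≠ 0
    · obtain ⟨k, hWk, hYk, z, hz⟩ := hk
      exact cellBound_of_no_three (no_three_of_br_ne F hWj hYj hWk hYk hz)
    push Not at hk
    set M := F.pj (cellA t e j) (cellB t e j) with hMdef
    have hM : Function.Injective M := F.pj_injective hWj hYj
    have hMs : Function.Surjective M := LinearMap.surjective_of_injective hM
    -- The coordinates of the edges as lines of one regulus. Scalars `(1, 0)` and `(0, 1)` stand for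
    -- the two base lines; for a skew edge the ratio of the scalars is the factor between its
    -- projectivity and `M`.
    have key : ∀ k, ∃ (c d : ℝ) (p q : ℝ × ℝ), (c ≠ 0 ∨ d ≠ 0) ∧ br p q ≠ 0 ∧
        F.Y (cellA t e k) = c • M p ∧ F.W (cellA t e k) = d • p ∧
        F.Y (cellB t e k) = c • M q ∧ F.W (cellB t e k) = d • q ∧
        (br (F.W (cellA t e k)) (F.W (cellB t e k)) ≠ 0 → c ≠ 0 ∨ br (F.Y (cellA t e k)) (F.Y (cellB t e k)) = 0) := by
      intro k
      rcases h k with ⟨h1, h2⟩ | ⟨h1, h2⟩ | ⟨h1, h2⟩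
      · obtain ⟨p, hp⟩ := hMs (F.Y (cellA t e k))
        obtain ⟨q, hq⟩ := hMs (F.Y (cellB t e k))
        refine ⟨1, 0, p, q, Or.inl one_ne_zero, ?_, by simp [hp], by simp [h1], by simp [hq],
          by simp [h2], by simp⟩
        intro h0
        have := F.br_pj (cellA t e j) (cellB t e j) p q
        rw [← hMdef, hp, hq, h0, mul_zero] at this
        exact cellA_ne_cellB t e k (F.eq_of_W_eq_zero h1 h2 this)
      · refine ⟨0, 1, F.W (cellA t e k), F.W (cellB t e k), Or.inr one_ne_zero, ?_, by simp [h1],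
          by simp, by simp [h2], by simp, fun _ => Or.inr (by simp [h1, br])⟩
        intro h0
        exact cellA_ne_cellB t e k (F.eq_of_Y_eq_zero h1 h2 h0)
      · obtain ⟨κ, hκ, hall⟩ := exists_smul_of_forall_parallel hM (F.pj_injective h1 h2)
          (hk k h1 h2)
        have e1 := F.pj_left (cellA t e k) (cellB t e k)
        have e2 := F.pj_right (cellA t e k) (cellB t e k)
        set B := br (F.W (cellA t e k)) (F.W (cellB t e k)) with hB
        refine ⟨B⁻¹ * κ, 1, F.W (cellA t e k), F.W (cellB t e k), Or.inr one_ne_zero, h1, ?_,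
          by simp, ?_, by simp, fun _ => Or.inl (by positivity)⟩
        · rw [mul_smul, ← hall, e1, smul_smul, inv_mul_cancel₀ h1, one_smul]
        · rw [mul_smul, ← hall, e2, smul_smul, inv_mul_cancel₀ h1, one_smul]
    choose c d p q hcd hpq hYA hWA hYB hWB hc using key
    refine cellBound_of_regulus F hM hcd hpq hYA hWA hYB hWB (j := j)
      ((hc j hWj).resolve_right hYj) ?_
    intro h0
    have := hWA j
    rw [h0, zero_smul] at this
    rw [this] at hWj
    simp [br] at hWj
  · push Not at hj
    refine (cellBound_of_joinedIn fun L hL M hM => ?_).mono one_le_two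
    refine (joinedIn_of_two_lines F (fun k => ?_) hL hM).mono cell_subset
    rcases h k with h1 | h1 | h1
    · exact Or.inl h1
    · exact Or.inr h1
    · exact absurd (hj k h1.1) h1.2

end TriTangent

/-! ### Concurrent, collinear and planar families of transversals -/

namespace TriTangent

open Set

variable {t : Fin 4 → Affine.Triangle ℝ E3} {e : Fin 4 → Fin 3}

/-- The chosen edge of the triangle `k`. -/
abbrev seg (t : Fin 4 → Affine.Triangle ℝ E3) (e : Fin 4 → Fin 3) (k : Fin 4) : Set E3 :=
  segment ℝ (cellA t e k) (cellB t e k)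

/-- The line through the chosen edge of the triangle `k`. -/
noncomputable def edgeLine (t : Fin 4 → Affine.Triangle ℝ E3) (e : Fin 4 → Fin 3) (k : Fin 4) :
    Line3 := ln (cellA t e k) (cellB t e k - cellA t e k)

theorem cellB_sub_cellA_ne (k : Fin 4) : cellB t e k - cellA t e k ≠ 0 :=
  sub_ne_zero.2 (cellA_ne_cellB t e k).symm

theorem cellA_mem_edgeLine (k : Fin 4) : cellA t e k ∈ (edgeLine t e k).1 :=
  left_mem_ln (cellB_sub_cellA_ne k)

theorem cellB_mem_edgeLine (k : Fin 4) : cellB t e k ∈ (edgeLine t e k).1 :=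
  (mem_ln (cellB_sub_cellA_ne k)).2 ⟨1, by simp⟩

theorem seg_subset_edgeLine {k : Fin 4} {x : E3} (hx : x ∈ seg t e k) : x ∈ (edgeLine t e k).1 := by
  obtain ⟨r, s, hr, hs, hrs, rfl⟩ := hx
  refine (mem_ln (cellB_sub_cellA_ne k)).2 ⟨s, ?_⟩
  rw [show r = 1 - s by linarith]
  module

theorem mem_edgeLine_iff {k : Fin 4} {x : E3} : x ∈ (edgeLine t e k).1 ↔
    ∃ s : ℝ, x = (1 - s) • cellA t e k + s • cellB t e k := by
  rw [edgeLine, mem_ln (cellB_sub_cellA_ne k)]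
  refine exists_congr fun s => ?_
  rw [show cellA t e k + s • (cellB t e k - cellA t e k) =
    (1 - s) • cellA t e k + s • cellB t e k by module]

/-- Only the segment `l` restricts the direction. If it contains `p`, the whole star of `p` is
available; otherwise its points are a convex set of parameters. -/
theorem joinedIn_of_mem_of_mem {p : E3} {l : Fin 4} (h : ∀ k ≠ l, p ∈ seg t e k) {L M : Line3}
    (hL : L ∈ cell t e) (hM : M ∈ cell t e) (hpL : p ∈ L.1) (hpM : p ∈ M.1) :
    JoinedIn (commonTangents t) L M := by
  refine JoinedIn.mono ?_ (cell_subset (e := e))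
  by_cases hl : p ∈ seg t e l
  · have hall : ∀ v ≠ 0, ln p v ∈ cell t e := by
      intro v hv k
      by_cases hk : k = l
      · exact ⟨p, hk ▸ hl, left_mem_ln hv⟩
      · exact ⟨p, h k hk, left_mem_ln hv⟩
    obtain ⟨v, hv, rfl⟩ := exists_eq_ln_of_mem hpL
    obtain ⟨w, hw, rfl⟩ := exists_eq_ln_of_mem hpM
    exact joinedIn_star hall hv hw
  · have hne : ∀ x ∈ seg t e l, x - p ≠ 0 := fun x hx h0 => hl (sub_eq_zero.1 h0 ▸ hx)
    obtain ⟨x, hx, hxL⟩ := hL l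
    obtain ⟨y, hy, hyM⟩ := hM l
    rw [eq_ln (hne x hx) hpL (by simpa using hxL), eq_ln (hne y hy) hpM (by simpa using hyM)]
    refine joinedIn_ln_of_convex (convex_segment (cellA t e l) (cellB t e l)) (p := fun _ => p)
      (v := fun x => x - p) (by fun_prop) (by fun_prop) hne ?_ hx hy
    intro z hz k
    by_cases hk : k = l
    · exact ⟨z, hk ▸ hz, (mem_ln (hne z hz)).2 ⟨1, by simp⟩⟩
    · exact ⟨p, h k hk, left_mem_ln (hne z hz)⟩

/-- All segments on one line. -/
theorem joinedIn_of_collinear {i : Fin 4} (h : ∀ k, cellA t e k ∈ (edgeLine t e i).1 ∧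
    cellB t e k ∈ (edgeLine t e i).1) {L M : Line3} (hL : L ∈ cell t e) (hM : M ∈ cell t e) :
    JoinedIn (commonTangents t) L M := by
  have heq : ∀ k, edgeLine t e k = edgeLine t e i := fun k =>
    eq_of_two_mem (cellA_ne_cellB t e k) (cellA_mem_edgeLine k) (cellB_mem_edgeLine k)
      (h k).1 (h k).2
  have hin : edgeLine t e i ∈ cell t e := fun k =>
    ⟨cellA t e k, left_mem_segment .., (h k).1⟩
  have key : ∀ L ∈ cell t e, JoinedIn (commonTangents t) L (edgeLine t e i) := by
    intro L hL
    by_cases hLe : L = edgeLine t e i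
    · subst hLe
      exact JoinedIn.refl (cell_subset hL)
    obtain ⟨x, hx, hxL⟩ := hL i
    have hxi := seg_subset_edgeLine hx
    -- A transversal different from the common line meets it only in `x`, so `x` lies on every
    -- segment; it can then turn around `x` into the common line.
    refine joinedIn_of_mem_of_mem (p := x) (l := i) ?_ hL hin hxL hxi
    intro k _
    obtain ⟨y, hy, hyL⟩ := hL k
    have hyi := seg_subset_edgeLine hy
    rw [heq k] at hyi
    by_contra hxk
    have hne : x ≠ y := by rintro rfl; exact hxk hy
    exact hLe (eq_of_two_mem hne hxL hyL hxi hyi)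
  exact (key L hL).trans (key M hM).symm

theorem Frame.affine_comb' (f : E3 →ᵃ[ℝ] ℝ × ℝ) {k : Fin 4} (hA : f (cellA t e k) = 0)
    (hB : f (cellB t e k) = 0) {x : E3} (hx : x ∈ (edgeLine t e k).1) : f x = 0 := by
  obtain ⟨s, rfl⟩ := mem_edgeLine_iff.1 hx
  rw [Frame.affine_comb _ (by ring), hA, hB]
  simp

/-- With one skew pair as base, every edge that fails to be skew to a base edge lies on its line,
which is the situation of `cellBound_of_frame`. Without a skew pair all edges are collinear. -/
theorem cellBound_of_skew_or_collinear
    (h : ∀ k l, Cop (cellA t e k) (cellB t e k) (cellA t e l) (cellB t e l) →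
      cellA t e k ∈ (edgeLine t e l).1 ∧ cellB t e k ∈ (edgeLine t e l).1) :
    CellBound t e 2 := by
  by_cases hs : ∃ i l, ¬ Cop (cellA t e i) (cellB t e i) (cellA t e l) (cellB t e l)
  · obtain ⟨i, l, hil⟩ := hs
    obtain ⟨F⟩ := Frame.exists_of_not_cop hil
    refine cellBound_of_frame F fun k => ?_
    by_cases hW : br (F.W (cellA t e k)) (F.W (cellB t e k)) = 0
    · obtain ⟨h1, h2⟩ := h k i (F.cop_left_of_br_eq_zero hW)
      exact Or.inl ⟨Frame.affine_comb' F.W F.Wa F.Wb h1, Frame.affine_comb' F.W F.Wa F.Wb h2⟩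
    by_cases hY : br (F.Y (cellA t e k)) (F.Y (cellB t e k)) = 0
    · obtain ⟨h1, h2⟩ := h k l (F.cop_right_of_br_eq_zero hY)
      exact Or.inr (Or.inl ⟨Frame.affine_comb' F.Y F.Yc F.Yd h1,
        Frame.affine_comb' F.Y F.Yc F.Yd h2⟩)
    exact Or.inr (Or.inr ⟨hW, hY⟩)
  · push Not at hs
    exact (cellBound_of_joinedIn fun L hL M hM =>
      joinedIn_of_collinear (i := 0) (fun k => h k 0 (hs k 0)) hL hM).mono one_le_two

/-! ### Lines in a plane -/

theorem exists_plane_basis {f : E3 →ₗ[ℝ] ℝ} (hf : f ≠ 0) :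
    ∃ g : ℝ × ℝ →ₗ[ℝ] E3, Function.Injective g ∧ (∀ w, f (g w) = 0) ∧
      ∀ v, f v = 0 → ∃ w, g w = v := by
  have h1 : Module.finrank ℝ (LinearMap.ker f) = 2 := by
    have h2 := LinearMap.finrank_range_add_finrank_ker f
    have h3 : LinearMap.range f = ⊤ := LinearMap.range_eq_top.2 (LinearMap.surjective hf)
    rw [h3, finrank_top] at h2
    simp at h2
    omega
  have h4 : Module.finrank ℝ (ℝ × ℝ) = Module.finrank ℝ (LinearMap.ker f) := by rw [h1]; simp
  let E := LinearEquiv.ofFinrankEq (ℝ × ℝ) (LinearMap.ker f) h4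
  refine ⟨(LinearMap.ker f).subtype.comp E.toLinearMap, ?_, ?_, ?_⟩
  · exact (LinearMap.ker f).injective_subtype.comp E.injective
  · intro w
    exact (E w).2
  · intro v hv
    exact ⟨E.symm ⟨v, hv⟩, by simp⟩

/-- The line lies in the plane `f = κ`. -/
def InPlane (f : E3 →ₗ[ℝ] ℝ) (κ : ℝ) (L : Line3) : Prop := ∀ x ∈ L.1, f x = κ

variable {f : E3 →ₗ[ℝ] ℝ} {κ : ℝ}

theorem inPlane_of_two_mem {L : Line3} {p q : E3} (hpq : p ≠ q) (hp : p ∈ L.1) (hq : q ∈ L.1)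
    (hfp : f p = κ) (hfq : f q = κ) : InPlane f κ L := by
  intro x hx
  obtain ⟨c, rfl⟩ := (mem_iff_of_two_mem hpq hp hq).1 hx
  simp [hfp, hfq]

theorem map_eq_of_mem_segment {a b x : E3} (ha : f a = κ) (hb : f b = κ)
    (hx : x ∈ segment ℝ a b) : f x = κ := by
  obtain ⟨r, s, hr, hs, hrs, rfl⟩ := hx
  simp only [map_add, map_smul, ha, hb, smul_eq_mul]
  rw [← add_mul, hrs, one_mul]

theorem eq_of_mem_edgeLine_of_map_eq {k : Fin 4} {x y : E3}
    (h : ¬ (f (cellA t e k) = κ ∧ f (cellB t e k) = κ)) (hx : x ∈ (edgeLine t e k).1)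
    (hy : y ∈ (edgeLine t e k).1) (hfx : f x = κ) (hfy : f y = κ) : x = y := by
  by_contra hne
  have := inPlane_of_two_mem hne hx hy hfx hfy
  exact h ⟨this _ (cellA_mem_edgeLine k), this _ (cellB_mem_edgeLine k)⟩

theorem eq_of_mem_seg_of_map_eq {k : Fin 4} {x y : E3}
    (h : ¬ (f (cellA t e k) = κ ∧ f (cellB t e k) = κ)) (hx : x ∈ seg t e k)
    (hy : y ∈ seg t e k) (hfx : f x = κ) (hfy : f y = κ) : x = y :=
  eq_of_mem_edgeLine_of_map_eq h (seg_subset_edgeLine hx) (seg_subset_edgeLine hy) hfx hfy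

theorem exists_eq_ln_of_inPlane {g : ℝ × ℝ →ₗ[ℝ] E3} (hg : ∀ v, f v = 0 → ∃ w, g w = v)
    {p : E3} {L : Line3} (hp : p ∈ L.1) (hL : InPlane f κ L) : ∃ w, w ≠ 0 ∧ L = ln p (g w) := by
  obtain ⟨v, hv, rfl⟩ := exists_eq_ln_of_mem hp
  have h1 := hL _ hp
  have h2 := hL (p + v) ((mem_ln hv).2 ⟨1, by simp⟩)
  rw [map_add, h1, add_eq_left] at h2
  obtain ⟨w, rfl⟩ := hg v h2
  exact ⟨w, by rintro rfl; simp at hv, rfl⟩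

/-- The planar pencil of transversals through a point. -/
theorem exists_planar_pencil_representatives (hf : f ≠ 0) {p : E3} (hp : f p = κ)
    {I : Finset (Fin 4)} (hI : ∀ k, k ∈ I ↔ p ∉ seg t e k) (hne : I.Nonempty)
    (hpl : ∀ k, p ∉ seg t e k → f (cellA t e k) = κ ∧ f (cellB t e k) = κ) :
    ∃ R : Finset Line3, R.card ≤ I.card ∧ (∀ M ∈ R, M ∈ cell t e ∧ 2 ≤ mult t M) ∧
      ∀ L ∈ cell t e, p ∈ L.1 → InPlane f κ L → ∃ M ∈ R, JoinedIn (commonTangents t) L M := by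
  obtain ⟨g, hg1, hg2, hg3⟩ := exists_plane_basis hf
  have hα : ∀ x, f x = κ → ∃ w, x = p + g w := by
    intro x hx
    obtain ⟨w, hw⟩ := hg3 (x - p) (by rw [map_sub, hx, hp, sub_self])
    exact ⟨w, by rw [hw]; abel⟩
  have h1 : ∀ k, ∃ α β : ℝ × ℝ, k ∈ I → cellA t e k = p + g α ∧ cellB t e k = p + g β := by
    intro k
    by_cases hk : k ∈ I
    · obtain ⟨h1, h2⟩ := hpl k ((hI k).1 hk)
      obtain ⟨α, hα'⟩ := hα _ h1
      obtain ⟨β, hβ'⟩ := hα _ h2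
      exact ⟨α, β, fun _ => ⟨hα', hβ'⟩⟩
    · exact ⟨0, 0, fun h => absurd h hk⟩
  choose α β hαβ using h1
  obtain ⟨R, r1, r2, r3⟩ := exists_pencil_representatives hg1 hne (fun k hk => (hαβ k hk).1)
    (fun k hk => (hαβ k hk).2) (fun k hk => (hI k).1 hk)
    (fun k hk => not_not.1 (fun h => hk ((hI k).2 h)))
  refine ⟨R, r1, fun M hM => ⟨(r2 M hM).1, (r2 M hM).2.1⟩, ?_⟩
  intro L hL hpL hLπ
  obtain ⟨w, hw, rfl⟩ := exists_eq_ln_of_inPlane hg3 hpL hLπ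
  obtain ⟨M, hM, hj⟩ := r3 w hw hL
  exact ⟨M, hM, hj.mono cell_subset⟩

/-- A class of weight one, and further classes of weight one half. -/
theorem cellBound_of_hub {H : Line3} (hH : H ∈ cell t e) {R : Finset Line3} {n : ℕ}
    (hc : R.card ≤ n) (hR : ∀ M ∈ R, M ∈ cell t e ∧ 2 ≤ mult t M)
    (h : ∀ L ∈ cell t e, JoinedIn (commonTangents t) L H ∨
      ∃ M ∈ R, JoinedIn (commonTangents t) L M) : CellBound t e (1 + n / 2) := by
  classical
  refine ⟨insert H R, ?_, ?_, ?_⟩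
  · intro L hL
    rcases Finset.mem_insert.1 hL with rfl | hL
    · exact hH
    · exact (hR L hL).1
  · intro L hL
    rcases h L hL with h | ⟨M, hM, h⟩
    · exact ⟨H, Finset.mem_insert_self _ _, h⟩
    · exact ⟨M, Finset.mem_insert_of_mem hM, h⟩
  · have h1 : (1 / mult t H : ℚ) ≤ 1 := by
      have : (1 : ℚ) ≤ mult t H := by exact_mod_cast one_le_mult hH
      simpa using inv_le_one_of_one_le₀ this
    have h2 := sum_inv_mult_le (m := 2) (by norm_num) hc (fun M hM => (hR M hM).2)
    have h3 : (0 : ℚ) ≤ 1 / mult t H := by positivity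
    by_cases hHR : H ∈ R
    · rw [Finset.insert_eq_of_mem hHR]
      push_cast at h2
      linarith
    · rw [Finset.sum_insert hHR]
      push_cast at h2
      linarith

/-- If the class of `H` is counted already, one representative of a pencil through `H` becomes
superfluous. -/
theorem exists_erase_representative {H : Line3} {R : Finset Line3} {n : ℕ} (hc : R.card ≤ n + 1)
    (hH : ∃ M ∈ R, JoinedIn (commonTangents t) H M) :
    ∃ R' ⊆ R, R'.card ≤ n ∧ ∀ L, (∃ M ∈ R, JoinedIn (commonTangents t) L M) →
      JoinedIn (commonTangents t) L H ∨ ∃ M ∈ R', JoinedIn (commonTangents t) L M := by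
  classical
  obtain ⟨M₀, hM₀, hj⟩ := hH
  refine ⟨R.erase M₀, Finset.erase_subset _ _, ?_, ?_⟩
  · rw [Finset.card_erase_of_mem hM₀]; omega
  · rintro L ⟨M, hM, hL⟩
    by_cases h : M = M₀
    · subst h
      exact Or.inl (hL.trans hj.symm)
    · exact Or.inr ⟨M, Finset.mem_erase.2 ⟨h, hM⟩, hL⟩

/-- If the meeting points with the two coplanar edges differ, they span the line inside the plane;
if they agree, the line passes through a common point. -/
theorem inPlane_or_mem {i j : Fin 4} (hAi : f (cellA t e i) = κ) (hBi : f (cellB t e i) = κ)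
    (hAj : f (cellA t e j) = κ) (hBj : f (cellB t e j) = κ) {L : Line3} (hL : L ∈ cell t e) :
    InPlane f κ L ∨ ∃ o ∈ L.1, o ∈ seg t e i ∧ o ∈ seg t e j := by
  obtain ⟨x, hx, hxL⟩ := hL i
  obtain ⟨y, hy, hyL⟩ := hL j
  by_cases hxy : x = y
  · subst hxy
    exact Or.inr ⟨x, hxL, hx, hy⟩
  · exact Or.inl (inPlane_of_two_mem hxy hxL hyL (map_eq_of_mem_segment hAi hBi hx)
      (map_eq_of_mem_segment hAj hBj hy))

theorem eq_of_mem_of_edgeLine_ne {i j : Fin 4} (hne : edgeLine t e i ≠ edgeLine t e j) {o o' : E3}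
    (h1 : o ∈ seg t e i) (h2 : o ∈ seg t e j) (h3 : o' ∈ seg t e i) (h4 : o' ∈ seg t e j) :
    o = o' := by
  by_contra h
  exact hne (eq_of_two_mem h (seg_subset_edgeLine h1) (seg_subset_edgeLine h3)
    (seg_subset_edgeLine h2) (seg_subset_edgeLine h4))

end TriTangent

/-! ### Two or three coplanar edges -/

namespace TriTangent

open Set

variable {t : Fin 4 → Affine.Triangle ℝ E3} {e : Fin 4 → Fin 3} {f : E3 →ₗ[ℝ] ℝ} {κ : ℝ}

theorem cellBound_of_representatives {R : Finset Line3} {n m : ℕ} (hm : 0 < m) (hc : R.card ≤ n)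
    (hR : ∀ L ∈ R, L ∈ cell t e ∧ m ≤ mult t L)
    (hcov : ∀ L ∈ cell t e, ∃ M ∈ R, JoinedIn (commonTangents t) L M) : CellBound t e (n / m) :=
  ⟨R, fun L hL => (hR L hL).1, hcov, sum_inv_mult_le hm hc fun L hL => (hR L hL).2⟩

theorem cellBound_of_two_classes (P : Line3 → Prop)
    (h : ∀ L ∈ cell t e, ∀ M ∈ cell t e, (P L ↔ P M) → JoinedIn (commonTangents t) L M) :
    CellBound t e 2 := by
  classical
  have key : ∀ Q : Line3 → Prop, (∀ L ∈ cell t e, ∀ M ∈ cell t e, Q L → Q M →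
      JoinedIn (commonTangents t) L M) → ∃ R : Finset Line3, R.card ≤ 1 ∧ (∀ L ∈ R, L ∈ cell t e) ∧
      ∀ L ∈ cell t e, Q L → ∃ M ∈ R, JoinedIn (commonTangents t) L M := by
    intro Q hQ
    by_cases hex : ∃ M ∈ cell t e, Q M
    · obtain ⟨M, hM, hQM⟩ := hex
      exact ⟨{M}, by simp, by simpa using hM, fun L hL hQL => ⟨M, by simp, hQ L hL M hM hQL hQM⟩⟩
    · push Not at hex
      exact ⟨∅, by simp, by simp, fun L hL hQL => absurd hQL (hex L hL)⟩
  obtain ⟨R₁, a1, a2, a3⟩ := key P fun L hL M hM h1 h2 => h L hL M hM ⟨fun _ => h2, fun _ => h1⟩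
  obtain ⟨R₂, b1, b2, b3⟩ := key (fun L => ¬ P L) fun L hL M hM h1 h2 =>
    h L hL M hM ⟨fun h => absurd h h1, fun h => absurd h h2⟩
  have := cellBound_of_representatives (t := t) (e := e) (R := R₁ ∪ R₂) (n := 2) (m := 1)
    (by norm_num) ((Finset.card_union_le _ _).trans (by omega))
    (by
      intro L hL
      have hc : L ∈ cell t e := (Finset.mem_union.1 hL).elim (a2 L) (b2 L)
      exact ⟨hc, one_le_mult hc⟩)
    (by
      intro L hL
      by_cases hP : P L
      · obtain ⟨M, hM, hj⟩ := a3 L hL hP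
        exact ⟨M, Finset.mem_union_left _ hM, hj⟩
      · obtain ⟨M, hM, hj⟩ := b3 L hL hP
        exact ⟨M, Finset.mem_union_right _ hM, hj⟩)
  simpa using this

theorem InPlane.mem_of_mem_seg {l : Fin 4} (hl : ¬ (f (cellA t e l) = κ ∧ f (cellB t e l) = κ))
    {p : E3} (hp : p ∈ seg t e l) (hfp : f p = κ) {L : Line3} (hL : L ∈ cell t e)
    (hLπ : InPlane f κ L) : p ∈ L.1 := by
  obtain ⟨x, hx, hxL⟩ := hL l
  rwa [eq_of_mem_seg_of_map_eq hl hp hx hfp (hLπ x hxL)]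

/-- Transversals in a plane that pass through one point. -/
theorem cellBound_of_planar_pencil (hf : f ≠ 0) {p : E3} (hp : f p = κ) {J : Finset (Fin 4)}
    (hJ : ∀ k ∉ J, p ∈ seg t e k) (hpl : ∀ k ∈ J, f (cellA t e k) = κ ∧ f (cellB t e k) = κ)
    (hJ2 : 2 ≤ J.card) (h : ∀ L ∈ cell t e, InPlane f κ L ∧ p ∈ L.1) :
    CellBound t e (J.card / 2) := by
  classical
  set I : Finset (Fin 4) := Finset.univ.filter fun k => p ∉ seg t e k with hI
  have hIJ : I ⊆ J := by
    intro k hk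
    by_contra hkJ
    exact (Finset.mem_filter.1 hk).2 (hJ k hkJ)
  rcases I.eq_empty_or_nonempty with h0 | h0
  · have hall : ∀ k, p ∈ seg t e k := by
      intro k
      by_contra hk
      have : k ∈ I := by simp [hI, hk]
      simp [h0] at this
    refine (cellBound_of_joinedIn fun L hL M hM => joinedIn_of_mem_of_mem (l := 0)
      (fun k _ => hall k) hL hM (h L hL).2 (h M hM).2).mono ?_
    have : (2 : ℚ) ≤ J.card := by exact_mod_cast hJ2
    linarith
  · obtain ⟨R, r1, r2, r3⟩ := exists_planar_pencil_representatives (t := t) (e := e) hf hp (I := I)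
      (fun k => by simp [hI]) h0 (fun k hk => hpl k (hIJ (by simp [hI, hk])))
    exact_mod_cast cellBound_of_representatives (m := 2) (by norm_num)
      (r1.trans (Finset.card_le_card hIJ)) r2 (fun L hL => r3 L hL (h L hL).2 (h L hL).1)

/-- The edge `l` meets the plane in a single point, through which all transversals pass; the planar
pencil has three arcs of weight one half. -/
theorem cellBound_of_forall_inPlane_of_three (hf : f ≠ 0) {l : Fin 4}
    (hpl : ∀ k ≠ l, f (cellA t e k) = κ ∧ f (cellB t e k) = κ)
    (hl : ¬ (f (cellA t e l) = κ ∧ f (cellB t e l) = κ)) (h : ∀ L ∈ cell t e, InPlane f κ L) :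
    CellBound t e (3 / 2) := by
  rcases (cell t e).eq_empty_or_nonempty with h0 | ⟨L₀, hL₀⟩
  · exact (cellBound_of_joinedIn (by simp [h0])).mono (by norm_num)
  obtain ⟨p, hp, hpL⟩ := hL₀ l
  have hfp := h L₀ hL₀ p hpL
  have := cellBound_of_planar_pencil hf hfp (J := Finset.univ.erase l)
    (fun k hk => by
      have : k = l := by simpa using hk
      rwa [this])
    (fun k hk => hpl k (Finset.ne_of_mem_erase hk)) (by simp)
    (fun L hL => ⟨h L hL, (h L hL).mem_of_mem_seg hl hp hfp hL⟩)
  simpa using this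

/-- Transversals outside the plane pass through a common point `o` of the three coplanar edges, and
planar ones through the trace `p` of the edge `l`. If both kinds are needed, the line `op` is a hub:
it absorbs the star of `o` and one of the at most three classes of the pencil at `p`, so the weight
is 1 + 2/2. -/
theorem cellBound_of_three_in_plane (hf : f ≠ 0) {i j l : Fin 4} (hil : i ≠ l) (hjl : j ≠ l)
    (hne : edgeLine t e i ≠ edgeLine t e j)
    (hpl : ∀ k ≠ l, f (cellA t e k) = κ ∧ f (cellB t e k) = κ)
    (hl : ¬ (f (cellA t e l) = κ ∧ f (cellB t e l) = κ)) : CellBound t e 2 := by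
  classical
  by_cases hall : ∀ L ∈ cell t e, InPlane f κ L
  · exact (cellBound_of_forall_inPlane_of_three hf hpl hl hall).mono (by norm_num)
  push Not at hall
  obtain ⟨L₁, hL₁, hL₁π⟩ := hall
  have hor : ∀ L ∈ cell t e, InPlane f κ L ∨ ∃ o ∈ L.1, o ∈ seg t e i ∧ o ∈ seg t e j := fun L hL =>
    inPlane_or_mem (hpl i hil).1 (hpl i hil).2 (hpl j hjl).1 (hpl j hjl).2 hL
  obtain ⟨o, hoL₁, hoi, hoj⟩ := (hor L₁ hL₁).resolve_left hL₁π
  have hfo : f o = κ := map_eq_of_mem_segment (hpl i hil).1 (hpl i hil).2 hoi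
  -- A line outside the plane meets it only in `o`, so it meets all three coplanar edges there.
  have ho : ∀ k ≠ l, o ∈ seg t e k := by
    intro k hk
    obtain ⟨y, hy, hyL⟩ := hL₁ k
    by_contra hok
    have hoy : o ≠ y := by rintro rfl; exact hok hy
    exact hL₁π (inPlane_of_two_mem hoy hoL₁ hyL hfo
      (map_eq_of_mem_segment (hpl k hk).1 (hpl k hk).2 hy))
  have hor' : ∀ L ∈ cell t e, InPlane f κ L ∨ o ∈ L.1 := by
    intro L hL
    refine (hor L hL).imp_right ?_
    rintro ⟨o', h1, h2, h3⟩
    rwa [eq_of_mem_of_edgeLine_ne hne hoi hoj h2 h3]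
  by_cases hallo : ∀ L ∈ cell t e, o ∈ L.1
  · exact (cellBound_of_joinedIn fun L hL M hM =>
      joinedIn_of_mem_of_mem ho hL hM (hallo L hL) (hallo M hM)).mono one_le_two
  push Not at hallo
  obtain ⟨L₂, hL₂, hoL₂⟩ := hallo
  have hL₂π := (hor' L₂ hL₂).resolve_right hoL₂
  obtain ⟨p, hp, hpL⟩ := hL₂ l
  have hfp := hL₂π p hpL
  have hpo : p - o ≠ 0 := fun h0 => hoL₂ (by rwa [← sub_eq_zero.1 h0])
  set H := ln o (p - o) with hH
  have hoH : o ∈ H.1 := left_mem_ln hpo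
  have hpH : p ∈ H.1 := (mem_ln hpo).2 ⟨1, by simp⟩
  have hHc : H ∈ cell t e := by
    intro k
    by_cases hk : k = l
    · exact ⟨p, hk ▸ hp, hpH⟩
    · exact ⟨o, ho k hk, hoH⟩
  set I : Finset (Fin 4) := Finset.univ.filter fun k => p ∉ seg t e k with hI
  have hIl : I ⊆ Finset.univ.erase l := by
    intro k hk
    refine Finset.mem_erase.2 ⟨?_, Finset.mem_univ _⟩
    rintro rfl
    exact (Finset.mem_filter.1 hk).2 hp
  have hIc : I.card ≤ 3 := by simpa using Finset.card_le_card hIl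
  have hI0 : I.Nonempty := by
    rw [Finset.nonempty_iff_ne_empty]
    intro h0
    have hmem : ∀ k, p ∈ seg t e k := by
      intro k
      by_contra hk
      have : k ∈ I := by simp [hI, hk]
      simp [h0] at this
    exact hpo (sub_eq_zero.2 (eq_of_mem_of_edgeLine_ne hne (hmem i) (hmem j) hoi hoj))
  obtain ⟨R, r1, r2, r3⟩ := exists_planar_pencil_representatives (t := t) (e := e) hf hfp (I := I)
    (fun k => by simp [hI]) hI0 (fun k hk => hpl k (by rintro rfl; exact hk hp))
  have hHπ : InPlane f κ H := inPlane_of_two_mem (sub_ne_zero.1 hpo) hpH hoH hfp hfo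
  obtain ⟨R', s1, s2, s3⟩ := exists_erase_representative (n := 2) (r1.trans hIc)
    (r3 H hHc hpH hHπ)
  have := cellBound_of_hub hHc s2 (fun M hM => r2 M (s1 hM)) (by
    intro L hL
    rcases hor' L hL with h | h
    · exact s3 L (r3 L hL (h.mem_of_mem_seg hl hp hfp hL) h)
    · exact Or.inl (joinedIn_of_mem_of_mem ho hL hHc h hoH))
  norm_num at this
  exact this

/-- The two remaining edges have single traces `p` and `q` in the plane. If they differ, only the
line `pq` is possible; if they agree, the pencil has two arcs of weight one half. -/
theorem cellBound_of_forall_inPlane_of_two (hf : f ≠ 0) {i j k l : Fin 4} (hij : i ≠ j)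
    (hex : ∀ m, m = i ∨ m = j ∨ m = k ∨ m = l)
    (hi : f (cellA t e i) = κ ∧ f (cellB t e i) = κ)
    (hj : f (cellA t e j) = κ ∧ f (cellB t e j) = κ)
    (hk : ¬ (f (cellA t e k) = κ ∧ f (cellB t e k) = κ))
    (hl : ¬ (f (cellA t e l) = κ ∧ f (cellB t e l) = κ)) (h : ∀ L ∈ cell t e, InPlane f κ L) :
    CellBound t e 1 := by
  classical
  rcases (cell t e).eq_empty_or_nonempty with h0 | ⟨L₀, hL₀⟩
  · exact (cellBound_of_joinedIn (by simp [h0]))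
  obtain ⟨p, hp, hpL⟩ := hL₀ k
  obtain ⟨q, hq, hqL⟩ := hL₀ l
  have hfp := h L₀ hL₀ p hpL
  have hfq := h L₀ hL₀ q hqL
  have hpm : ∀ L ∈ cell t e, p ∈ L.1 := fun L hL => (h L hL).mem_of_mem_seg hk hp hfp hL
  have hqm : ∀ L ∈ cell t e, q ∈ L.1 := fun L hL => (h L hL).mem_of_mem_seg hl hq hfq hL
  by_cases hpq : p = q
  · subst hpq
    have := cellBound_of_planar_pencil hf hfp (J := {i, j})
      (fun m hm => by
        rcases hex m with rfl | rfl | rfl | rfl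
        · simp at hm
        · simp at hm
        · exact hp
        · exact hq)
      (fun m hm => by
        rcases Finset.mem_insert.1 hm with rfl | hm
        · exact hi
        · rwa [Finset.mem_singleton.1 hm])
      (by rw [Finset.card_pair hij]) (fun L hL => ⟨h L hL, hpm L hL⟩)
    rw [Finset.card_pair hij] at this
    norm_num at this
    exact this
  · refine cellBound_of_joinedIn fun L hL M hM => ?_
    rw [eq_of_two_mem hpq (hpm L hL) (hqm L hL) (hpm M hM) (hqm M hM)]
    exact JoinedIn.refl (cell_subset hM)

/-- The directions from a point towards a convex set form a convex cone; this keeps the parameters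
convex even when two segments are to be met at once. -/
theorem convex_cone_translate {s : Set E3} (hs : Convex ℝ s) (o : E3) :
    Convex ℝ {v : E3 | ∃ r : ℝ, 0 < r ∧ ∃ x ∈ s, v = r • (x - o)} := by
  rintro _ ⟨r, hr, x, hx, rfl⟩ _ ⟨r', hr', x', hx', rfl⟩ a b ha hb hab
  have hpos : 0 < a * r + b * r' := by
    rcases ha.eq_or_lt with rfl | ha
    · have : b = 1 := by linarith
      subst this
      linarith
    · have := mul_pos ha hr
      have := mul_nonneg hb hr'.le
      linarith
  refine ⟨a * r + b * r', hpos, _, hs hx hx' (a := a * r / (a * r + b * r'))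
    (b := b * r' / (a * r + b * r')) (by positivity) (by positivity) (by field_simp), ?_⟩
  have e1 : (a * r + b * r') * (a * r / (a * r + b * r')) = a * r := by field_simp
  have e2 : (a * r + b * r') * (b * r' / (a * r + b * r')) = b * r' := by field_simp
  rw [smul_sub (a * r + b * r'), smul_add (a * r + b * r'), smul_smul (a * r + b * r'),
    smul_smul (a * r + b * r'), e1, e2]
  module

/-- Lines through a point of two segments meeting the two others on prescribed sides. -/
theorem joinedIn_of_same_side {o : E3} {k l : Fin 4} (ho : ∀ m, m ≠ k → m ≠ l → o ∈ seg t e m)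
    (hok : o ∉ seg t e k) {L M : Line3} (hoL : o ∈ L.1) (hoM : o ∈ M.1) {x y x' y' : E3}
    (hx : x ∈ seg t e k) (hy : y ∈ seg t e l) (hx' : x' ∈ seg t e k) (hy' : y' ∈ seg t e l)
    (hxL : x ∈ L.1) (hxM : x' ∈ M.1) {c c' : ℝ} (hc : x - o = c • (y - o))
    (hc' : x' - o = c' • (y' - o)) (hcc : 0 < c * c') : JoinedIn (commonTangents t) L M := by
  have hc0 : c ≠ 0 := by rintro rfl; simp at hcc
  have hne : ∀ x ∈ seg t e k, x - o ≠ 0 := fun x hx h0 => hok (sub_eq_zero.1 h0 ▸ hx)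
  -- A direction `v` pointing towards the segment `k` must point towards the segment `l` after
  -- multiplication by `c`. Only the sign of `c` matters, so `c'` leads to the same convex set.
  let φ : E3 →ₗ[ℝ] E3 := c • LinearMap.id
  have hS : Convex ℝ ({v : E3 | ∃ r : ℝ, 0 < r ∧ ∃ x ∈ seg t e k, v = r • (x - o)} ∩
      φ ⁻¹' {v : E3 | ∃ r : ℝ, 0 < r ∧ ∃ x ∈ seg t e l, v = r • (x - o)}) :=
    (convex_cone_translate (convex_segment _ _) o).inter
      ((convex_cone_translate (convex_segment _ _) o).linear_preimage φ)
  have hS0 : ∀ v ∈ {v : E3 | ∃ r : ℝ, 0 < r ∧ ∃ x ∈ seg t e k, v = r • (x - o)} ∩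
      φ ⁻¹' {v : E3 | ∃ r : ℝ, 0 < r ∧ ∃ x ∈ seg t e l, v = r • (x - o)}, v ≠ 0 := by
    rintro v ⟨⟨r, hr, z, hz, rfl⟩, -⟩
    exact smul_ne_zero hr.ne' (hne z hz)
  rw [eq_ln (hne x hx) hoL (by simpa using hxL), eq_ln (hne x' hx') hoM (by simpa using hxM)]
  refine joinedIn_ln_of_convex hS (p := fun _ => o) (v := fun v => v) (by fun_prop) (by fun_prop)
    hS0 ?_ ⟨⟨1, one_pos, x, hx, by simp⟩, ?_⟩ ⟨⟨1, one_pos, x', hx', by simp⟩, ?_⟩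
  · rintro v hv
    have hv0 := hS0 v hv
    obtain ⟨⟨r, hr, z, hz, hvz⟩, r', hr', z', hz', hvz'⟩ := hv
    refine cell_subset (e := e) fun m => ?_
    by_cases hmk : m = k
    · subst hmk
      refine ⟨z, hz, (mem_ln hv0).2 ⟨r⁻¹, ?_⟩⟩
      rw [hvz, smul_smul, inv_mul_cancel₀ hr.ne']; simp
    by_cases hml : m = l
    · subst hml
      refine ⟨z', hz', (mem_ln hv0).2 ⟨r'⁻¹ * c, ?_⟩⟩
      have : c • v = r' • (z' - o) := by simpa [φ] using hvz'
      rw [mul_smul, this, smul_smul, inv_mul_cancel₀ hr'.ne']; simp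
    exact ⟨o, ho m hmk hml, left_mem_ln hv0⟩
  · refine ⟨c * c, mul_self_pos.2 hc0, y, hy, ?_⟩
    simp [φ, hc, smul_smul]
  · refine ⟨c * c', hcc, y', hy', ?_⟩
    simp [φ, hc', smul_smul, mul_comm c c']

theorem exists_smul_sub_of_mem {o x y : E3} {L : Line3} (ho : o ∈ L.1) (hx : x ∈ L.1)
    (hy : y ∈ L.1) (hox : o ≠ x) (hoy : o ≠ y) : ∃ c : ℝ, c ≠ 0 ∧ x - o = c • (y - o) := by
  obtain ⟨c, hc⟩ := (mem_iff_of_two_mem hoy ho hy).1 hx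
  have h : x - o = c • (y - o) := by rw [hc]; simp
  refine ⟨c, ?_, h⟩
  rintro rfl
  rw [zero_smul] at h
  exact hox (sub_eq_zero.1 h).symm

/-- Two lines through a point of a plane meeting two further lines on opposite sides force the
point to be collinear with the traces of these lines. -/
theorem collinear_traces_of_opposite {k l : Fin 4} {o p q x y x' y' : E3}
    (hk : ¬ (f (cellA t e k) = κ ∧ f (cellB t e k) = κ))
    (ho : f o = κ) (hfp : f p = κ)
    (hfq : f q = κ) (hp : p ∈ (edgeLine t e k).1) (hq : q ∈ (edgeLine t e l).1)
    (hok : o ∉ (edgeLine t e k).1) (hol : o ∉ (edgeLine t e l).1)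
    (hx : x ∈ (edgeLine t e k).1) (hx' : x' ∈ (edgeLine t e k).1) (hy : y ∈ (edgeLine t e l).1)
    (hy' : y' ∈ (edgeLine t e l).1) {c c' : ℝ} (hc : x - o = c • (y - o))
    (hc' : x' - o = c' • (y' - o)) (hcc : c * c' < 0) :
    x ≠ x' ∧ y ≠ y' ∧ ∃ m : ℝ, q - o = m • (p - o) := by
  have hc0 : c ≠ 0 := by rintro rfl; simp at hcc
  have hc0' : c' ≠ 0 := by rintro rfl; simp at hcc
  have hcne : c ≠ c' := by rintro rfl; nlinarith [mul_self_nonneg c]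
  have hyx : y - o = c⁻¹ • (x - o) := by rw [hc, smul_smul, inv_mul_cancel₀ hc0, one_smul]
  have hyx' : y' - o = c'⁻¹ • (x' - o) := by rw [hc', smul_smul, inv_mul_cancel₀ hc0', one_smul]
  -- Points `u` and `v` of a line with `u - o = m • (v - o)` and `m ≠ 1` put `o` on the line. This
  -- excludes that one of the two edges is met twice in the same point.
  have aux : ∀ {L : Line3} {u v : E3} {m : ℝ}, o ∉ L.1 → u ∈ L.1 → v ∈ L.1 → m ≠ 1 →
      u - o = m • (v - o) → False := by
    intro L u v m hoL hu hv hm huv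
    have huv' : u ≠ v := by
      rintro rfl
      have : (1 - m) • (u - o) = 0 := by rw [sub_smul, one_smul, ← huv, sub_self]
      rcases smul_eq_zero.1 this with h | h
      · exact hm (by linarith)
      · exact hoL (by rwa [← sub_eq_zero.1 h])
    apply hoL
    rw [mem_iff_of_two_mem huv' hu hv]
    have h1 : m - 1 ≠ 0 := sub_ne_zero.2 hm
    refine ⟨m * (m - 1)⁻¹, ?_⟩
    have e1 : u = o + m • (v - o) := by rw [← huv]; abel
    have e2 : m = (m - 1) * (m * (m - 1)⁻¹) := by field_simp
    rw [e1]
    have : o + m • (v - o) + (m * (m - 1)⁻¹) • (v - (o + m • (v - o))) =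
      o + (m - (m - 1) * (m * (m - 1)⁻¹)) • (v - o) := by module
    rw [this, ← e2, sub_self, zero_smul, add_zero]
  have hxx : x ≠ x' := by
    rintro rfl
    refine aux hol hy hy' (m := c⁻¹ * c') ?_ ?_
    · intro h
      apply hcne
      field_simp at h
      exact h.symm
    · rw [hyx, hc', smul_smul]
  have hyy : y ≠ y' := by
    rintro rfl
    refine aux hok hx hx' (m := c * c'⁻¹) ?_ ?_
    · intro h
      apply hcne
      field_simp at h
      exact h
    · rw [hc, hyx', smul_smul]
  refine ⟨hxx, hyy, ?_⟩
  obtain ⟨s, hs⟩ := (mem_iff_of_two_mem hxx hx hx').1 hp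
  obtain ⟨s', hs'⟩ := (mem_iff_of_two_mem hyy hy hy').1 hq
  have ep : p - o = (1 - s) • (x - o) + s • (x' - o) := by rw [hs]; module
  have eq : q - o = ((1 - s') * c⁻¹) • (x - o) + (s' * c'⁻¹) • (x' - o) := by
    rw [mul_smul, mul_smul, ← hyx, ← hyx', hs']; module
  have fp := congrArg f ep
  have fq := congrArg f eq
  rw [map_sub, hfp, ho, sub_self, map_add, map_smul, map_smul, smul_eq_mul, smul_eq_mul] at fp
  rw [map_sub, hfq, ho, sub_self, map_add, map_smul, map_smul, smul_eq_mul, smul_eq_mul] at fq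
  have hF : ¬ (f (x - o) = 0 ∧ f (x' - o) = 0) := by
    rintro ⟨h1, h2⟩
    rw [map_sub, ho, sub_eq_zero] at h1 h2
    exact hxx (eq_of_mem_edgeLine_of_map_eq hk hx hx' h1 h2)
  -- In the basis `x - o`, `x' - o`, the traces have coordinate vectors annihilated by the same
  -- nonzero functional, the restriction of `f`; hence they are parallel.
  have hbr : br (1 - s, s) ((1 - s') * c⁻¹, s' * c'⁻¹) = 0 := by
    simp only [br]
    rcases not_and_or.1 hF with h | h
    · apply (mul_eq_zero.1 (_ : f (x - o) * _ = 0)).resolve_left h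
      linear_combination (s' * c'⁻¹) * fp.symm - s * fq.symm
    · apply (mul_eq_zero.1 (_ : f (x' - o) * _ = 0)).resolve_left h
      linear_combination (1 - s) * fq.symm - ((1 - s') * c⁻¹) * fp.symm
  have h0 : ((1 - s, s) : ℝ × ℝ) ≠ 0 := by
    intro h
    rw [Prod.mk_eq_zero] at h
    linarith [h.1, h.2]
  obtain ⟨m, hm⟩ := exists_smul_of_br_eq_zero h0 hbr
  rw [Prod.smul_mk, Prod.mk.injEq] at hm
  refine ⟨m, ?_⟩
  rw [eq, ep, hm.1, hm.2]
  simp only [smul_eq_mul]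
  module

theorem exists_plane_of_three (a b c : E3) : ∃ f : E3 →ₗ[ℝ] ℝ, f ≠ 0 ∧ f b = f a ∧ f c = f a := by
  have hne : Submodule.span ℝ (Set.range ![b - a, c - a]) ≠ ⊤ := by
    intro htop
    have h1 := finrank_range_le_card (R := ℝ) ![b - a, c - a]
    rw [Set.finrank, htop, finrank_top] at h1
    simp at h1
  obtain ⟨f, hf, hle⟩ := Submodule.exists_le_ker_of_lt_top _ (lt_top_iff_ne_top.2 hne)
  have hz : ∀ i : Fin 2, f (![b - a, c - a] i) = 0 := fun i =>
    hle (Submodule.subset_span ⟨i, rfl⟩)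
  have h0 := hz 0
  have h1 := hz 1
  simp only [Matrix.cons_val_zero, Matrix.cons_val_one, map_sub] at h0 h1
  exact ⟨f, hf, by linarith, by linarith⟩

/-- Planar transversals pass through the traces `p` and `q` of the edges `k` and `l`, the others
through the common point `o` of the coplanar edges. The star of `o` splits into at most two convex
classes, according to whether `k` and `l` are met on the same side of `o`. The cases measure how
these classes interact with the planar lines. -/
theorem cellBound_of_two_in_plane (hf : f ≠ 0) {i j k l : Fin 4} (hij : i ≠ j) (hkl : k ≠ l)
    (hex : ∀ m, m = i ∨ m = j ∨ m = k ∨ m = l) (hne : edgeLine t e i ≠ edgeLine t e j)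
    (hi : f (cellA t e i) = κ ∧ f (cellB t e i) = κ)
    (hj : f (cellA t e j) = κ ∧ f (cellB t e j) = κ)
    (hk : ¬ (f (cellA t e k) = κ ∧ f (cellB t e k) = κ))
    (hl : ¬ (f (cellA t e l) = κ ∧ f (cellB t e l) = κ)) : CellBound t e 2 := by
  classical
  by_cases hall : ∀ L ∈ cell t e, InPlane f κ L
  · exact (cellBound_of_forall_inPlane_of_two hf hij hex hi hj hk hl hall).mono one_le_two
  push Not at hall
  obtain ⟨L₁, hL₁, hL₁π⟩ := hall
  have hor : ∀ L ∈ cell t e, InPlane f κ L ∨ ∃ o ∈ L.1, o ∈ seg t e i ∧ o ∈ seg t e j := fun L hL =>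
    inPlane_or_mem hi.1 hi.2 hj.1 hj.2 hL
  obtain ⟨o, hoL₁, hoi, hoj⟩ := (hor L₁ hL₁).resolve_left hL₁π
  have hfo : f o = κ := map_eq_of_mem_segment hi.1 hi.2 hoi
  have hor' : ∀ L ∈ cell t e, InPlane f κ L ∨ o ∈ L.1 := by
    intro L hL
    refine (hor L hL).imp_right ?_
    rintro ⟨o', h1, h2, h3⟩
    rwa [eq_of_mem_of_edgeLine_ne hne hoi hoj h2 h3]
  -- If `o` lies on a transverse edge, it is the trace of that edge, so planar transversals pass
  -- through `o` as well and everything is one star.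
  have one : ∀ k l : Fin 4, (∀ m, m = i ∨ m = j ∨ m = k ∨ m = l) →
      ¬ (f (cellA t e k) = κ ∧ f (cellB t e k) = κ) → o ∈ seg t e k → CellBound t e 2 := by
    intro k l hex hk hok
    have hallo : ∀ L ∈ cell t e, o ∈ L.1 := fun L hL =>
      (hor' L hL).elim (fun h => h.mem_of_mem_seg hk hok hfo hL) id
    refine (cellBound_of_joinedIn fun L hL M hM => joinedIn_of_mem_of_mem (l := l) ?_ hL hM
      (hallo L hL) (hallo M hM)).mono one_le_two
    intro m hm
    rcases hex m with rfl | rfl | rfl | rfl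
    · exact hoi
    · exact hoj
    · exact hok
    · exact absurd rfl hm
  by_cases hok : o ∈ seg t e k
  · exact one k l hex hk hok
  by_cases hol : o ∈ seg t e l
  · exact one l k (fun m => by rcases hex m with h | h | h | h <;> simp [h]) hl hol
  have ho : ∀ m, m ≠ k → m ≠ l → o ∈ seg t e m := by
    intro m hmk hml
    rcases hex m with rfl | rfl | rfl | rfl
    · exact hoi
    · exact hoj
    · exact absurd rfl hmk
    · exact absurd rfl hml
  have hside : ∀ L ∈ cell t e, o ∈ L.1 → ∃ x ∈ seg t e k, ∃ y ∈ seg t e l, x ∈ L.1 ∧ y ∈ L.1 ∧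
      ∃ c : ℝ, c ≠ 0 ∧ x - o = c • (y - o) := by
    intro L hL hoL
    obtain ⟨x, hx, hxL⟩ := hL k
    obtain ⟨y, hy, hyL⟩ := hL l
    exact ⟨x, hx, y, hy, hxL, hyL, exists_smul_sub_of_mem hoL hxL hyL
      (by rintro rfl; exact hok hx) (by rintro rfl; exact hol hy)⟩
  by_cases hallo : ∀ L ∈ cell t e, o ∈ L.1
  · refine cellBound_of_two_classes (fun L => ∃ x ∈ seg t e k, ∃ y ∈ seg t e l, x ∈ L.1 ∧ y ∈ L.1 ∧
      ∃ c : ℝ, 0 < c ∧ x - o = c • (y - o)) ?_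
    intro L hL M hM hLM
    by_cases hP : ∃ x ∈ seg t e k, ∃ y ∈ seg t e l, x ∈ L.1 ∧ y ∈ L.1 ∧
      ∃ c : ℝ, 0 < c ∧ x - o = c • (y - o)
    · obtain ⟨x', hx', y', hy', hxM, hyM, c', hc', h'⟩ := hLM.1 hP
      obtain ⟨x, hx, y, hy, hxL, hyL, c, hc, h⟩ := hP
      exact joinedIn_of_same_side ho hok (hallo L hL) (hallo M hM) hx hy hx' hy' hxL hxM h h'
        (mul_pos hc hc')
    · obtain ⟨x, hx, y, hy, hxL, hyL, c, hc, h⟩ := hside L hL (hallo L hL)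
      obtain ⟨x', hx', y', hy', hxM, hyM, c', hc', h'⟩ := hside M hM (hallo M hM)
      have h1 : c < 0 := by
        by_contra hn
        exact hP ⟨x, hx, y, hy, hxL, hyL, c, lt_of_le_of_ne (not_lt.1 hn) hc.symm, h⟩
      have h2 : c' < 0 := by
        by_contra hn
        exact hP (hLM.2 ⟨x', hx', y', hy', hxM, hyM, c',
          lt_of_le_of_ne (not_lt.1 hn) hc'.symm, h'⟩)
      exact joinedIn_of_same_side ho hok (hallo L hL) (hallo M hM) hx hy hx' hy' hxL hxM h h'
        (mul_pos_of_neg_of_neg h1 h2)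
  push Not at hallo
  obtain ⟨L₂, hL₂, hoL₂⟩ := hallo
  have hL₂π := (hor' L₂ hL₂).resolve_right hoL₂
  obtain ⟨p, hp, hpL⟩ := hL₂ k
  obtain ⟨q, hq, hqL⟩ := hL₂ l
  have hfp := hL₂π p hpL
  have hfq := hL₂π q hqL
  have hpm : ∀ L ∈ cell t e, InPlane f κ L → p ∈ L.1 := fun L hL h => h.mem_of_mem_seg hk hp hfp hL
  have hqm : ∀ L ∈ cell t e, InPlane f κ L → q ∈ L.1 := fun L hL h => h.mem_of_mem_seg hl hq hfq hL
  have hokl : o ∉ (edgeLine t e k).1 := fun h => hok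
    (by rwa [eq_of_mem_edgeLine_of_map_eq hk h (seg_subset_edgeLine hp) hfo hfp])
  have holl : o ∉ (edgeLine t e l).1 := fun h => hol
    (by rwa [eq_of_mem_edgeLine_of_map_eq hl h (seg_subset_edgeLine hq) hfo hfq])
  by_cases hpq : p = q
  · subst hpq
    -- For coinciding traces the line `op` is a hub: it is a planar transversal and belongs to the
    -- star of `o`.
    have hpo : p - o ≠ 0 := fun h0 => hok (by rwa [← sub_eq_zero.1 h0])
    set H := ln o (p - o) with hH
    have hoH : o ∈ H.1 := left_mem_ln hpo
    have hpH : p ∈ H.1 := (mem_ln hpo).2 ⟨1, by simp⟩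
    have hHc : H ∈ cell t e := by
      intro m
      by_cases hmk : m = k
      · exact ⟨p, hmk ▸ hp, hpH⟩
      by_cases hml : m = l
      · exact ⟨p, hml ▸ hq, hpH⟩
      exact ⟨o, ho m hmk hml, hoH⟩
    have hHπ : InPlane f κ H := inPlane_of_two_mem (sub_ne_zero.1 hpo) hpH hoH hfp hfo
    set I : Finset (Fin 4) := Finset.univ.filter fun k => p ∉ seg t e k with hI
    have hIl : I ⊆ {i, j} := by
      intro m hm
      have hm' := (Finset.mem_filter.1 hm).2
      rcases hex m with rfl | rfl | rfl | rfl
      · simp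
      · simp
      · exact absurd hp hm'
      · exact absurd hq hm'
    have hIc : I.card ≤ 2 := (Finset.card_le_card hIl).trans Finset.card_le_two
    have hI0 : I.Nonempty := by
      rw [Finset.nonempty_iff_ne_empty]
      intro h0
      have hmem : ∀ k, p ∈ seg t e k := by
        intro k
        by_contra hk
        have : k ∈ I := by simp [hI, hk]
        simp [h0] at this
      exact hpo (sub_eq_zero.2 (eq_of_mem_of_edgeLine_ne hne (hmem i) (hmem j) hoi hoj))
    obtain ⟨R, r1, r2, r3⟩ := exists_planar_pencil_representatives (t := t) (e := e) hf hfp (I := I)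
      (fun k => by simp [hI]) hI0 (fun m hm => by
        rcases hex m with rfl | rfl | rfl | rfl
        · exact hi
        · exact hj
        · exact absurd hp hm
        · exact absurd hq hm)
    obtain ⟨R', s1, s2, s3⟩ := exists_erase_representative (n := 1) (r1.trans hIc)
      (r3 H hHc hpH hHπ)
    by_cases hneg : ∃ x ∈ seg t e k, ∃ y ∈ seg t e l, ∃ c : ℝ, c < 0 ∧ x - o = c • (y - o)
    · obtain ⟨x', hx', y', hy', c', hc', h'⟩ := hneg
      obtain ⟨hpx, hpy, -⟩ := collinear_traces_of_opposite (x := p) (y := p) hk hfo hfp hfp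
        (seg_subset_edgeLine hp) (seg_subset_edgeLine hq) hokl holl (seg_subset_edgeLine hp)
        (seg_subset_edgeLine hx') (seg_subset_edgeLine hq) (seg_subset_edgeLine hy')
        (one_smul ℝ (p - o)).symm h' (by linarith)
      -- The hub meets `k` and `l` in `p`, on the same side. If the opposite side occurs too, the
      -- edges `k` and `l` lie in one plane through `o`, and the star of `o` becomes a planar pencil
      -- with two arcs.
      obtain ⟨f', hf', e1, e2⟩ := exists_plane_of_three o p x'
      have e3 : f' y' = f' o := by
        have := congrArg f' h'
        rw [map_sub, map_smul, map_sub, e2, sub_self] at this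
        exact sub_eq_zero.1 ((smul_eq_zero.1 this.symm).resolve_left hc'.ne)
      have hk' := inPlane_of_two_mem hpx (seg_subset_edgeLine hp) (seg_subset_edgeLine hx') e1 e2
      have hl' := inPlane_of_two_mem hpy (seg_subset_edgeLine hq) (seg_subset_edgeLine hy') e1 e3
      have hin : ∀ L ∈ cell t e, o ∈ L.1 → InPlane f' (f' o) L := by
        intro L hL hoL
        obtain ⟨x, hx, hxL⟩ := hL k
        exact inPlane_of_two_mem (by rintro rfl; exact hok hx) hoL hxL rfl
          (hk' x (seg_subset_edgeLine hx))
      set I' : Finset (Fin 4) := Finset.univ.filter fun k => o ∉ seg t e k with hI'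
      have hIl' : I' ⊆ {k, l} := by
        intro m hm
        have hm' := (Finset.mem_filter.1 hm).2
        by_contra hmn
        simp only [Finset.mem_insert, Finset.mem_singleton, not_or] at hmn
        exact hm' (ho m hmn.1 hmn.2)
      have hIc' : I'.card ≤ 2 := (Finset.card_le_card hIl').trans Finset.card_le_two
      obtain ⟨Q, q1, q2, q3⟩ := exists_planar_pencil_representatives (t := t) (e := e) hf' (κ := f' o) rfl (I := I')
        (fun k => by simp [hI']) ⟨k, by simp [hI', hok]⟩ (fun m hm => by
          by_cases hmk : m = k
          · subst hmk
            exact ⟨hk' _ (cellA_mem_edgeLine m), hk' _ (cellB_mem_edgeLine m)⟩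
          by_cases hml : m = l
          · subst hml
            exact ⟨hl' _ (cellA_mem_edgeLine m), hl' _ (cellB_mem_edgeLine m)⟩
          exact absurd (ho m hmk hml) hm)
      obtain ⟨Q', u1, u2, u3⟩ := exists_erase_representative (n := 1) (q1.trans hIc')
        (q3 H hHc hoH (hin H hHc hoH))
      -- Each of the two planar pencils keeps one class besides that of the hub: 1 + 2/2.
      have := cellBound_of_hub hHc (R := R' ∪ Q') (n := 2)
        ((Finset.card_union_le _ _).trans (by omega))
        (fun M hM => (Finset.mem_union.1 hM).elim (fun h => r2 M (s1 h)) (fun h => q2 M (u1 h)))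
        (by
          intro L hL
          rcases hor' L hL with h | h
          · refine (s3 L (r3 L hL (hpm L hL h) h)).imp_right ?_
            rintro ⟨M, hM, hj⟩
            exact ⟨M, Finset.mem_union_left _ hM, hj⟩
          · refine (u3 L (q3 L hL h (hin L hL h))).imp_right ?_
            rintro ⟨M, hM, hj⟩
            exact ⟨M, Finset.mem_union_right _ hM, hj⟩)
      norm_num at this
      exact this
    · refine (cellBound_of_hub hHc s2 (fun M hM => r2 M (s1 hM)) ?_).mono (by norm_num)
      intro L hL
      rcases hor' L hL with h | h
      · exact s3 L (r3 L hL (hpm L hL h) h)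
      · left
        obtain ⟨x, hx, y, hy, hxL, hyL, c, hc, h1⟩ := hside L hL h
        have hc' : 0 < c := by
          by_contra hn
          exact hneg ⟨x, hx, y, hy, c, lt_of_le_of_ne (not_lt.1 hn) hc, h1⟩
        exact joinedIn_of_same_side ho hok h hoH hx hy hp hq hxL hpH h1
          (one_smul ℝ (p - o)).symm (by linarith)
  -- For different traces the only planar transversal is `pq`. Both sides in the star would make
  -- `o`, `p`, `q` collinear, whereas `L₂` contains `p` and `q` but not `o`; so the star is a single
  -- class.
  · refine cellBound_of_two_classes (fun L => o ∈ L.1) ?_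
    intro L hL M hM hLM
    by_cases hoL : o ∈ L.1
    · have hoM := hLM.1 hoL
      obtain ⟨x, hx, y, hy, hxL, hyL, c, hc, h⟩ := hside L hL hoL
      obtain ⟨x', hx', y', hy', hxM, hyM, c', hc', h'⟩ := hside M hM hoM
      rcases (mul_ne_zero hc hc').lt_or_gt with hcc | hcc
      · exfalso
        obtain ⟨-, -, m, hm⟩ := collinear_traces_of_opposite hk hfo hfp hfq
          (seg_subset_edgeLine hp) (seg_subset_edgeLine hq) hokl holl (seg_subset_edgeLine hx)
          (seg_subset_edgeLine hx') (seg_subset_edgeLine hy) (seg_subset_edgeLine hy') h h' hcc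
        have hpo : o ≠ p := by rintro rfl; exact hok hp
        have hv : p - o ≠ 0 := sub_ne_zero.2 hpo.symm
        have hq' : q ∈ (ln o (p - o)).1 := (mem_ln hv).2 ⟨m, by rw [← hm]; abel⟩
        have := eq_of_two_mem hpq hpL hqL ((mem_ln hv).2 ⟨1, by simp⟩) hq'
        exact hoL₂ (this ▸ left_mem_ln hv)
      · exact joinedIn_of_same_side ho hok hoL hoM hx hy hx' hy' hxL hxM h h' hcc
    · have hoM : o ∉ M.1 := fun h => hoL (hLM.2 h)
      have h1 := (hor' L hL).resolve_right hoL
      have h2 := (hor' M hM).resolve_right hoM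
      rw [eq_of_two_mem hpq (hpm L hL h1) (hqm L hL h1) (hpm M hM h2) (hqm M hM h2)]
      exact JoinedIn.refl (cell_subset hM)

end TriTangent

/-! ### Directions of lines meeting two disjoint plane segments -/

namespace TriTangent

open Set

/-- By `id1`, a vector with determinants of opposite signs against `u` and `v` is a combination of
them with coefficients of one sign. If `u` and `v` are parallel, pointedness makes the arc a single
direction. -/
theorem inArc_of_br_mul_nonpos {u v z : ℝ × ℝ} (h : Pointed u v) (hz : br z u * br z v ≤ 0) :
    InArc u v z := by
  have id1 : br u v • z = br z v • u - br z u • v := by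
    ext <;> simp [br] <;> ring
  by_cases h0 : br u v = 0
  · obtain ⟨c, rfl⟩ := exists_smul_of_br_eq_zero h.left_ne h0
    have hc : 0 < c := by
      by_contra hc
      have := h (-c) 1 (by linarith) zero_le_one (by module)
      linarith [this.2]
    have e1 : br z (c • u) = c * br z u := by simp [br]; ring
    rw [e1] at hz
    have hzu : br u z = 0 := by
      have h1 : br u z = - br z u := by simp [br]; ring
      have h2 : br z u * br z u ≤ 0 := by
        by_contra hn
        push Not at hn
        nlinarith [mul_pos hc hn]
      have h3 : br z u = 0 := mul_self_eq_zero.1 (le_antisymm h2 (mul_self_nonneg _))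
      rw [h1, h3, neg_zero]
    obtain ⟨d, rfl⟩ := exists_smul_of_br_eq_zero h.left_ne hzu
    exact InArc.smul (Or.inl (InCone.left _ _)) d
  · have hz' : z = (br u v)⁻¹ • (br z v • u + (-br z u) • v) := by
      rw [neg_smul, ← sub_eq_add_neg, ← id1, smul_smul, inv_mul_cancel₀ h0, one_smul]
    rw [hz']
    apply InArc.smul
    rcases le_total 0 (br z v) with h1 | h1
    · rcases h1.eq_or_lt with h2 | h2
      · rw [← h2]
        rcases le_total 0 (br z u) with h3 | h3
        · exact Or.inr ⟨0, br z u, le_rfl, h3, by module⟩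
        · exact Or.inl ⟨0, -br z u, le_rfl, by linarith, by module⟩
      · have : br z u ≤ 0 := by
          by_contra hn
          push Not at hn
          nlinarith [mul_pos hn h2]
        exact Or.inl ⟨br z v, -br z u, h1, by linarith, rfl⟩
    · rcases h1.eq_or_lt with h2 | h2
      · rw [h2]
        rcases le_total 0 (br z u) with h3 | h3
        · exact Or.inr ⟨0, br z u, le_rfl, h3, by module⟩
        · exact Or.inl ⟨0, -br z u, le_rfl, by linarith, by module⟩
      · have : 0 ≤ br z u := by
          by_contra hn
          push Not at hn
          nlinarith [mul_pos_of_neg_of_neg hn h2]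
        exact Or.inr ⟨-br z v, br z u, by linarith, this, by module⟩

theorem br_sub_right (z p q : ℝ × ℝ) : br z (q - p) = br z q - br z p := by simp [br]; ring

theorem br_anticomm (z p : ℝ × ℝ) : br z p = - br p z := by simp [br]; ring

/-- Finitely many vectors in an open half plane span a cone generated by two of them. -/
theorem exists_extreme_pair {X : Finset (ℝ × ℝ)} (hX : X.Nonempty) {φ : ℝ × ℝ →ₗ[ℝ] ℝ}
    (hφ : ∀ x ∈ X, 0 < φ x) : ∃ u ∈ X, ∃ v ∈ X, Pointed u v ∧
      (∀ x ∈ X, 0 ≤ br u x) ∧ ∀ x ∈ X, 0 ≤ br x v := by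
  obtain ⟨x₀, hx₀⟩ := hX
  -- In the affine chart where `φ` equals one, the vectors are ordered by the slope `br x₀ x / φ x`.
  -- This Plücker relation turns a comparison of slopes into the sign of a determinant.
  have plu : ∀ x y : ℝ × ℝ, φ x * br x₀ y - φ y * br x₀ x = φ x₀ * br x y := by
    intro x y
    have hz : ∀ z : ℝ × ℝ, φ z = φ (1, 0) * z.1 + φ (0, 1) * z.2 := by
      intro z
      have : z = z.1 • (1, 0) + z.2 • (0, 1) := by ext <;> simp
      nth_rw 1 [this]
      rw [map_add, map_smul, map_smul]
      simp only [smul_eq_mul]; ring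
    rw [hz x, hz y, hz x₀]
    simp only [br]; ring
  have mono : ∀ x ∈ X, ∀ y ∈ X, br x₀ x / φ x ≤ br x₀ y / φ y → 0 ≤ br x y := by
    intro x hx y hy h
    rw [div_le_div_iff₀ (hφ x hx) (hφ y hy)] at h
    have := plu x y
    by_contra hn
    push Not at hn
    nlinarith [mul_neg_of_pos_of_neg (hφ x₀ hx₀) hn]
  obtain ⟨u, hu, hu'⟩ := X.exists_min_image (fun x => br x₀ x / φ x) ⟨x₀, hx₀⟩
  obtain ⟨v, hv, hv'⟩ := X.exists_max_image (fun x => br x₀ x / φ x) ⟨x₀, hx₀⟩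
  refine ⟨u, hu, v, hv, ?_, fun x hx => mono u hu x hx (hu' x hx),
    fun x hx => mono x hx v hv (hv' x hx)⟩
  intro r s hr hs h
  have := congrArg φ h
  rw [map_add, map_smul, map_smul, map_zero, smul_eq_mul, smul_eq_mul] at this
  have h1 := hφ u hu
  have h2 := hφ v hv
  have h3 := mul_nonneg hr h1.le
  have h4 := mul_nonneg hs h2.le
  constructor
  · exact (mul_eq_zero.1 (by linarith : r * φ u = 0)).resolve_right h1.ne'
  · exact (mul_eq_zero.1 (by linarith : s * φ v = 0)).resolve_right h2.ne'

/-- The directions of the lines meeting two disjoint plane segments form an arc; a line whose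
direction is an end of the arc passes through an end of each segment. -/
theorem exists_arc_of_disjoint {a b c d : ℝ × ℝ} (h : Disjoint (segment ℝ a b) (segment ℝ c d)) :
    ∃ u v : ℝ × ℝ, Pointed u v ∧
      (∀ z, InArc u v z ↔ min (br z a) (br z b) ≤ max (br z c) (br z d) ∧
        min (br z c) (br z d) ≤ max (br z a) (br z b)) ∧
      ∀ z, z = u ∨ z = v → ∀ τ ∈ uIcc (br z a) (br z b), τ ∈ uIcc (br z c) (br z d) →
        (br z a = τ ∨ br z b = τ) ∧ (br z c = τ ∨ br z d = τ) := by
  classical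
  have hcomp : ∀ a b : ℝ × ℝ, IsCompact (segment ℝ a b) := fun a b => by
    rw [show segment ℝ a b = convexHull ℝ {a, b} from (convexHull_pair ..).symm]
    exact (Set.toFinite {a, b}).isCompact_convexHull ℝ
  -- A separating functional is positive on all differences of ends, so two of these differences
  -- span the cone of all of them.
  obtain ⟨φ, r, s, h1, h2, h3⟩ := geometric_hahn_banach_compact_closed (convex_segment a b)
    (hcomp a b) (convex_segment c d) (hcomp c d).isClosed h
  have ha := h1 a (left_mem_segment ..)
  have hb := h1 b (right_mem_segment ..)
  have hc := h3 c (left_mem_segment ..)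
  have hd := h3 d (right_mem_segment ..)
  obtain ⟨u, hu, v, hv, hpt, hux, hxv⟩ := exists_extreme_pair (X := {c - a, c - b, d - a, d - b})
    (φ := φ.toLinearMap) ⟨c - a, by simp⟩ (by
      intro x hx
      simp only [Finset.mem_insert, Finset.mem_singleton] at hx
      rcases hx with rfl | rfl | rfl | rfl <;>
      · simp only [ContinuousLinearMap.coe_coe, map_sub]
        linarith)
  set X : Finset (ℝ × ℝ) := {c - a, c - b, d - a, d - b} with hX
  have mX : ∀ x ∈ X, x = c - a ∨ x = c - b ∨ x = d - a ∨ x = d - b := by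
    intro x hx
    simpa [hX] using hx
  have hpos : ∀ x ∈ X, 0 < φ x := by
    intro x hx
    rcases mX x hx with rfl | rfl | rfl | rfl <;>
    · rw [map_sub]
      linarith
  have mca : c - a ∈ X := by simp [hX]
  have mcb : c - b ∈ X := by simp [hX]
  have mda : d - a ∈ X := by simp [hX]
  have mdb : d - b ∈ X := by simp [hX]
  have hbz : ∀ z, ∀ x ∈ X, br z x = br z c - br z a ∨ br z x = br z c - br z b ∨
      br z x = br z d - br z a ∨ br z x = br z d - br z b := by
    intro z x hx
    rcases mX x hx with rfl | rfl | rfl | rfl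
    · exact Or.inl (br_sub_right ..)
    · exact Or.inr (Or.inl (br_sub_right ..))
    · exact Or.inr (Or.inr (Or.inl (br_sub_right ..)))
    · exact Or.inr (Or.inr (Or.inr (br_sub_right ..)))
  refine ⟨u, v, hpt, fun z => ⟨fun hz => ?_, ?_⟩, ?_⟩
  -- Directions in the arc have the two extreme differences on opposite sides, so neither projected
  -- segment lies strictly beyond the other.
  · have key : (br z u ≤ 0 ∧ 0 ≤ br z v) ∨ (0 ≤ br z u ∧ br z v ≤ 0) := by
      have hex : 0 ≤ br u v := hux v hv
      rcases hz with ⟨r, s, hr, hs, hz⟩ | ⟨r, s, hr, hs, hz⟩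
      · left
        rw [hz]
        have e1 : br (r • u + s • v) u = - (s * br u v) := by simp [br]; ring
        have e2 : br (r • u + s • v) v = r * br u v := by simp [br]; ring
        rw [e1, e2]
        exact ⟨neg_nonpos.2 (mul_nonneg hs hex), mul_nonneg hr hex⟩
      · right
        rw [← neg_neg z, hz]
        have e1 : br (-(r • u + s • v)) u = s * br u v := by simp [br]; ring
        have e2 : br (-(r • u + s • v)) v = - (r * br u v) := by simp [br]; ring
        rw [e1, e2]
        exact ⟨mul_nonneg hs hex, neg_nonpos.2 (mul_nonneg hr hex)⟩
    have p1 : ∀ w ∈ X, 0 ≤ br z w → min (br z a) (br z b) ≤ max (br z c) (br z d) := by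
      intro w hw h0
      rcases hbz z w hw with h | h | h | h
      · exact (min_le_left _ _).trans ((by linarith : br z a ≤ br z c).trans (le_max_left _ _))
      · exact (min_le_right _ _).trans ((by linarith : br z b ≤ br z c).trans (le_max_left _ _))
      · exact (min_le_left _ _).trans ((by linarith : br z a ≤ br z d).trans (le_max_right _ _))
      · exact (min_le_right _ _).trans ((by linarith : br z b ≤ br z d).trans (le_max_right _ _))
    have p2 : ∀ w ∈ X, br z w ≤ 0 → min (br z c) (br z d) ≤ max (br z a) (br z b) := by
      intro w hw h0
      rcases hbz z w hw with h | h | h | h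
      · exact (min_le_left _ _).trans ((by linarith : br z c ≤ br z a).trans (le_max_left _ _))
      · exact (min_le_left _ _).trans ((by linarith : br z c ≤ br z b).trans (le_max_right _ _))
      · exact (min_le_right _ _).trans ((by linarith : br z d ≤ br z a).trans (le_max_left _ _))
      · exact (min_le_right _ _).trans ((by linarith : br z d ≤ br z b).trans (le_max_right _ _))
    rcases key with ⟨k1, k2⟩ | ⟨k1, k2⟩
    · exact ⟨p1 v hv k2, p2 u hu k1⟩
    · exact ⟨p1 u hu k1, p2 v hv k2⟩
  · rintro ⟨o1, o2⟩
    apply inArc_of_br_mul_nonpos hpt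
    have hcone : ∀ x ∈ X, InCone u v x ∧ x ≠ 0 := by
      intro x hx
      refine ⟨?_, fun h0 => by simpa [h0] using hpos x hx⟩
      have harc : InArc u v x := inArc_of_br_mul_nonpos hpt (by
        rw [br_anticomm x u, neg_mul]
        exact neg_nonpos.2 (mul_nonneg (hux x hx) (hxv x hx)))
      rcases harc with h | ⟨r, s, hr, hs, he⟩
      · exact h
      · exfalso
        have := congrArg φ he
        simp only [map_neg, map_add, map_smul, smul_eq_mul] at this
        have e1 := hpos x hx
        have e2 := mul_nonneg hr (hpos u hu).le
        have e3 := mul_nonneg hs (hpos v hv).le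
        linarith
    by_contra hn
    push Not at hn
    have side : ∀ ε : ℝ, 0 < ε * br z u → 0 < ε * br z v → ∀ x ∈ X, 0 < ε * br z x := by
      intro ε k1 k2 x hx
      obtain ⟨⟨r, s, hr, hs, hxe⟩, hx0⟩ := hcone x hx
      have e1 : ε * br z x = r * (ε * br z u) + s * (ε * br z v) := by
        rw [hxe]; simp [br]; ring
      rw [e1]
      rcases hr.eq_or_lt with h | hr
      · rcases hs.eq_or_lt with h' | hs
        · rw [hxe, ← h, ← h'] at hx0
          simp at hx0
        · rw [← h, zero_mul, zero_add]
          exact mul_pos hs k2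
      · have := mul_pos hr k1
        have := mul_nonneg hs k2.le
        linarith
    rcases pos_and_pos_or_neg_and_neg_of_mul_pos hn with ⟨k1, k2⟩ | ⟨k1, k2⟩
    · have s1 := side 1 (by linarith) (by linarith)
      have t1 := s1 _ mca
      have t2 := s1 _ mcb
      have t3 := s1 _ mda
      have t4 := s1 _ mdb
      rw [br_sub_right, one_mul] at t1 t2 t3 t4
      rcases min_le_iff.1 o2 with h | h <;> rcases le_max_iff.1 h with h | h <;> linarith
    · have s1 := side (-1) (by linarith) (by linarith)
      have t1 := s1 _ mca
      have t2 := s1 _ mcb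
      have t3 := s1 _ mda
      have t4 := s1 _ mdb
      rw [br_sub_right] at t1 t2 t3 t4
      rcases min_le_iff.1 o1 with h | h <;> rcases le_max_iff.1 h with h | h <;> linarith
  · intro z hz τ ht1 ht2
    -- For an extreme direction all differences lie on one side. One projected interval then weakly
    -- precedes the other, and a common value is an end of both.
    have tight : ∀ ε : ℝ, (∀ x ∈ X, 0 ≤ ε * br z x) → ε ≠ 0 → ∀ w ∈ X, br z w = 0 →
        (br z a = τ ∨ br z b = τ) ∧ (br z c = τ ∨ br z d = τ) := by
      intro ε hε hε0 w hw hw0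
      have t1 := hε _ mca
      have t2 := hε _ mcb
      have t3 := hε _ mda
      have t4 := hε _ mdb
      rw [br_sub_right] at t1 t2 t3 t4
      have ab : ε * br z a ≤ ε * τ ∨ ε * br z b ≤ ε * τ := by
        rcases mem_uIcc.1 ht1 with h | h <;> rcases le_total 0 ε with h' | h'
        · exact Or.inl (mul_le_mul_of_nonneg_left h.1 h')
        · exact Or.inr (mul_le_mul_of_nonpos_left h.2 h')
        · exact Or.inr (mul_le_mul_of_nonneg_left h.1 h')
        · exact Or.inl (mul_le_mul_of_nonpos_left h.2 h')
      have ab' : ε * τ ≤ ε * br z a ∨ ε * τ ≤ ε * br z b := by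
        rcases mem_uIcc.1 ht1 with h | h <;> rcases le_total 0 ε with h' | h'
        · exact Or.inr (mul_le_mul_of_nonneg_left h.2 h')
        · exact Or.inl (mul_le_mul_of_nonpos_left h.1 h')
        · exact Or.inl (mul_le_mul_of_nonneg_left h.2 h')
        · exact Or.inr (mul_le_mul_of_nonpos_left h.1 h')
      have cd : ε * br z c ≤ ε * τ ∨ ε * br z d ≤ ε * τ := by
        rcases mem_uIcc.1 ht2 with h | h <;> rcases le_total 0 ε with h' | h'
        · exact Or.inl (mul_le_mul_of_nonneg_left h.1 h')
        · exact Or.inr (mul_le_mul_of_nonpos_left h.2 h')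
        · exact Or.inr (mul_le_mul_of_nonneg_left h.1 h')
        · exact Or.inl (mul_le_mul_of_nonpos_left h.2 h')
      have pa : ε * τ ≤ ε * br z a → br z a = τ := fun h => by
        apply mul_left_cancel₀ hε0
        rcases cd with h' | h' <;> linarith
      have pb : ε * τ ≤ ε * br z b → br z b = τ := fun h => by
        apply mul_left_cancel₀ hε0
        rcases cd with h' | h' <;> linarith
      have pc : ε * br z c ≤ ε * τ → br z c = τ := fun h => by
        apply mul_left_cancel₀ hε0
        rcases ab' with h' | h' <;> linarith
      have pd : ε * br z d ≤ ε * τ → br z d = τ := fun h => by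
        apply mul_left_cancel₀ hε0
        rcases ab' with h' | h' <;> linarith
      exact ⟨ab'.imp pa pb, cd.imp pc pd⟩
    rcases hz with rfl | rfl
    · exact tight 1 (fun x hx => by rw [one_mul]; exact hux x hx) one_ne_zero z hu (br_self z)
    · refine tight (-1) (fun x hx => ?_) (by norm_num) z hv (br_self z)
      have := hxv x hx
      rw [br_anticomm] at this
      linarith

end TriTangent

/-! ### Four segments in a plane -/

namespace TriTangent

open Set

variable {t : Fin 4 → Affine.Triangle ℝ E3} {e : Fin 4 → Fin 3} {f : E3 →ₗ[ℝ] ℝ} {κ : ℝ}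

/-- The line `br z u = τ` of the plane `p + g u`. -/
noncomputable def planeLine (p : E3) (g : ℝ × ℝ →ₗ[ℝ] E3) (z : ℝ × ℝ) (τ : ℝ) : Line3 :=
  ln (p + g ((τ / (z.1 ^ 2 + z.2 ^ 2)) • (-z.2, z.1))) (g z)

section PlaneLine

variable {p : E3} {g : ℝ × ℝ →ₗ[ℝ] E3}

theorem map_ne_zero_of_injective (hg : Function.Injective g) {z : ℝ × ℝ} (hz : z ≠ 0) : g z ≠ 0 :=
  fun h => hz (hg (by simpa using h))

theorem br_foot {z : ℝ × ℝ} (hz : z ≠ 0) (τ : ℝ) :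
    br z ((τ / (z.1 ^ 2 + z.2 ^ 2)) • (-z.2, z.1)) = τ := by
  have := (sq_add_sq_pos hz).ne'
  simp only [br, Prod.smul_mk, smul_eq_mul]
  field_simp
  ring

theorem mem_planeLine (hg : Function.Injective g) {z : ℝ × ℝ} (hz : z ≠ 0) {τ : ℝ} {u : ℝ × ℝ} :
    p + g u ∈ (planeLine p g z τ).1 ↔ br z u = τ := by
  rw [planeLine, mem_ln (map_ne_zero_of_injective hg hz)]
  have hfoot := br_foot hz τ
  set x := (τ / (z.1 ^ 2 + z.2 ^ 2)) • (-z.2, z.1)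
  constructor
  · rintro ⟨c, hc⟩
    have : g u = g (x + c • z) := by
      rw [map_add, map_smul g c z]
      rw [add_assoc] at hc
      exact add_left_cancel hc
    rw [hg this, ← hfoot]
    simp [br]; ring
  · intro h
    have h1 : br z (u - x) = 0 := by rw [br_sub_right, h, hfoot, sub_self]
    obtain ⟨c, hc⟩ := exists_smul_of_br_eq_zero hz h1
    refine ⟨c, ?_⟩
    rw [add_assoc, ← map_smul, ← map_add, ← hc]
    congr 2
    abel

theorem meets_planeLine (hg : Function.Injective g) {z : ℝ × ℝ} (hz : z ≠ 0) {τ : ℝ} {a b : E3}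
    {α β : ℝ × ℝ} (ha : a = p + g α) (hb : b = p + g β) :
    Meets (planeLine p g z τ) a b ↔ τ ∈ uIcc (br z α) (br z β) := by
  have hcomb : ∀ r s : ℝ, r + s = 1 → r • a + s • b = p + g (r • α + s • β) := by
    intro r s hrs
    rw [ha, hb, map_add, map_smul, map_smul]
    have : p = (r + s) • p := by rw [hrs, one_smul]
    nth_rw 3 [this]
    module
  rw [← segment_eq_uIcc]
  constructor
  · rintro ⟨_, ⟨r, s, hr, hs, hrs, rfl⟩, hx⟩
    rw [hcomb r s hrs, mem_planeLine hg hz] at hx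
    refine ⟨r, s, hr, hs, hrs, ?_⟩
    rw [← hx]
    simp [br]; ring
  · rintro ⟨r, s, hr, hs, hrs, h⟩
    refine ⟨_, ⟨r, s, hr, hs, hrs, rfl⟩, ?_⟩
    rw [hcomb r s hrs, mem_planeLine hg hz, ← h]
    simp [br]; ring

theorem planeLine_neg (hg : Function.Injective g) {z : ℝ × ℝ} (hz : z ≠ 0) (τ : ℝ) :
    planeLine p g (-z) (-τ) = planeLine p g z τ := by
  have h1 := map_ne_zero_of_injective hg hz
  have : (-τ / ((-z).1 ^ 2 + (-z).2 ^ 2)) • (-(-z).2, (-z).1) =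
      (τ / (z.1 ^ 2 + z.2 ^ 2)) • ((-z.2, z.1) : ℝ × ℝ) := by
    ext <;> simp <;> ring
  rw [planeLine, planeLine, this, map_neg, ln_neg h1]

theorem exists_eq_planeLine (hg : Function.Injective g) (hg3 : ∀ v, f v = 0 → ∃ w, g w = v)
    (hp : f p = κ) {L : Line3} (hL : InPlane f κ L) : ∃ z τ, z ≠ 0 ∧ L = planeLine p g z τ := by
  obtain ⟨q, v, hv, rfl⟩ := exists_eq_ln L
  have hq := left_mem_ln (p := q) hv
  obtain ⟨z, hz, h⟩ := exists_eq_ln_of_inPlane hg3 hq hL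
  obtain ⟨u, hu⟩ := hg3 (q - p) (by rw [map_sub, hL q hq, hp, sub_self])
  have hq' : q = p + g u := by rw [hu]; abel
  refine ⟨z, br z u, hz, ?_⟩
  rw [h]
  have hgz := map_ne_zero_of_injective hg hz
  refine (eq_ln hgz ?_ ?_).symm
  · rw [hq', mem_planeLine hg hz]
  · rw [hq', add_assoc, ← map_add, mem_planeLine hg hz]
    simp [br]; ring

/-- For a fixed direction the admissible offsets form an intersection of intervals, so parallel
transversals can be translated into each other. -/
theorem joinedIn_planeLine (hg : Function.Injective g) {α β : Fin 4 → ℝ × ℝ}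
    (hα : ∀ k, cellA t e k = p + g (α k)) (hβ : ∀ k, cellB t e k = p + g (β k)) {z : ℝ × ℝ}
    (hz : z ≠ 0) {τ τ' : ℝ} (h : planeLine p g z τ ∈ cell t e) (h' : planeLine p g z τ' ∈ cell t e) :
    JoinedIn (cell t e) (planeLine p g z τ) (planeLine p g z τ') := by
  have hS : Convex ℝ {τ | planeLine p g z τ ∈ cell t e} := by
    have : {τ | planeLine p g z τ ∈ cell t e} = ⋂ k, uIcc (br z (α k)) (br z (β k)) := by
      ext τ
      rw [mem_iInter]
      exact forall_congr' fun k => meets_planeLine hg hz (hα k) (hβ k)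
    rw [this]
    exact convex_iInter fun k => convex_uIcc _ _
  have hgc := g.continuous_of_finiteDimensional
  exact joinedIn_ln_of_convex hS
    (p := fun τ => p + g ((τ / (z.1 ^ 2 + z.2 ^ 2)) • (-z.2, z.1))) (v := fun _ => g z)
    (by fun_prop) (by fun_prop) (fun _ _ => map_ne_zero_of_injective hg hz) (fun _ h => h) h h'

end PlaneLine

/-- The largest lower bound and the smallest upper bound for the offset of a line with
direction `z` meeting all segments, averaged. -/
noncomputable def midOffset (α β : Fin 4 → ℝ × ℝ) (z : ℝ × ℝ) : ℝ :=
  (Finset.univ.sup' Finset.univ_nonempty (fun k => min (br z (α k)) (br z (β k))) +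
    Finset.univ.inf' Finset.univ_nonempty (fun k => max (br z (α k)) (br z (β k)))) / 2

theorem continuous_midOffset (α β : Fin 4 → ℝ × ℝ) : Continuous (midOffset α β) := by
  unfold midOffset br
  refine Continuous.div_const (Continuous.add ?_ ?_) _
  · exact Continuous.finset_sup'_apply _ fun k _ => by fun_prop
  · exact Continuous.finset_inf'_apply _ fun k _ => by fun_prop

/-- Helly's theorem on the line: if the intervals overlap pairwise, the largest lower end is at most
the smallest upper end, and the midpoint lies in all of them. -/
theorem midOffset_mem {α β : Fin 4 → ℝ × ℝ} {z : ℝ × ℝ}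
    (h : ∀ m n, min (br z (α m)) (br z (β m)) ≤ max (br z (α n)) (br z (β n))) (k : Fin 4) :
    midOffset α β z ∈ uIcc (br z (α k)) (br z (β k)) := by
  have h1 := Finset.le_sup' (fun k => min (br z (α k)) (br z (β k))) (Finset.mem_univ k)
  have h2 := Finset.inf'_le (fun k => max (br z (α k)) (br z (β k))) (Finset.mem_univ k)
  have h3 : Finset.univ.sup' Finset.univ_nonempty (fun k => min (br z (α k)) (br z (β k))) ≤
      Finset.univ.inf' Finset.univ_nonempty (fun k => max (br z (α k)) (br z (β k))) :=
    Finset.sup'_le _ _ fun m _ => Finset.le_inf' _ _ fun n _ => h m n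
  rw [uIcc, mem_Icc, midOffset]
  change min (br z (α k)) (br z (β k)) ≤ _ ∧ _ ≤ max (br z (α k)) (br z (β k))
  constructor <;> linarith

/-- Opposite directions describe the same parallel lines with negated offset, so the chosen line
depends only on the unoriented direction. -/
theorem midOffset_neg (α β : Fin 4 → ℝ × ℝ) (z : ℝ × ℝ) :
    midOffset α β (-z) = - midOffset α β z := by
  have hbr : ∀ u, br (-z) u = - br z u := fun u => by simp [br]; ring
  have h1 : Finset.univ.sup' Finset.univ_nonempty
      (fun k => min (br (-z) (α k)) (br (-z) (β k))) = - Finset.univ.inf' Finset.univ_nonempty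
      (fun k => max (br z (α k)) (br z (β k))) := by
    apply le_antisymm
    · refine Finset.sup'_le _ _ fun k _ => ?_
      rw [hbr, hbr, min_neg_neg]
      exact neg_le_neg (Finset.inf'_le (fun k => max (br z (α k)) (br z (β k)))
        (Finset.mem_univ k))
    · rw [neg_le]
      refine Finset.le_inf' _ _ fun k _ => ?_
      rw [neg_le, ← min_neg_neg, ← hbr, ← hbr]
      exact Finset.le_sup' (fun k => min (br (-z) (α k)) (br (-z) (β k))) (Finset.mem_univ k)
  have h2 : Finset.univ.inf' Finset.univ_nonempty
      (fun k => max (br (-z) (α k)) (br (-z) (β k))) = - Finset.univ.sup' Finset.univ_nonempty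
      (fun k => min (br z (α k)) (br z (β k))) := by
    apply le_antisymm
    · rw [le_neg]
      refine Finset.sup'_le _ _ fun k _ => ?_
      rw [le_neg, ← max_neg_neg, ← hbr, ← hbr]
      exact Finset.inf'_le (fun k => max (br (-z) (α k)) (br (-z) (β k))) (Finset.mem_univ k)
    · refine Finset.le_inf' _ _ fun k _ => ?_
      rw [hbr, hbr, max_neg_neg]
      exact neg_le_neg (Finset.le_sup' (fun k => min (br z (α k)) (br z (β k)))
        (Finset.mem_univ k))
  rw [midOffset, midOffset, h1, h2]
  ring

/-- Four segments in a plane: the transversals in this plane. -/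
theorem cellBound_of_forall_inPlane_of_four (hf : f ≠ 0)
    (hpl : ∀ k, f (cellA t e k) = κ ∧ f (cellB t e k) = κ) (h : ∀ L ∈ cell t e, InPlane f κ L) :
    CellBound t e (3 / 2) := by
  classical
  obtain ⟨g, hg1, hg2, hg3⟩ := exists_plane_basis hf
  set p := cellA t e 0 with hp
  have hpκ : f p = κ := (hpl 0).1
  have hco : ∀ x, f x = κ → ∃ w, x = p + g w := by
    intro x hx
    obtain ⟨w, hw⟩ := hg3 (x - p) (by rw [map_sub, hx, hpκ, sub_self])
    exact ⟨w, by rw [hw]; abel⟩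
  choose α hα using fun k => hco _ (hpl k).1
  choose β hβ using fun k => hco _ (hpl k).2
  have hgc := g.continuous_of_finiteDimensional
  -- A continuous choice of one transversal in each admissible direction reduces the count to the
  -- set of directions.
  set Γ : ℝ × ℝ → Line3 := fun z => planeLine p g z (midOffset α β z) with hΓ
  have hΓc : ContinuousOn Γ {z | z ≠ 0} := by
    have hm := continuous_midOffset α β
    refine continuousOn_ln.comp (f := fun z : ℝ × ℝ =>
      (p + g ((midOffset α β z / (z.1 ^ 2 + z.2 ^ 2)) • (-z.2, z.1)), g z)) ?_
      (fun z hz => map_ne_zero_of_injective hg1 hz)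
    refine ContinuousOn.prodMk (continuousOn_const.add (hgc.comp_continuousOn
      (ContinuousOn.smul (hm.continuousOn.div (by fun_prop) fun z hz => (sq_add_sq_pos hz).ne')
        (by fun_prop)))) (by fun_prop)
  have hover : ∀ z, z ≠ 0 → ∀ τ, planeLine p g z τ ∈ cell t e →
      ∀ m n, min (br z (α m)) (br z (β m)) ≤ max (br z (α n)) (br z (β n)) := by
    intro z hz τ hL m n
    have h1 := (meets_planeLine hg1 hz (hα m) (hβ m)).1 (hL m)
    have h2 := (meets_planeLine hg1 hz (hα n) (hβ n)).1 (hL n)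
    exact h1.1.trans h2.2
  have hin : ∀ z, z ≠ 0 →
      (∀ m n, min (br z (α m)) (br z (β m)) ≤ max (br z (α n)) (br z (β n))) →
      Γ z ∈ cell t e := fun z hz ho k =>
    (meets_planeLine hg1 hz (hα k) (hβ k)).2 (midOffset_mem ho k)
  have hneg : ∀ z, z ≠ 0 → Γ (-z) = Γ z := fun z hz => by
    simp only [hΓ, midOffset_neg]
    exact planeLine_neg hg1 hz _
  have hjoin : ∀ L ∈ cell t e, ∃ z, z ≠ 0 ∧
      (∀ m n, min (br z (α m)) (br z (β m)) ≤ max (br z (α n)) (br z (β n))) ∧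
      JoinedIn (cell t e) L (Γ z) := by
    intro L hL
    obtain ⟨z, τ, hz, rfl⟩ := exists_eq_planeLine hg1 hg3 hpκ (h L hL)
    have ho := hover z hz τ hL
    exact ⟨z, hz, ho, joinedIn_planeLine hg1 hα hβ hz hL (hin z hz ho)⟩
  -- Only disjoint pairs restrict the direction, each of them to an arc; there are at most six.
  let D : Finset (Fin 4 × Fin 4) := Finset.univ.filter fun x =>
    x.1 < x.2 ∧ Disjoint (segment ℝ (α x.1) (β x.1)) (segment ℝ (α x.2) (β x.2))
  have hDc : D.card ≤ 6 := by
    refine (Finset.card_le_card (t := Finset.univ.filter fun x : Fin 4 × Fin 4 => x.1 < x.2)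
      ?_).trans (by decide)
    intro x hx
    simp only [D, Finset.mem_filter, Finset.mem_univ, true_and] at hx ⊢
    exact hx.1
  have hmeet : ∀ a b c d : ℝ × ℝ, ¬ Disjoint (segment ℝ a b) (segment ℝ c d) → ∀ z,
      min (br z a) (br z b) ≤ max (br z c) (br z d) ∧
        min (br z c) (br z d) ≤ max (br z a) (br z b) := by
    intro a b c d hd z
    obtain ⟨x, hx1, hx2⟩ := not_disjoint_iff.1 hd
    have key : ∀ a b : ℝ × ℝ, x ∈ segment ℝ a b → br z x ∈ uIcc (br z a) (br z b) := by
      rintro a b ⟨r, s, hr, hs, hrs, rfl⟩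
      rw [← segment_eq_uIcc]
      exact ⟨r, s, hr, hs, hrs, by simp [br]; ring⟩
    have h1 := key a b hx1
    have h2 := key c d hx2
    exact ⟨h1.1.trans h2.2, h2.1.trans h1.2⟩
  have harc : ∀ x : D, ∃ u v : ℝ × ℝ, Pointed u v ∧
      (∀ z, InArc u v z ↔ min (br z (α x.1.1)) (br z (β x.1.1)) ≤
        max (br z (α x.1.2)) (br z (β x.1.2)) ∧
        min (br z (α x.1.2)) (br z (β x.1.2)) ≤ max (br z (α x.1.1)) (br z (β x.1.1))) ∧
      ∀ z, z = u ∨ z = v → ∀ τ ∈ uIcc (br z (α x.1.1)) (br z (β x.1.1)),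
        τ ∈ uIcc (br z (α x.1.2)) (br z (β x.1.2)) →
        (br z (α x.1.1) = τ ∨ br z (β x.1.1) = τ) ∧ (br z (α x.1.2) = τ ∨ br z (β x.1.2) = τ) :=
    fun x => exists_arc_of_disjoint (Finset.mem_filter.1 x.2).2.2
  choose u v hpt hov htight using harc
  have hdom : ∀ z, z ≠ 0 →
      ((∀ m n, min (br z (α m)) (br z (β m)) ≤ max (br z (α n)) (br z (β n))) ↔
        ∀ x : D, InArc (u x) (v x) z) := by
    intro z hz
    constructor
    · intro ho x
      exact (hov x z).2 ⟨ho _ _, ho _ _⟩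
    · intro ho
      have hlt : ∀ m n, m < n → min (br z (α m)) (br z (β m)) ≤ max (br z (α n)) (br z (β n)) ∧
          min (br z (α n)) (br z (β n)) ≤ max (br z (α m)) (br z (β m)) := by
        intro m n hmn
        by_cases hd : Disjoint (segment ℝ (α m) (β m)) (segment ℝ (α n) (β n))
        · have hx : (m, n) ∈ D := Finset.mem_filter.2 ⟨Finset.mem_univ _, hmn, hd⟩
          exact (hov ⟨(m, n), hx⟩ z).1 (ho ⟨(m, n), hx⟩)
        · exact hmeet _ _ _ _ hd z
      intro m n
      rcases lt_trichotomy m n with h | rfl | h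
      · exact (hlt m n h).1
      · exact min_le_max
      · exact (hlt n m h).2
  rcases D.eq_empty_or_nonempty with hD | hD
  · have hall : ∀ z, z ≠ 0 → Γ z ∈ cell t e := by
      intro z hz
      refine hin z hz ((hdom z hz).2 fun x => ?_)
      have := x.2
      simp [hD] at this
    refine (cellBound_of_joinedIn fun L hL M hM => ?_).mono (by norm_num)
    refine JoinedIn.mono ?_ (cell_subset (e := e))
    obtain ⟨z, hz, -, hj⟩ := hjoin L hL
    obtain ⟨w, hw, -, hj'⟩ := hjoin M hM
    refine (hj.trans ?_).trans hj'.symm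
    have hpc : IsPathConnected ({0}ᶜ : Set (ℝ × ℝ)) := by
      apply isPathConnected_compl_singleton_of_one_lt_rank
      rw [← Module.finrank_eq_rank]
      simp
    exact ((hpc.joinedIn z hz w hw).map_continuousOn hΓc).mono
      (by rintro _ ⟨x, hx, rfl⟩; exact hall x hx)
  · have : Nonempty D := hD.to_subtype
    obtain ⟨R, r1, r2, r3⟩ := exists_arc_representatives (a := u) (b := v) (Γ := Γ)
      (T := cell t e) hpt (hΓc.mono fun z hz => hz.1)
      (fun z hz => hin z hz.1 ((hdom z hz.1).2 hz.2)) hneg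
    -- At the end of an arc the transversal passes through ends of two edges, so its multiplicity is
    -- at least four: 6/4 = 3/2.
    have := cellBound_of_representatives (t := t) (e := e) (R := R) (n := 6) (m := 4)
      (by norm_num) (r1.trans (by simpa using hDc))
      (by
        intro L hL
        obtain ⟨x, z, hz, hzd, rfl⟩ := r2 L hL
        have hc := hin z hzd.1 ((hdom z hzd.1).2 hzd.2)
        refine ⟨hc, four_le_mult (ne_of_lt (Finset.mem_filter.1 x.2).2.1) hc ?_ ?_⟩
        · have := (htight x z hz _ (midOffset_mem ((hdom z hzd.1).2 hzd.2) _)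
            (midOffset_mem ((hdom z hzd.1).2 hzd.2) _)).1
          refine this.imp (fun h => ?_) (fun h => ?_)
          · rw [hα]; exact (mem_planeLine hg1 hzd.1).2 h
          · rw [hβ]; exact (mem_planeLine hg1 hzd.1).2 h
        · have := (htight x z hz _ (midOffset_mem ((hdom z hzd.1).2 hzd.2) _)
            (midOffset_mem ((hdom z hzd.1).2 hzd.2) _)).2
          refine this.imp (fun h => ?_) (fun h => ?_)
          · rw [hα]; exact (mem_planeLine hg1 hzd.1).2 h
          · rw [hβ]; exact (mem_planeLine hg1 hzd.1).2 h)
      (by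
        intro L hL
        obtain ⟨z, hz, ho, hj⟩ := hjoin L hL
        obtain ⟨M, hM, hj'⟩ := r3 z ⟨hz, (hdom z hz).1 ho⟩
        exact ⟨M, hM, (hj.trans hj').mono cell_subset⟩)
    norm_num at this
    exact this

/-- A transversal outside the plane forces a point `o` common to all four edges. Planar transversals
can be translated to `o`, and the star of `o` is connected, so there is a single class. -/
theorem cellBound_of_four_in_plane (hf : f ≠ 0) {i j : Fin 4}
    (hne : edgeLine t e i ≠ edgeLine t e j)
    (hpl : ∀ k, f (cellA t e k) = κ ∧ f (cellB t e k) = κ) : CellBound t e 2 := by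
  by_cases hall : ∀ L ∈ cell t e, InPlane f κ L
  · exact (cellBound_of_forall_inPlane_of_four hf hpl hall).mono (by norm_num)
  push Not at hall
  obtain ⟨L₁, hL₁, hL₁π⟩ := hall
  obtain ⟨o, ho0, hoL⟩ := hL₁ 0
  have hseg : ∀ k, ∀ x ∈ seg t e k, f x = κ := fun k x hx =>
    map_eq_of_mem_segment (hpl k).1 (hpl k).2 hx
  have ho : ∀ k, o ∈ seg t e k := by
    intro k
    obtain ⟨y, hy, hyL⟩ := hL₁ k
    by_contra hok
    exact hL₁π (inPlane_of_two_mem (by rintro rfl; exact hok hy) hoL hyL (hseg 0 o ho0)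
      (hseg k y hy))
  have hfo := hseg 0 o ho0
  obtain ⟨g, hg1, hg2, hg3⟩ := exists_plane_basis hf
  have hco : ∀ x, f x = κ → ∃ w, x = o + g w := by
    intro x hx
    obtain ⟨w, hw⟩ := hg3 (x - o) (by rw [map_sub, hx, hfo, sub_self])
    exact ⟨w, by rw [hw]; abel⟩
  choose α hα using fun k => hco _ (hpl k).1
  choose β hβ using fun k => hco _ (hpl k).2
  have key : ∀ L ∈ cell t e, ∃ M ∈ cell t e, o ∈ M.1 ∧ JoinedIn (commonTangents t) L M := by
    intro L hL
    by_cases hoL : o ∈ L.1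
    · exact ⟨L, hL, hoL, JoinedIn.refl (cell_subset hL)⟩
    have hLπ : InPlane f κ L := by
      obtain ⟨x, hx, hxL⟩ := hL 0
      by_contra hLπ
      have : ∀ k, x ∈ seg t e k := by
        intro k
        obtain ⟨y, hy, hyL⟩ := hL k
        by_contra hxk
        exact hLπ (inPlane_of_two_mem (by rintro rfl; exact hxk hy) hxL hyL (hseg 0 x hx)
          (hseg k y hy))
      exact hoL (by rwa [eq_of_mem_of_edgeLine_ne hne (ho i) (ho j) (this i) (this j)])
    obtain ⟨z, τ, hz, rfl⟩ := exists_eq_planeLine hg1 hg3 hfo hLπ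
    have ho0 : o ∈ (planeLine o g z 0).1 := by
      have := (mem_planeLine (p := o) hg1 hz (τ := 0) (u := 0)).2 (by simp [br])
      simpa using this
    have hM : planeLine o g z 0 ∈ cell t e := fun k => ⟨o, ho k, ho0⟩
    exact ⟨_, hM, ho0, (joinedIn_planeLine hg1 hα hβ hz hL hM).mono cell_subset⟩
  refine (cellBound_of_joinedIn fun L hL M hM => ?_).mono one_le_two
  obtain ⟨L', h1, h2, h3⟩ := key L hL
  obtain ⟨M', k1, k2, k3⟩ := key M hM
  exact (h3.trans (joinedIn_of_mem_of_mem (l := 0) (fun k _ => ho k) h1 k1 h2 k2)).trans k3.symm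

end TriTangent

/-! ### The bound two for every cell, and savings from coplanar edges -/

namespace TriTangent

open Set

variable {t : Fin 4 → Affine.Triangle ℝ E3} {e : Fin 4 → Fin 3} {f : E3 →ₗ[ℝ] ℝ} {κ : ℝ}

/-- The chosen edges of the triangles `k` and `l` lie in a common plane. -/
def CopAt (t : Fin 4 → Affine.Triangle ℝ E3) (e : Fin 4 → Fin 3) (k l : Fin 4) : Prop :=
  Cop (cellA t e k) (cellB t e k) (cellA t e l) (cellB t e l)

theorem exists_complementary_pair {i j : Fin 4} (hij : i ≠ j) : ∃ k l : Fin 4, k ≠ l ∧ k ≠ i ∧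
    k ≠ j ∧ l ≠ i ∧ l ≠ j ∧ ∀ m, m = i ∨ m = j ∨ m = k ∨ m = l := by
  revert i j
  decide

/-- Either coplanar edges are always collinear, or two coplanar edges span a plane; then the other
two edges may or may not lie in this plane. -/
theorem cellBound_two (t : Fin 4 → Affine.Triangle ℝ E3) (e : Fin 4 → Fin 3) :
    CellBound t e 2 := by
  by_cases h : ∀ k l, Cop (cellA t e k) (cellB t e k) (cellA t e l) (cellB t e l) →
      cellA t e k ∈ (edgeLine t e l).1 ∧ cellB t e k ∈ (edgeLine t e l).1
  · exact cellBound_of_skew_or_collinear h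
  push Not at h
  obtain ⟨i, j, ⟨f, hf, κ, h1, h2, h3, h4⟩, hij⟩ := h
  have hne : edgeLine t e i ≠ edgeLine t e j := by
    intro heq
    rw [← heq] at hij
    exact hij (cellA_mem_edgeLine i) (cellB_mem_edgeLine i)
  have hne' : i ≠ j := by rintro rfl; exact hne rfl
  obtain ⟨k, l, hkl, hki, hkj, hli, hlj, hex⟩ := exists_complementary_pair hne'
  by_cases hk : f (cellA t e k) = κ ∧ f (cellB t e k) = κ
  · by_cases hl : f (cellA t e l) = κ ∧ f (cellB t e l) = κ
    · refine cellBound_of_four_in_plane (κ := κ) hf hne fun m => ?_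
      rcases hex m with rfl | rfl | rfl | rfl
      exacts [⟨h1, h2⟩, ⟨h3, h4⟩, hk, hl]
    · refine cellBound_of_three_in_plane hf hli.symm hlj.symm hne (fun m hm => ?_) hl
      rcases hex m with rfl | rfl | rfl | rfl
      exacts [⟨h1, h2⟩, ⟨h3, h4⟩, hk, absurd rfl hm]
  · by_cases hl : f (cellA t e l) = κ ∧ f (cellB t e l) = κ
    · refine cellBound_of_three_in_plane hf hki.symm hkj.symm hne (fun m hm => ?_) hk
      rcases hex m with rfl | rfl | rfl | rfl
      exacts [⟨h1, h2⟩, ⟨h3, h4⟩, absurd rfl hm, hl]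
    · exact cellBound_of_two_in_plane hf hne' hkl hex hne ⟨h1, h2⟩ ⟨h3, h4⟩ hk hl

/-- Disjoint segments on one line are met in two different points of that line. -/
theorem forall_eq_edgeLine {i j : Fin 4} (hd : Disjoint (seg t e i) (seg t e j))
    (heq : edgeLine t e i = edgeLine t e j) {L : Line3} (hL : L ∈ cell t e) :
    L = edgeLine t e i := by
  obtain ⟨x, hx, hxL⟩ := hL i
  obtain ⟨y, hy, hyL⟩ := hL j
  refine eq_of_two_mem ?_ hxL hyL (seg_subset_edgeLine hx) (heq ▸ seg_subset_edgeLine hy)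
  rintro rfl
  exact disjoint_left.1 hd hx hy

theorem cellBound_one_of_edgeLine_eq {i j : Fin 4} (hd : Disjoint (seg t e i) (seg t e j))
    (heq : edgeLine t e i = edgeLine t e j) : CellBound t e 1 :=
  cellBound_of_joinedIn fun L hL M hM => by
    rw [forall_eq_edgeLine hd heq hL, ← forall_eq_edgeLine hd heq hM]
    exact JoinedIn.refl (cell_subset hM)

/-- A coplanar pair of disjoint edges. -/
theorem cellBound_of_copAt {i j : Fin 4} (hij : i ≠ j) (hd : Disjoint (seg t e i) (seg t e j))
    (h : CopAt t e i j) : CellBound t e (3 / 2) := by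
  by_cases hne : edgeLine t e i = edgeLine t e j
  · exact (cellBound_one_of_edgeLine_eq hd hne).mono (by norm_num)
  obtain ⟨f, hf, κ, h1, h2, h3, h4⟩ := h
  -- Disjointness excludes a common point of the two edges, so every transversal is planar.
  have hpl : ∀ L ∈ cell t e, InPlane f κ L := by
    intro L hL
    refine (inPlane_or_mem h1 h2 h3 h4 hL).resolve_right ?_
    rintro ⟨o, -, ho1, ho2⟩
    exact disjoint_left.1 hd ho1 ho2
  obtain ⟨k, l, hkl, hki, hkj, hli, hlj, hex⟩ := exists_complementary_pair hij
  by_cases hk : f (cellA t e k) = κ ∧ f (cellB t e k) = κ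
  · by_cases hl : f (cellA t e l) = κ ∧ f (cellB t e l) = κ
    · refine cellBound_of_forall_inPlane_of_four (κ := κ) hf (fun m => ?_) hpl
      rcases hex m with rfl | rfl | rfl | rfl
      exacts [⟨h1, h2⟩, ⟨h3, h4⟩, hk, hl]
    · refine cellBound_of_forall_inPlane_of_three hf (fun m hm => ?_) hl hpl
      rcases hex m with rfl | rfl | rfl | rfl
      exacts [⟨h1, h2⟩, ⟨h3, h4⟩, hk, absurd rfl hm]
  · by_cases hl : f (cellA t e l) = κ ∧ f (cellB t e l) = κ
    · refine cellBound_of_forall_inPlane_of_three hf (fun m hm => ?_) hk hpl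
      rcases hex m with rfl | rfl | rfl | rfl
      exacts [⟨h1, h2⟩, ⟨h3, h4⟩, absurd rfl hm, hl]
    · exact (cellBound_of_forall_inPlane_of_two hf hij hex ⟨h1, h2⟩ ⟨h3, h4⟩ hk hl hpl).mono
        (by norm_num)

/-- A coplanar pair of disjoint edges, the only one in its cell. -/
theorem cellBound_of_unique_copAt {i j : Fin 4} (hij : i ≠ j)
    (hd : Disjoint (seg t e i) (seg t e j)) (h : CopAt t e i j)
    (hu : ∀ k l, k ≠ l → CopAt t e k l → ({k, l} : Finset (Fin 4)) = {i, j}) :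
    CellBound t e 1 := by
  by_cases hne : edgeLine t e i = edgeLine t e j
  · exact cellBound_one_of_edgeLine_eq hd hne
  obtain ⟨f, hf, κ, h1, h2, h3, h4⟩ := h
  have hpl : ∀ L ∈ cell t e, InPlane f κ L := by
    intro L hL
    refine (inPlane_or_mem h1 h2 h3 h4 hL).resolve_right ?_
    rintro ⟨o, -, ho1, ho2⟩
    exact disjoint_left.1 hd ho1 ho2
  obtain ⟨k, l, hkl, hki, hkj, hli, hlj, hex⟩ := exists_complementary_pair hij
  have key : ∀ m, m ≠ i → m ≠ j → ¬ (f (cellA t e m) = κ ∧ f (cellB t e m) = κ) := by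
    intro m hmi hmj hm
    have := hu i m hmi.symm ⟨f, hf, κ, h1, h2, hm.1, hm.2⟩
    have hm' : m ∈ ({i, j} : Finset (Fin 4)) := by rw [← this]; simp
    simp [hmi, hmj] at hm'
  exact cellBound_of_forall_inPlane_of_two hf hij hex ⟨h1, h2⟩ ⟨h3, h4⟩ (key k hki hkj)
    (key l hli hlj) hpl

/-! ### Counting -/

/-- The cells that agree with a given one at prescribed triangles. -/
def box (e : Fin 4 → Fin 3) (T : Finset (Fin 4)) : Finset (Fin 4 → Fin 3) :=
  Fintype.piFinset fun k => if k ∈ T then {e k} else Finset.univ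

theorem mem_box {e e' : Fin 4 → Fin 3} {T : Finset (Fin 4)} : e' ∈ box e T ↔
    ∀ k ∈ T, e' k = e k := by
  rw [box, Fintype.mem_piFinset]
  refine forall_congr' fun k => ?_
  split_ifs with h <;> simp [h]

theorem card_box (e : Fin 4 → Fin 3) (T : Finset (Fin 4)) : (box e T).card = 3 ^ (4 - T.card) := by
  rw [box, Fintype.card_piFinset]
  have : ∀ k, (if k ∈ T then ({e k} : Finset (Fin 3)) else Finset.univ).card =
      if k ∈ Tᶜ then 3 else 1 := by
    intro k
    by_cases h : k ∈ T <;> simp [h]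
  simp only [this]
  rw [Finset.prod_ite_mem, Finset.univ_inter, Finset.prod_const, Finset.card_compl,
    Fintype.card_fin]

theorem box_inter (e : Fin 4 → Fin 3) (T U : Finset (Fin 4)) : box e T ∩ box e U = box e (T ∪ U) := by
  ext e'
  simp only [Finset.mem_inter, mem_box, Finset.mem_union]
  constructor
  · rintro ⟨h1, h2⟩ k (hk | hk)
    exacts [h1 k hk, h2 k hk]
  · intro h
    exact ⟨fun k hk => h k (Or.inl hk), fun k hk => h k (Or.inr hk)⟩

/-- The 81 cells pay at most 162, and each cell of `S` saves `δ`. -/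
theorem numTangentComponents_le_of_loss {S : Finset (Fin 4 → Fin 3)} {δ : ℚ} {n : ℕ}
    (h : ∀ e ∈ S, CellBound t e (2 - δ)) (hn : 162 - δ * S.card < n + 1) :
    numTangentComponents t ≤ n := by
  classical
  refine numTangentComponents_le (β := fun e => 2 - if e ∈ S then δ else 0) (fun e => ?_) ?_
  · by_cases he : e ∈ S
    · simpa [he] using h e he
    · simpa [he] using cellBound_two t e
  · refine lt_of_eq_of_lt ?_ hn
    rw [Finset.sum_sub_distrib, Finset.sum_ite_mem, Finset.univ_inter, Finset.sum_const,
      Finset.sum_const, Finset.card_univ]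
    simp
    ring

theorem copAt_congr {e e' : Fin 4 → Fin 3} {i j : Fin 4} (hi : e' i = e i) (hj : e' j = e j)
    (h : CopAt t e i j) : CopAt t e' i j := by
  unfold CopAt cellA cellB at *
  rwa [hi, hj]

theorem seg_subset_triangleSet (k : Fin 4) : seg t e k ⊆ triangleSet (t k) := by
  unfold triangleSet
  exact segment_subset_convexHull (mem_range_self (e k + 1)) (mem_range_self (e k + 2))

theorem disjoint_seg (h : ∀ i j : Fin 4, i ≠ j → Disjoint (triangleSet (t i)) (triangleSet (t j)))
    (e : Fin 4 → Fin 3) {i j : Fin 4} (hij : i ≠ j) : Disjoint (seg t e i) (seg t e j) :=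
  (h i j hij).mono (seg_subset_triangleSet i) (seg_subset_triangleSet j)

/-- A coplanar pair of edges persists in the nine cells that keep these two edges. If it is always
the only pair, each of these cells saves 1, in total 9. Otherwise some cell has a second pair, and
both boxes of nine cells save one half per cell. -/
theorem numTangentComponents_le_of_copAt
    (h : ∀ i j : Fin 4, i ≠ j → Disjoint (triangleSet (t i)) (triangleSet (t j)))
    {i j : Fin 4} (hij : i ≠ j) (hc : CopAt t e i j) : numTangentComponents t ≤ 156 := by
  by_cases hu : ∀ e' ∈ box e {i, j}, ∀ k l, k ≠ l → CopAt t e' k l →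
      ({k, l} : Finset (Fin 4)) = {i, j}
  · refine numTangentComponents_le_of_loss (S := box e {i, j}) (δ := 1) (fun e' he' => ?_) ?_
    · have hm := mem_box.1 he'
      refine (cellBound_of_unique_copAt hij (disjoint_seg h e' hij)
        (copAt_congr (hm i (by simp)) (hm j (by simp)) hc) (hu e' he')).mono (by norm_num)
    · rw [card_box, Finset.card_pair hij]
      norm_num
  · push Not at hu
    obtain ⟨e', he', k, l, hkl, hc', hne⟩ := hu
    have hm := mem_box.1 he'
    have hc1 := copAt_congr (hm i (by simp)) (hm j (by simp)) hc
    have hbox : ∀ i j : Fin 4, i ≠ j → CopAt t e' i j → ∀ e'' ∈ box e' {i, j},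
        CellBound t e'' (2 - 1 / 2) := by
      intro i j hij hc e'' he''
      have hm := mem_box.1 he''
      exact (cellBound_of_copAt hij (disjoint_seg h e'' hij)
        (copAt_congr (hm i (by simp)) (hm j (by simp)) hc)).mono (by norm_num)
    refine numTangentComponents_le_of_loss (S := box e' {i, j} ∪ box e' {k, l}) (δ := 1 / 2)
      (fun e'' he'' => ?_) ?_
    · rcases Finset.mem_union.1 he'' with h' | h'
      · exact hbox i j hij hc1 e'' h'
      · exact hbox k l hkl hc' e'' h'
    · have h1 := Finset.card_union_add_card_inter (box e' {i, j}) (box e' {k, l})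
      rw [box_inter, card_box, card_box, card_box, Finset.card_pair hij, Finset.card_pair hkl] at h1
      -- Different pairs involve at least three triangles, so the boxes share at most three cells.
      -- Their union has at least 15 cells, and 162 - 15/2 < 157.
      have h2 : 3 ≤ (({i, j} : Finset (Fin 4)) ∪ {k, l}).card := by
        by_contra hlt
        push Not at hlt
        have e1 := Finset.eq_of_subset_of_card_le
          (Finset.subset_union_left (s₁ := ({i, j} : Finset (Fin 4))) (s₂ := {k, l}))
          (by rw [Finset.card_pair hij]; omega)
        have e2 := Finset.eq_of_subset_of_card_le
          (Finset.subset_union_right (s₁ := ({i, j} : Finset (Fin 4))) (s₂ := {k, l}))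
          (by rw [Finset.card_pair hkl]; omega)
        exact hne (e2.trans e1.symm)
      have h3 : 3 ^ (4 - (({i, j} : Finset (Fin 4)) ∪ {k, l}).card) ≤ 3 ^ 1 :=
        Nat.pow_le_pow_right (by norm_num) (by omega)
      have h4 : 15 ≤ (box e' {i, j} ∪ box e' {k, l}).card := by omega
      have h5 : (15 : ℚ) ≤ ((box e' {i, j} ∪ box e' {k, l}).card : ℚ) := by exact_mod_cast h4
      push_cast
      linarith

end TriTangent

/-! ### An edge line that misses two triangles -/

namespace TriTangent

open Set

variable {t : Fin 4 → Affine.Triangle ℝ E3} {e : Fin 4 → Fin 3}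

/-- The line of the edge `m` of the triangle `i` meets the triangle `j`. -/
def Hit (t : Fin 4 → Affine.Triangle ℝ E3) (i : Fin 4) (m : Fin 3) (j : Fin 4) : Prop :=
  ∃ x ∈ triangleSet (t j), ∃ s : ℝ,
    x = (1 - s) • (t i).points (m + 1) + s • (t i).points (m + 2)

theorem exists_plane_of_triangle (T : Affine.Triangle ℝ E3) : ∃ (f : E3 →ₗ[ℝ] ℝ) (κ : ℝ), f ≠ 0 ∧
    (∀ m, f (T.points m) = κ) ∧ ∀ x ∈ triangleSet T, f x = κ := by
  obtain ⟨f, hf, h1, h2⟩ := exists_plane_of_three (T.points 0) (T.points 1) (T.points 2)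
  have hpts : ∀ m, f (T.points m) = f (T.points 0) := by
    intro m
    fin_cases m
    exacts [rfl, h1, h2]
  refine ⟨f, f (T.points 0), hf, hpts, fun x hx => ?_⟩
  have hconv : Convex ℝ {x | f x = f (T.points 0)} := convex_hyperplane f.isLinear _
  exact convexHull_min (by rintro _ ⟨m, rfl⟩; exact hpts m) hconv hx

/-- The line of the edge meets the plane of the triangle `j` in a point of this triangle. By
disjointness this point is outside the edge, so both ends of the edge lie strictly on one side of
the plane. -/
theorem same_side_of_hit (hd : ∀ i j : Fin 4, i ≠ j →
    Disjoint (triangleSet (t i)) (triangleSet (t j)))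
    (hc : ∀ (e : Fin 4 → Fin 3) (i j : Fin 4), i ≠ j → ¬ CopAt t e i j) {i j : Fin 4} (hij : i ≠ j)
    {f : E3 →ₗ[ℝ] ℝ} {κ : ℝ} (hf : f ≠ 0) (hpts : ∀ m, f ((t j).points m) = κ)
    (hT : ∀ x ∈ triangleSet (t j), f x = κ) {m : Fin 3} (h : Hit t i m j) :
    0 < (f ((t i).points (m + 1)) - κ) * (f ((t i).points (m + 2)) - κ) := by
  obtain ⟨x, hx, s, hs⟩ := h
  set A := (t i).points (m + 1) with hA
  set B := (t i).points (m + 2) with hB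
  have hfx : (1 - s) * (f A - κ) + s * (f B - κ) = 0 := by
    have := hT x hx
    rw [hs, map_add, map_smul, map_smul, smul_eq_mul, smul_eq_mul] at this
    linear_combination this
  have hout : s < 0 ∨ 1 < s := by
    by_contra hn
    push Not at hn
    have hxi : x ∈ triangleSet (t i) := by
      unfold triangleSet
      refine segment_subset_convexHull (mem_range_self (m + 1)) (mem_range_self (m + 2)) ?_
      exact ⟨1 - s, s, by linarith, hn.1, by ring, hs.symm⟩
    exact disjoint_left.1 (hd i j hij) hxi hx
  have hnz : ¬ (f A = κ ∧ f B = κ) := by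
    rintro ⟨h1, h2⟩
    apply hc (fun _ => m) i j hij
    exact ⟨f, hf, κ, h1, h2, hpts _, hpts _⟩
  set a := f A - κ with ha
  set b := f B - κ with hb
  have hab : a ≠ 0 ∨ b ≠ 0 := by
    by_contra hn
    push Not at hn
    exact hnz ⟨by linarith [hn.1], by linarith [hn.2]⟩
  -- Both identities follow from `(1 - s) * a + s * b = 0`. Since `s * (s - 1)` is positive outside
  -- the edge, `a * b` is positive as soon as one factor is nonzero.
  have e1 : s * (s - 1) * (a * b) = (s - 1) ^ 2 * a ^ 2 := by linear_combination (s - 1) * a * hfx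
  have e2 : s * (s - 1) * (a * b) = s ^ 2 * b ^ 2 := by linear_combination -(s * b) * hfx
  have hpos : 0 < s * (s - 1) := by
    rcases hout with h | h
    · exact mul_pos_of_neg_of_neg h (by linarith)
    · exact mul_pos (by linarith) (by linarith)
  have hs0 : s ≠ 0 := by rintro rfl; simp at hpos
  have hs1 : s - 1 ≠ 0 := by intro h; simp [h] at hpos
  refine (mul_pos_iff_of_pos_left hpos).1 ?_
  rcases hab with h | h
  · rw [e1]; positivity
  · rw [e2]; positivity

/-- Two edges of a triangle cover its vertices and share one, so the whole triangle `i` lies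
strictly on one side of the plane of `j`, while the edge lines of `j` lie in that plane. -/
theorem not_hit_of_two_hits (hd : ∀ i j : Fin 4, i ≠ j →
    Disjoint (triangleSet (t i)) (triangleSet (t j)))
    (hc : ∀ (e : Fin 4 → Fin 3) (i j : Fin 4), i ≠ j → ¬ CopAt t e i j) {i j : Fin 4} (hij : i ≠ j)
    {m n : Fin 3} (hmn : m ≠ n) (hm : Hit t i m j) (hn : Hit t i n j) (r : Fin 3) :
    ¬ Hit t j r i := by
  obtain ⟨f, κ, hf, hpts, hT⟩ := exists_plane_of_triangle (t j)
  have h1 := same_side_of_hit hd hc hij hf hpts hT hm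
  have h2 := same_side_of_hit hd hc hij hf hpts hT hn
  have hall : ∀ u v : Fin 3, 0 < (f ((t i).points u) - κ) * (f ((t i).points v) - κ) := by
    have key : ∀ g : Fin 3 → ℝ, 0 < g (m + 1) * g (m + 2) → 0 < g (n + 1) * g (n + 2) →
        (∀ u, 0 < g u) ∨ ∀ u, g u < 0 := by
      intro g h1 h2
      have hu : ∀ u : Fin 3, u = 0 ∨ u = 1 ∨ u = 2 := by decide
      rcases pos_and_pos_or_neg_and_neg_of_mul_pos h1 with ⟨a1, a2⟩ | ⟨a1, a2⟩ <;>
      rcases pos_and_pos_or_neg_and_neg_of_mul_pos h2 with ⟨b1, b2⟩ | ⟨b1, b2⟩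
      · left
        have hcov : ∀ m n u : Fin 3, m ≠ n → u = m + 1 ∨ u = m + 2 ∨ u = n + 1 ∨ u = n + 2 := by
          decide
        intro u
        rcases hcov m n u hmn with rfl | rfl | rfl | rfl <;> assumption
      · exfalso
        have hcov : ∀ m n : Fin 3, m ≠ n → m + 1 = n + 2 ∨ m + 2 = n + 1 := by decide
        rcases hcov m n hmn with h | h
        · rw [h] at a1; linarith
        · rw [h] at a2; linarith
      · exfalso
        have hcov : ∀ m n : Fin 3, m ≠ n → m + 1 = n + 2 ∨ m + 2 = n + 1 := by decide
        rcases hcov m n hmn with h | h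
        · rw [h] at a1; linarith
        · rw [h] at a2; linarith
      · right
        have hcov : ∀ m n u : Fin 3, m ≠ n → u = m + 1 ∨ u = m + 2 ∨ u = n + 1 ∨ u = n + 2 := by
          decide
        intro u
        rcases hcov m n u hmn with rfl | rfl | rfl | rfl <;> assumption
    intro u v
    rcases key (fun u => f ((t i).points u) - κ) h1 h2 with h | h
    · exact mul_pos (h u) (h v)
    · exact mul_pos_of_neg_of_neg (h u) (h v)
  have hne : ∀ x ∈ triangleSet (t i), f x ≠ κ := by
    set c := f ((t i).points 0) - κ with hc'
    have hconv : Convex ℝ {x | 0 < (c • f) x - c * κ} := by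
      have : {x | 0 < (c • f) x - c * κ} = {x | c * κ < (c • f) x} := by
        ext x; simp [sub_pos]
      rw [this]
      exact convex_halfSpace_gt (c • f).isLinear _
    intro x hx hxκ
    have := convexHull_min (s := range (t i).points) (t := {x | 0 < (c • f) x - c * κ}) (by
      rintro _ ⟨u, rfl⟩
      have := hall 0 u
      simp only [mem_ofPred_eq, LinearMap.smul_apply, smul_eq_mul]
      rw [← mul_sub]
      exact this) hconv hx
    simp only [mem_ofPred_eq, LinearMap.smul_apply, smul_eq_mul] at this
    rw [hxκ] at this
    linarith
  rintro ⟨x, hx, s, hs⟩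
  apply hne x hx
  rw [hs, map_add, map_smul, map_smul, hpts, hpts, smul_eq_mul, smul_eq_mul]
  ring

/-- Some edge line misses two of the three other triangles. -/
theorem exists_edge_missing_two (hd : ∀ i j : Fin 4, i ≠ j →
    Disjoint (triangleSet (t i)) (triangleSet (t j)))
    (hc : ∀ (e : Fin 4 → Fin 3) (i j : Fin 4), i ≠ j → ¬ CopAt t e i j) :
    ∃ (i : Fin 4) (m : Fin 3) (j k : Fin 4), i ≠ j ∧ i ≠ k ∧ j ≠ k ∧ ¬ Hit t i m j ∧
      ¬ Hit t i m k := by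
  classical
  by_contra hno
  push Not at hno
  let H : Fin 4 → Fin 4 → ℕ := fun i j => (Finset.univ.filter fun m => Hit t i m j).card
  have hle : ∀ i j, H i j ≤ 3 := fun i j => (Finset.card_filter_le _ _).trans (by simp)
  have hzero : ∀ i j, i ≠ j → 2 ≤ H i j → H j i = 0 := by
    intro i j hij h2
    obtain ⟨m, hm, n, hn, hmn⟩ := Finset.one_lt_card.1 h2
    simp only [Finset.mem_filter, Finset.mem_univ, true_and] at hm hn
    rw [Finset.card_eq_zero, Finset.filter_eq_empty_iff]
    intro r _
    exact not_hit_of_two_hits hd hc hij hmn hm hn r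
  have hpair : ∀ i j, i ≠ j → H i j + H j i ≤ 3 := by
    intro i j hij
    have h1 := hle i j
    have h2 := hle j i
    have h3 := hzero i j hij
    have h4 := hzero j i hij.symm
    omega
  have hsum : ∀ i j k l, i ≠ j → i ≠ k → i ≠ l → j ≠ k → j ≠ l → k ≠ l →
      6 ≤ H i j + H i k + H i l := by
    intro i j k l hij hik hil hjk hjl hkl
    have e : H i j + H i k + H i l = ∑ m : Fin 3, ((if Hit t i m j then 1 else 0) +
        (if Hit t i m k then 1 else 0) + (if Hit t i m l then 1 else 0)) := by
      rw [Finset.sum_add_distrib, Finset.sum_add_distrib]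
      simp only [H, Finset.card_filter]
    rw [e]
    have : ∀ m : Fin 3, 2 ≤ (if Hit t i m j then 1 else 0) +
        (if Hit t i m k then 1 else 0) + (if Hit t i m l then 1 else 0) := by
      intro m
      have h1 := hno i m j k hij hik hjk
      have h2 := hno i m j l hij hil hjl
      have h3 := hno i m k l hik hil hkl
      by_cases c1 : Hit t i m j <;> by_cases c2 : Hit t i m k <;> by_cases c3 : Hit t i m l <;>
        simp [c1, c2, c3] at h1 h2 h3 ⊢
    calc 6 = ∑ m : Fin 3, 2 := by simp
      _ ≤ _ := Finset.sum_le_sum fun m _ => this m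
  -- If every edge line met two of the other triangles, the four triangles would produce at least 24
  -- hits, but each of the six pairs allows only three.
  have s0 := hsum 0 1 2 3 (by decide) (by decide) (by decide) (by decide) (by decide) (by decide)
  have s1 := hsum 1 0 2 3 (by decide) (by decide) (by decide) (by decide) (by decide) (by decide)
  have s2 := hsum 2 0 1 3 (by decide) (by decide) (by decide) (by decide) (by decide) (by decide)
  have s3 := hsum 3 0 1 2 (by decide) (by decide) (by decide) (by decide) (by decide) (by decide)
  have p1 := hpair 0 1 (by decide)
  have p2 := hpair 0 2 (by decide)
  have p3 := hpair 0 3 (by decide)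
  have p4 := hpair 1 2 (by decide)
  have p5 := hpair 1 3 (by decide)
  have p6 := hpair 2 3 (by decide)
  omega

end TriTangent

/-! ### Interlacing roots and their order along two arcs -/

namespace TriTangent

open Set

/-- The order in which points of two intersecting arcs of a projective line occur on the second
arc, in terms of their order on the first one. -/
def TwistLE (P : ℝ → Prop) (x y : ℝ) : Prop :=
  ((P x ↔ P y) ∧ x ≤ y) ∨ (¬ (P x ↔ P y) ∧ y ≤ x)

theorem iff_of_not_iff {a b c : Prop} (h : ¬ (a ↔ b)) (h' : ¬ (c ↔ b)) : a ↔ c := by tauto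

/-- The letters record the edges of the two triangles: `L` and `R` for the two short arcs and `F`
for the full one. `P` is the sign relating the two arcs. Interlacing produces roots in `FF` below
`b` of both signs, and in addition a root that is at least `b`; these are three different roots. -/
theorem twisted_order_aux {P : ℝ → Prop} {D : Set ℝ}
    (hD : ∀ x ∈ D, ∀ y ∈ D, ∀ z ∈ D, x ≤ y → y ≤ z → (P x ↔ P z) → (P y ↔ P x)) {b : ℝ}
    {LL FL FR FF : Set ℝ} (hLL : LL ⊆ D) (hFL : FL ⊆ D) (hFR : FR ⊆ D) (hFF : FF ⊆ D)
    {p q r s : ℝ} (hp : p ∈ LL) (hq : q ∈ D) (hr : r ∈ D) (hs : s ∈ D) (hpb : p ≤ b)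
    (hqb : q ≤ b) (hrb : b ≤ r) (hps : P p ↔ P s) (hpr : P p ↔ P r)
    (hpq : ¬ (P p ↔ P q)) (hcross : ∀ u ∈ FL, TwistLE P u s)
    (c1 : ∃ f ∈ FL, ∀ x ∈ LL, f ≤ x) (c2 : ∃ f ∈ FR, f ≤ q) (c3 : ∃ g ∈ FF, b ≤ g)
    (r1 : ∃ g ∈ FF, ∀ x ∈ FL, TwistLE P g x) (r2 : ∃ g ∈ FF, ∀ x ∈ FR, TwistLE P x g)
    (htwo : ∀ x ∈ FF, ∀ y ∈ FF, ∀ z ∈ FF, x = y ∨ x = z ∨ y = z)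
    (hlt : ∃ x ∈ LL, x < b) : False := by
  -- A sign class is convex in `D`, and `q < r` have opposite signs. Hence the whole class of `q`
  -- lies to the left of the class of `p` and `r`.
  have left : ∀ u ∈ D, ∀ v ∈ D, ¬ (P u ↔ P p) → (P v ↔ P p) → u < v := by
    intro u hu v hv hup hvp
    have hqr : q < r := by
      refine lt_of_le_of_ne (hqb.trans hrb) ?_
      rintro rfl
      exact hpq hpr
    by_contra hn
    push Not at hn
    rcases le_or_gt q v with h | h
    · have := hD q hq v hv u hu h hn (iff_of_not_iff (fun h' => hpq h'.symm) hup)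
      exact hpq (hvp.symm.trans this)
    · have := hD v hv q hq r hr h.le hqr.le (hvp.trans hpr)
      exact hpq (this.trans hvp).symm
  obtain ⟨f, hf, hf'⟩ := c1
  obtain ⟨f₂, hf₂, hf₂'⟩ := c2
  obtain ⟨g₃, hg₃, hg₃'⟩ := c3
  obtain ⟨g, hg, hg'⟩ := r1
  obtain ⟨g₂, hg₂, hg₂'⟩ := r2
  obtain ⟨x, hx, hxb⟩ := hlt
  -- With the opposite sign, `f` would lie left of `s` in the first order, while the twisted order
  -- demands the converse.
  have hfp : P f ↔ P p := by
    by_contra h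
    have h1 := left f (hFL hf) s hs h hps.symm
    rcases hcross f hf with ⟨h2, -⟩ | ⟨-, h2⟩
    · exact h (h2.trans hps.symm)
    · linarith
  have hf₂p : ¬ (P f₂ ↔ P p) := by
    intro h
    have := left q hq f₂ (hFR hf₂) (fun h' => hpq h'.symm) h
    linarith
  have hgp : (P g ↔ P p) ∧ g ≤ f := by
    rcases hg' f hf with ⟨h1, h2⟩ | ⟨h1, h2⟩
    · exact ⟨h1.trans hfp, h2⟩
    · have := left g (hFF hg) f (hFL hf) (fun h' => h1 (h'.trans hfp.symm)) hfp
      linarith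
  have hg₂p : ¬ (P g₂ ↔ P p) := by
    intro h
    have h1 := left f₂ (hFR hf₂) g₂ (hFF hg₂) hf₂p h
    rcases hg₂' f₂ hf₂ with ⟨h2, -⟩ | ⟨-, h2⟩
    · exact hf₂p (h2.trans h)
    · linarith
  have hg₂b : g₂ < b := (left g₂ (hFF hg₂) p (hLL hp) hg₂p Iff.rfl).trans_le hpb
  have hgb : g < b := (hgp.2.trans (hf' x hx)).trans_lt hxb
  rcases htwo g hg g₂ hg₂ g₃ hg₃ with h | h | h
  · rw [h] at hgp
    exact hg₂p hgp.1
  · rw [← h] at hg₃'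
    linarith
  · rw [← h] at hg₃'
    linarith

/-- The roots of nine quadratic forms cannot be ordered consistently along both arcs. -/
theorem twisted_order_contradiction {P : ℝ → Prop} {D : Set ℝ}
    (hD : ∀ x ∈ D, ∀ y ∈ D, ∀ z ∈ D, x ≤ y → y ≤ z → (P x ↔ P z) → (P y ↔ P x)) {b : ℝ}
    {LL LR RL RR FL FR FF : Set ℝ} (dLL : LL ⊆ D) (dLR : LR ⊆ D) (dRL : RL ⊆ D) (dRR : RR ⊆ D)
    (dFL : FL ⊆ D) (dFR : FR ⊆ D) (dFF : FF ⊆ D) (bLL : ∀ x ∈ LL, x ≤ b) (bLR : ∀ x ∈ LR, x ≤ b)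
    (bRL : ∀ x ∈ RL, b ≤ x) (bRR : ∀ x ∈ RR, b ≤ x)
    (xFLRR : ∀ u ∈ FL, ∀ v ∈ RR, TwistLE P u v) (xLLFR : ∀ u ∈ LL, ∀ v ∈ FR, TwistLE P u v)
    (xRLLR : ∀ u ∈ RL, ∀ v ∈ LR, TwistLE P u v) (xLLRR : ∀ u ∈ LL, ∀ v ∈ RR, TwistLE P u v)
    (cFL : ∃ f ∈ FL, ∀ x ∈ LL, f ≤ x) (cFL' : ∃ f ∈ FL, ∀ x ∈ RL, x ≤ f)
    (cFR : ∃ f ∈ FR, ∀ x ∈ LR, f ≤ x) (cFR' : ∃ f ∈ FR, ∀ x ∈ RR, x ≤ f)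
    (cFF : ∃ g ∈ FF, g ≤ b) (cFF' : ∃ g ∈ FF, b ≤ g)
    (r1 : ∃ g ∈ FF, ∀ x ∈ FL, TwistLE P g x) (r2 : ∃ g ∈ FF, ∀ x ∈ FR, TwistLE P x g)
    (htwo : ∀ x ∈ FF, ∀ y ∈ FF, ∀ z ∈ FF, x = y ∨ x = z ∨ y = z)
    (nLL : ∃ x ∈ LL, x ≠ b) (nLR : ∃ x ∈ LR, x ≠ b) (nRL : ∃ x ∈ RL, x ≠ b)
    (nRR : ∃ x ∈ RR, x ≠ b) : False := by
  obtain ⟨p, hp, hpb⟩ := nLL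
  obtain ⟨s, hs, hsb⟩ := nRR
  obtain ⟨q, hq, hqb⟩ := nLR
  obtain ⟨r, hr, hrb⟩ := nRL
  have hpb' : p < b := lt_of_le_of_ne (bLL p hp) hpb
  have hqb' : q < b := lt_of_le_of_ne (bLR q hq) hqb
  have hsb' : b < s := lt_of_le_of_ne (bRR s hs) hsb.symm
  have hrb' : b < r := lt_of_le_of_ne (bRL r hr) hrb.symm
  have hps : P p ↔ P s := by
    rcases xLLRR p hp s hs with h | h
    · exact h.1
    · linarith [h.2]
  have hqr : ¬ (P r ↔ P q) := by
    rcases xRLLR r hr q hq with h | h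
    · linarith [h.2]
    · exact h.1
  by_cases hpr : P p ↔ P r
  · exact twisted_order_aux hD dLL dFL dFR dFF hp (dLR hq) (dRL hr) (dRR hs) hpb'.le hqb'.le
      hrb'.le hps hpr (fun h => hqr (hpr.symm.trans h)) (fun u hu => xFLRR u hu s hs) cFL
      (by obtain ⟨f, hf, h⟩ := cFR; exact ⟨f, hf, h q hq⟩) cFF' r1 r2 htwo ⟨p, hp, hpb'⟩
  -- The remaining sign pattern is the mirror image: `x ↦ -x` exchanges `LL` with `RR`, `FL` with
  -- `FR`, and both orders.
  · have hneg : ∀ x y, TwistLE P x y → TwistLE (fun z => P (-z)) (-y) (-x) := by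
      intro x y h
      simp only [TwistLE, neg_neg, neg_le_neg_iff]
      exact h.imp (fun h => ⟨h.1.symm, h.2⟩) (fun h => ⟨fun h' => h.1 h'.symm, h.2⟩)
    refine twisted_order_aux (P := fun z => P (-z)) (D := {x | -x ∈ D}) (b := -b)
      (LL := {x | -x ∈ RR}) (FL := {x | -x ∈ FR}) (FR := {x | -x ∈ FL}) (FF := {x | -x ∈ FF})
      (p := -s) (q := -r) (r := -q) (s := -p)
      ?_ (fun x hx => dRR hx) (fun x hx => dFR hx) (fun x hx => dFL hx) (fun x hx => dFF hx)
      (by simpa using hs) (by simpa using dRL hr) (by simpa using dLR hq) (by simpa using dLL hp)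
      (by linarith) (by linarith) (by linarith) ?_ ?_ ?_ ?_ ?_ ?_ ?_ ?_ ?_ ?_
      ⟨-s, by simpa using hs, by linarith⟩
    · intro x hx y hy z hz hxy hyz h
      have h1 := hD (-z) hz (-y) hy (-x) hx (by linarith) (by linarith) h.symm
      exact h1.trans h.symm
    · simp only [neg_neg]; exact hps.symm
    · simp only [neg_neg]
      exact iff_of_not_iff (b := P r) (fun h => hpr (hps.trans h)) (fun h => hqr h.symm)
    · simp only [neg_neg]
      exact fun h => hpr (hps.trans h)
    · intro u hu
      have := hneg _ _ (xLLFR p hp (-u) hu)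
      rwa [neg_neg] at this
    · obtain ⟨f, hf, h⟩ := cFR'
      exact ⟨-f, by simpa using hf, fun x hx => by linarith [h (-x) hx]⟩
    · obtain ⟨f, hf, h⟩ := cFL'
      exact ⟨-f, by simpa using hf, by linarith [h r hr]⟩
    · obtain ⟨f, hf, h⟩ := cFF
      exact ⟨-f, by simpa using hf, by linarith⟩
    · obtain ⟨g, hg, h⟩ := r2
      refine ⟨-g, by simpa using hg, fun x hx => ?_⟩
      have := hneg _ _ (h (-x) hx)
      rwa [neg_neg] at this
    · obtain ⟨g, hg, h⟩ := r1
      refine ⟨-g, by simpa using hg, fun x hx => ?_⟩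
      have := hneg _ _ (h (-x) hx)
      rwa [neg_neg] at this
    · intro x hx y hy z hz
      have := htwo _ hx _ hy _ hz
      simpa using this

/-- Interlacing of the roots of three quadratics with a linear relation. -/
theorem roots_interlace {b β l₁ l₂ r₁ r₂ f₁ f₂ lam rho phi : ℝ} (hb0 : 0 < b) (hb1 : b < 1)
    (hβ : 0 < β) (hlam : lam ≠ 0) (hrho : rho ≠ 0) (hphi : phi ≠ 0)
    (hl₁ : 0 ≤ l₁ ∧ l₁ ≤ b) (hl₂ : 0 ≤ l₂ ∧ l₂ ≤ b) (hr₁ : b ≤ r₁ ∧ r₁ ≤ 1) (hr₂ : b ≤ r₂ ∧ r₂ ≤ 1)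
    (hf₁ : 0 ≤ f₁ ∧ f₁ ≤ 1) (hf₂ : 0 ≤ f₂ ∧ f₂ ≤ 1)
    (hid : ∀ x : ℝ, (1 - x) * (lam * ((x - l₁) * (x - l₂))) - x * (rho * ((x - r₁) * (x - r₂))) +
      β * (b - x) * (phi * ((x - f₁) * (x - f₂))) = 0)
    (hdeg : (l₁ = b ∨ l₂ = b) → l₁ ≠ 0 ∧ l₂ ≠ 0 ∧ r₁ ≠ 1 ∧ r₂ ≠ 1 ∧ l₁ ≠ l₂ ∧ r₁ ≠ r₂) :
    ((f₁ ≤ l₁ ∧ f₁ ≤ l₂) ∨ (f₂ ≤ l₁ ∧ f₂ ≤ l₂)) ∧ ((r₁ ≤ f₁ ∧ r₂ ≤ f₁) ∨ (r₁ ≤ f₂ ∧ r₂ ≤ f₂)) := by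
  -- The leading coefficient of the cubic identity, obtained as a third difference of its values.
  have hlead : lam + rho + β * phi = 0 := by
    have h0 := hid 0
    have h1 := hid 1
    have h2 := hid 2
    have h3 := hid (-1)
    linear_combination (-1 / 6) * h2 + (1 / 2) * h1 - (1 / 2) * h0 + (1 / 6) * h3
  -- Evaluation at `b` compares the signs of `lam` and `rho`, unless a root sits at `b`. In that
  -- case the values at 0 and 1 are compared, and `hdeg` keeps them from degenerating.
  have hs : 0 < lam * rho := by
    have hbb := hid b
    by_cases h : l₁ = b ∨ l₂ = b
    · obtain ⟨n1, n2, n3, n4, n5, n6⟩ := hdeg h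
      have h0 := hid 0
      have h1 := hid 1
      have p1 : 0 < l₁ := lt_of_le_of_ne hl₁.1 n1.symm
      have p2 : 0 < l₂ := lt_of_le_of_ne hl₂.1 n2.symm
      have p3 : r₁ < 1 := lt_of_le_of_ne hr₁.2 n3
      have p4 : r₂ < 1 := lt_of_le_of_ne hr₂.2 n4
      have e0 : lam * (l₁ * l₂) = - (β * b * (phi * (f₁ * f₂))) := by linear_combination h0
      have e1 : rho * ((1 - r₁) * (1 - r₂)) = - (β * (1 - b) * (phi * ((1 - f₁) * (1 - f₂)))) := by
        linear_combination -h1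
      have q1 : 0 < (l₁ * l₂) * ((1 - r₁) * (1 - r₂)) :=
        mul_pos (mul_pos p1 p2) (mul_pos (by linarith) (by linarith))
      have q2 : 0 ≤ (f₁ * f₂) * ((1 - f₁) * (1 - f₂)) :=
        mul_nonneg (mul_nonneg hf₁.1 hf₂.1) (mul_nonneg (by linarith [hf₁.2]) (by linarith [hf₂.2]))
      have q3 : lam * rho * ((l₁ * l₂) * ((1 - r₁) * (1 - r₂))) =
          β ^ 2 * (b * (1 - b)) * phi ^ 2 * ((f₁ * f₂) * ((1 - f₁) * (1 - f₂))) := by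
        calc _ = (lam * (l₁ * l₂)) * (rho * ((1 - r₁) * (1 - r₂))) := by ring
          _ = _ := by rw [e0, e1]; ring
      have q4 : 0 ≤ lam * rho * ((l₁ * l₂) * ((1 - r₁) * (1 - r₂))) := by
        rw [q3]
        have := mul_pos hb0 (by linarith : 0 < 1 - b)
        positivity
      have q5 : 0 ≤ lam * rho := nonneg_of_mul_nonneg_left q4 q1
      exact lt_of_le_of_ne q5 (mul_ne_zero hlam hrho).symm
    · push Not at h
      have p1 : 0 < (b - l₁) * (b - l₂) :=
        mul_pos (sub_pos.2 (lt_of_le_of_ne hl₁.2 h.1)) (sub_pos.2 (lt_of_le_of_ne hl₂.2 h.2))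
      have p2 : 0 ≤ (b - r₁) * (b - r₂) :=
        mul_nonneg_of_nonpos_of_nonpos (by linarith [hr₁.1]) (by linarith [hr₂.1])
      have e : (1 - b) * (lam * ((b - l₁) * (b - l₂))) = b * (rho * ((b - r₁) * (b - r₂))) := by
        linear_combination hbb
      have q3 : lam * rho * (b * ((b - r₁) * (b - r₂))) =
          lam ^ 2 * ((1 - b) * ((b - l₁) * (b - l₂))) := by linear_combination (-lam) * e
      have q4 : 0 < lam * rho * (b * ((b - r₁) * (b - r₂))) := by
        rw [q3]
        have : 0 < 1 - b := by linarith
        positivity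
      by_contra hn
      push Not at hn
      exact absurd q4 (not_lt.2 (mul_nonpos_of_nonpos_of_nonneg hn (mul_nonneg hb0.le p2)))
  have hphi' : lam * phi < 0 := by
    have : β * (lam * phi) = - (lam ^ 2 + lam * rho) := by linear_combination lam * hlead
    by_contra hn
    push Not at hn
    nlinarith [mul_nonneg hβ.le hn, sq_nonneg lam]
  have hrp : rho * phi < 0 := by
    have : β * (rho * phi) = - (rho ^ 2 + lam * rho) := by linear_combination rho * hlead
    by_contra hn
    push Not at hn
    nlinarith [mul_nonneg hβ.le hn, sq_nonneg rho]
  -- At a root of the left form below `b`, two terms of the identity remain and fix the sign of the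
  -- full form: such a root lies between `f₁` and `f₂`.
  have hl : ∀ l, (l - l₁) * (l - l₂) = 0 → 0 ≤ l → l < b → (l - f₁) * (l - f₂) ≤ 0 := by
    intro l h0 hl0 hlb
    have h1 := hid l
    rw [h0] at h1
    have p2 : 0 ≤ (l - r₁) * (l - r₂) :=
      mul_nonneg_of_nonpos_of_nonpos (by linarith [hr₁.1]) (by linarith [hr₂.1])
    have e : β * (b - l) * (phi * rho) * ((l - f₁) * (l - f₂)) = rho ^ 2 * (l * ((l - r₁) * (l - r₂))) := by
      linear_combination rho * h1
    have p3 : 0 ≤ β * (b - l) * (phi * rho) * ((l - f₁) * (l - f₂)) := by rw [e]; positivity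
    by_contra hn
    push Not at hn
    have p4 : 0 < β * (b - l) := mul_pos hβ (by linarith)
    have p5 : β * (b - l) * (phi * rho) < 0 := mul_neg_of_pos_of_neg p4 (by linarith)
    have := mul_neg_of_neg_of_pos p5 hn
    linarith
  have hr : ∀ r, (r - r₁) * (r - r₂) = 0 → b < r → r ≤ 1 → (r - f₁) * (r - f₂) ≤ 0 := by
    intro r h0 hrb hr1
    have h1 := hid r
    rw [h0] at h1
    have p2 : 0 ≤ (r - l₁) * (r - l₂) :=
      mul_nonneg (by linarith [hl₁.2]) (by linarith [hl₂.2])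
    have e : β * (r - b) * (phi * lam) * ((r - f₁) * (r - f₂)) =
        lam ^ 2 * ((1 - r) * ((r - l₁) * (r - l₂))) := by
      linear_combination (-lam) * h1
    have p3 : 0 ≤ β * (r - b) * (phi * lam) * ((r - f₁) * (r - f₂)) := by
      rw [e]
      have : 0 ≤ 1 - r := by linarith
      positivity
    by_contra hn
    push Not at hn
    have p4 : 0 < β * (r - b) := mul_pos hβ (by linarith)
    have p5 : β * (r - b) * (phi * lam) < 0 := mul_neg_of_pos_of_neg p4 (by linarith)
    have := mul_neg_of_neg_of_pos p5 hn
    linarith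
  have between : ∀ x, (x - f₁) * (x - f₂) ≤ 0 → (f₁ ≤ x ∧ x ≤ f₂) ∨ (f₂ ≤ x ∧ x ≤ f₁) := by
    intro x hx
    rcases mul_nonpos_iff.1 hx with h | h
    · exact Or.inl ⟨by linarith, by linarith⟩
    · exact Or.inr ⟨by linarith, by linarith⟩
  have hbl : (l₁ = b ∨ l₂ = b) ↔ (r₁ = b ∨ r₂ = b) := by
    have h1 := hid b
    have e : (1 - b) * (lam * ((b - l₁) * (b - l₂))) = b * (rho * ((b - r₁) * (b - r₂))) := by
      linear_combination h1
    have n1 : 1 - b ≠ 0 := by linarith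
    constructor
    · intro h
      have h2 : (b - l₁) * (b - l₂) = 0 := by
        rcases h with h | h <;> simp [h]
      rw [h2] at e
      have h3 : (b - r₁) * (b - r₂) = 0 := by
        have : b * rho * ((b - r₁) * (b - r₂)) = 0 := by linear_combination -e
        exact (mul_eq_zero.1 this).resolve_left (mul_ne_zero hb0.ne' hrho)
      rcases mul_eq_zero.1 h3 with h | h
      · exact Or.inl (by linarith)
      · exact Or.inr (by linarith)
    · intro h
      have h2 : (b - r₁) * (b - r₂) = 0 := by
        rcases h with h | h <;> simp [h]
      rw [h2] at e
      have h3 : (b - l₁) * (b - l₂) = 0 := by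
        have : (1 - b) * lam * ((b - l₁) * (b - l₂)) = 0 := by linear_combination e
        exact (mul_eq_zero.1 this).resolve_left (mul_ne_zero n1 hlam)
      rcases mul_eq_zero.1 h3 with h | h
      · exact Or.inl (by linarith)
      · exact Or.inr (by linarith)
  constructor
  · have key : ∃ l, (l = l₁ ∨ l = l₂) ∧ l < b ∧ l ≤ l₁ ∧ l ≤ l₂ := by
      rcases le_total l₁ l₂ with h | h
      · refine ⟨l₁, Or.inl rfl, lt_of_le_of_ne hl₁.2 fun h' => ?_, le_rfl, h⟩
        exact (hdeg (Or.inl h')).2.2.2.2.1 (le_antisymm h (by linarith [hl₂.2]))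
      · refine ⟨l₂, Or.inr rfl, lt_of_le_of_ne hl₂.2 fun h' => ?_, h, le_rfl⟩
        exact (hdeg (Or.inr h')).2.2.2.2.1 (le_antisymm (by linarith [hl₁.2]) h)
    obtain ⟨l, hl', hlb, h1, h2⟩ := key
    have h3 : (l - l₁) * (l - l₂) = 0 := by rcases hl' with h | h <;> simp [h]
    have h4 : 0 ≤ l := by
      rcases hl' with h | h
      · linarith [hl₁.1]
      · linarith [hl₂.1]
    rcases between l (hl l h3 h4 hlb) with h | h
    · exact Or.inl ⟨by linarith, by linarith⟩
    · exact Or.inr ⟨by linarith, by linarith⟩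
  · have key : ∃ r, (r = r₁ ∨ r = r₂) ∧ b < r ∧ r₁ ≤ r ∧ r₂ ≤ r := by
      rcases le_total r₁ r₂ with h | h
      · refine ⟨r₂, Or.inr rfl, lt_of_le_of_ne hr₂.1 fun h' => ?_, h, le_rfl⟩
        exact (hdeg (hbl.2 (Or.inr h'.symm))).2.2.2.2.2 (le_antisymm h (by linarith [hr₁.1]))
      · refine ⟨r₁, Or.inl rfl, lt_of_le_of_ne hr₁.1 fun h' => ?_, le_rfl, h⟩
        exact (hdeg (hbl.2 (Or.inl h'.symm))).2.2.2.2.2 (le_antisymm (by linarith [hr₂.1]) h)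
    obtain ⟨r, hr', hrb, h1, h2⟩ := key
    have h3 : (r - r₁) * (r - r₂) = 0 := by rcases hr' with h | h <;> simp [h]
    have h4 : r ≤ 1 := by
      rcases hr' with h | h
      · linarith [hr₁.2]
      · linarith [hr₂.2]
    rcases between r (hr r h3 hrb h4) with h | h
    · exact Or.inr ⟨by linarith, by linarith⟩
    · exact Or.inl ⟨by linarith, by linarith⟩

end TriTangent

/-! ### Charts on arcs and the contradiction for nine forms -/

namespace TriTangent

open Set

/-- Affine chart on the arc from `W 0` to `W 2`. -/
def chart (W : Fin 3 → ℝ × ℝ) (x : ℝ) : ℝ × ℝ := (1 - x) • W 0 + x • W 2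

/-- Three vectors in counterclockwise order inside a half plane. -/
structure Ordered (W : Fin 3 → ℝ × ℝ) : Prop where
  h01 : 0 < br (W 0) (W 1)
  h12 : 0 < br (W 1) (W 2)
  h02 : 0 < br (W 0) (W 2)

section Chart

variable {W : Fin 3 → ℝ × ℝ}

theorem br_smul_left (r : ℝ) (u v : ℝ × ℝ) : br (r • u) v = r * br u v := by simp [br]; ring

theorem br_smul_right (r : ℝ) (u v : ℝ × ℝ) : br u (r • v) = r * br u v := by simp [br]; ring

theorem br_chart (W : Fin 3 → ℝ × ℝ) (x y : ℝ) :
    br (chart W x) (chart W y) = (y - x) * br (W 0) (W 2) := by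
  simp [br, chart]; ring

theorem chart_zero (W : Fin 3 → ℝ × ℝ) : chart W 0 = W 0 := by simp [chart]

theorem chart_one (W : Fin 3 → ℝ × ℝ) : chart W 1 = W 2 := by simp [chart]

theorem chart_comb (W : Fin 3 → ℝ × ℝ) {r s : ℝ} (h : r + s ≠ 0) (x y : ℝ) :
    r • chart W x + s • chart W y = (r + s) • chart W ((r * x + s * y) / (r + s)) := by
  have h1 : (r + s) * ((r * x + s * y) / (r + s)) = r * x + s * y := by field_simp
  have h2 : ∀ c : ℝ, (r + s) • chart W c = (r + s - (r + s) * c) • W 0 + ((r + s) * c) • W 2 := by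
    intro c; simp only [chart]; module
  rw [h2, h1]
  simp only [chart]
  module

/-- Coordinate of the middle vector. -/
theorem Ordered.exists_mid (h : Ordered W) : ∃ β m : ℝ, 0 < m ∧ 0 < β ∧ β < 1 ∧
    W 1 = m • chart W β := by
  obtain ⟨h01, h12, h02⟩ := h
  have key : br (W 0) (W 2) • W 1 = br (W 1) (W 2) • W 0 + br (W 0) (W 1) • W 2 := by
    ext <;> simp [br] <;> ring
  set D := br (W 0) (W 2)
  set r := br (W 1) (W 2)
  set s := br (W 0) (W 1)
  refine ⟨s / (r + s), (r + s) / D, by positivity, by positivity, ?_, ?_⟩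
  · rw [div_lt_one (by positivity)]; linarith
  · have h1 := chart_comb W (r := r) (s := s) (by positivity) 0 1
    rw [chart_zero, chart_one, mul_zero, mul_one, zero_add, ← key] at h1
    rw [div_eq_inv_mul, mul_smul, ← h1, smul_smul, inv_mul_cancel₀ h02.ne', one_smul]

theorem exists_chart_of_inArc {p q u : ℝ × ℝ} {m n x y : ℝ} (hm : 0 < m) (hn : 0 < n)
    (hp : p = m • chart W x) (hq : q = n • chart W y) (hu : u ≠ 0) (h : InArc p q u) :
    ∃ μ z : ℝ, μ ≠ 0 ∧ z ∈ uIcc x y ∧ u = μ • chart W z := by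
  have key : ∀ u : ℝ × ℝ, u ≠ 0 → InCone p q u →
      ∃ μ z : ℝ, μ ≠ 0 ∧ z ∈ uIcc x y ∧ u = μ • chart W z := by
    rintro u hu ⟨r, s, hr, hs, rfl⟩
    have hr' := mul_nonneg hr hm.le
    have hs' := mul_nonneg hs hn.le
    have hpos : 0 < r * m + s * n := by
      rcases hr.eq_or_lt with h | h
      · rcases hs.eq_or_lt with h' | h'
        · simp [← h, ← h'] at hu
        · have := mul_pos h' hn
          linarith
      · have := mul_pos h hm
        linarith
    refine ⟨r * m + s * n, (r * m * x + s * n * y) / (r * m + s * n), hpos.ne', ?_, ?_⟩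
    · rw [← segment_eq_uIcc]
      refine ⟨r * m / (r * m + s * n), s * n / (r * m + s * n), by positivity, by positivity,
        by field_simp, ?_⟩
      simp only [smul_eq_mul]
      field_simp
    · rw [← chart_comb W hpos.ne', hp, hq, smul_smul, smul_smul]
  rcases h with h | h
  · exact key u hu h
  · obtain ⟨μ, z, h1, h2, h3⟩ := key (-u) (neg_ne_zero.2 hu) h
    exact ⟨-μ, z, neg_ne_zero.2 h1, h2, by rw [neg_smul, ← h3, neg_neg]⟩

end Chart

/-- A quadratic form in the chart. -/
structure ChartRoots (W : Fin 3 → ℝ × ℝ) (q : ℝ × ℝ → ℝ) (x y : ℝ) : Prop where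
  exists_eq : ∃ K : ℝ, K ≠ 0 ∧ ∀ z, q (chart W z) = K * ((z - x) * (z - y))

theorem chartRoots_of_eq {W : Fin 3 → ℝ × ℝ} (hD : br (W 0) (W 2) ≠ 0) {q : ℝ × ℝ → ℝ} {k : ℝ}
    {u v : ℝ × ℝ} (hk : k ≠ 0) (hq : ∀ z, q z = k * (br z u * br z v)) {μ ν x y : ℝ} (hμ : μ ≠ 0)
    (hν : ν ≠ 0) (hu : u = μ • chart W x) (hv : v = ν • chart W y) : ChartRoots W q x y := by
  refine ⟨k * μ * ν * br (W 0) (W 2) ^ 2, by positivity, fun z => ?_⟩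
  rw [hq, hu, hv, br_smul_right, br_smul_right, br_chart, br_chart]
  ring

theorem ChartRoots.left {W : Fin 3 → ℝ × ℝ} {q : ℝ × ℝ → ℝ} {x y : ℝ} (h : ChartRoots W q x y) :
    q (chart W x) = 0 := by
  obtain ⟨K, -, h⟩ := h.exists_eq
  rw [h]; ring

theorem ChartRoots.right {W : Fin 3 → ℝ × ℝ} {q : ℝ × ℝ → ℝ} {x y : ℝ} (h : ChartRoots W q x y) :
    q (chart W y) = 0 := by
  obtain ⟨K, -, h⟩ := h.exists_eq
  rw [h]; ring

/-- Order of the roots of three quadratic forms with a linear relation. -/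
theorem chartRoots_interlace {W : Fin 3 → ℝ × ℝ} (hW : Ordered W) {qR qF qL : ℝ × ℝ → ℝ}
    (hid : ∀ z, br z (W 0) * qR z + br z (W 1) * qF z + br z (W 2) * qL z = 0) {b m : ℝ}
    (hm : 0 < m) (hb0 : 0 < b) (hb1 : b < 1) (hb : W 1 = m • chart W b) {l₁ l₂ r₁ r₂ f₁ f₂ : ℝ}
    (hL : ChartRoots W qL l₁ l₂) (hR : ChartRoots W qR r₁ r₂) (hF : ChartRoots W qF f₁ f₂)
    (hl₁ : 0 ≤ l₁ ∧ l₁ ≤ b) (hl₂ : 0 ≤ l₂ ∧ l₂ ≤ b) (hr₁ : b ≤ r₁ ∧ r₁ ≤ 1) (hr₂ : b ≤ r₂ ∧ r₂ ≤ 1)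
    (hf₁ : 0 ≤ f₁ ∧ f₁ ≤ 1) (hf₂ : 0 ≤ f₂ ∧ f₂ ≤ 1)
    (hdeg : (l₁ = b ∨ l₂ = b) → l₁ ≠ 0 ∧ l₂ ≠ 0 ∧ r₁ ≠ 1 ∧ r₂ ≠ 1 ∧ l₁ ≠ l₂ ∧ r₁ ≠ r₂) :
    ((f₁ ≤ l₁ ∧ f₁ ≤ l₂) ∨ (f₂ ≤ l₁ ∧ f₂ ≤ l₂)) ∧ ((r₁ ≤ f₁ ∧ r₂ ≤ f₁) ∨ (r₁ ≤ f₂ ∧ r₂ ≤ f₂)) := by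
  obtain ⟨K, hK, hL⟩ := hL.exists_eq
  obtain ⟨M, hM, hR⟩ := hR.exists_eq
  obtain ⟨N, hN, hF⟩ := hF.exists_eq
  refine roots_interlace (β := m) (lam := K) (rho := M) (phi := N) hb0 hb1 hm hK hM hN hl₁ hl₂ hr₁
    hr₂ hf₁ hf₂ (fun x => ?_) hdeg
  have h := hid (chart W x)
  have h0 := br_chart W x 0
  have h1 := br_chart W x b
  have h2 := br_chart W x 1
  rw [chart_zero] at h0
  rw [chart_one] at h2
  rw [hb, br_smul_right, h0, h1, h2, hL, hR, hF] at h
  have hD := hW.h02.ne'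
  apply mul_left_cancel₀ hD
  linear_combination h

section Twist

variable {W W' : Fin 3 → ℝ × ℝ}

/-- The point with coordinate `x` on the first arc is positively proportional to a point of the
second arc. -/
def PosOn (W W' : Fin 3 → ℝ × ℝ) (x : ℝ) : Prop :=
  ∃ ν y : ℝ, 0 < ν ∧ y ∈ Icc (0 : ℝ) 1 ∧ chart W x = ν • chart W' y

/-- The cone of the second arc is pointed, so it does not contain a nonzero vector together with its
negative. -/
theorem sign_unique (hW' : Ordered W') {ν ν' y y' : ℝ} (hν : 0 < ν) (hν' : ν' < 0)
    (hy : y ∈ Icc (0 : ℝ) 1) (hy' : y' ∈ Icc (0 : ℝ) 1)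
    (h : ν • chart W' y = ν' • chart W' y') : False := by
  have hp := pointed_of_br_ne hW'.h02.ne'
  have e : (ν * (1 - y) + (-ν') * (1 - y')) • W' 0 + (ν * y + (-ν') * y') • W' 2 = 0 := by
    have : ν • chart W' y - ν' • chart W' y' = 0 := sub_eq_zero.2 h
    rw [← this]
    simp only [chart]
    module
  have a1 := mul_nonneg hν.le hy.1
  have a2 := mul_nonneg hν.le (by linarith [hy.2] : 0 ≤ 1 - y)
  have a3 := mul_nonneg (by linarith : 0 ≤ -ν') hy'.1
  have a4 := mul_nonneg (by linarith : 0 ≤ -ν') (by linarith [hy'.2] : 0 ≤ 1 - y')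
  obtain ⟨h1, h2⟩ := hp _ _ (by linarith) (by linarith) e
  linarith

theorem posOn_iff (hW' : Ordered W') {x ν y : ℝ} (hν : ν ≠ 0) (hy : y ∈ Icc (0 : ℝ) 1)
    (h : chart W x = ν • chart W' y) : PosOn W W' x ↔ 0 < ν := by
  constructor
  · rintro ⟨ν', y', hν', hy', h'⟩
    by_contra hn
    have : ν < 0 := lt_of_le_of_ne (not_lt.1 hn) hν
    exact sign_unique hW' hν' this hy' hy (h'.symm.trans h)
  · intro h0
    exact ⟨ν, y, h0, hy, h⟩

/-- The determinant of the two vectors, computed in both charts, equals the coordinate difference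
times a positive constant, up to the product of the scaling factors. The orders therefore agree for
equal signs and are reversed for opposite ones. -/
theorem twistLE_of_le (hW : Ordered W) (hW' : Ordered W') {x₁ x₂ ν₁ ν₂ y₁ y₂ : ℝ} (hν₁ : ν₁ ≠ 0)
    (hν₂ : ν₂ ≠ 0) (hy₁ : y₁ ∈ Icc (0 : ℝ) 1) (hy₂ : y₂ ∈ Icc (0 : ℝ) 1)
    (h₁ : chart W x₁ = ν₁ • chart W' y₁) (h₂ : chart W x₂ = ν₂ • chart W' y₂) (h : y₁ ≤ y₂) :
    TwistLE (PosOn W W') x₁ x₂ := by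
  have e := br_chart W x₁ x₂
  rw [h₁, h₂, br_smul_left, br_smul_right, br_chart] at e
  have hD := hW.h02
  have hD' := hW'.h02
  have h0 : 0 ≤ (y₂ - y₁) * br (W' 0) (W' 2) := mul_nonneg (by linarith) hD'.le
  rw [TwistLE, posOn_iff hW' hν₁ hy₁ h₁, posOn_iff hW' hν₂ hy₂ h₂]
  have pos : 0 ≤ (x₂ - x₁) * br (W 0) (W 2) → x₁ ≤ x₂ := fun h => by
    have := nonneg_of_mul_nonneg_left h hD
    linarith
  have neg : (x₂ - x₁) * br (W 0) (W 2) ≤ 0 → x₂ ≤ x₁ := fun h => by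
    by_contra hn
    push Not at hn
    have := mul_pos (sub_pos.2 hn) hD
    linarith
  rcases hν₁.lt_or_gt with a | a <;> rcases hν₂.lt_or_gt with b | b
  · refine Or.inl ⟨iff_of_false (by linarith) (by linarith), pos ?_⟩
    rw [← e, ← mul_assoc]
    exact mul_nonneg (mul_pos_of_neg_of_neg a b).le h0
  · refine Or.inr ⟨fun h => by linarith [h.2 b], neg ?_⟩
    rw [← e, ← mul_assoc]
    exact mul_nonpos_of_nonpos_of_nonneg (mul_neg_of_neg_of_pos a b).le h0
  · refine Or.inr ⟨fun h => by linarith [h.1 a], neg ?_⟩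
    rw [← e, ← mul_assoc]
    exact mul_nonpos_of_nonpos_of_nonneg (mul_neg_of_pos_of_neg a b).le h0
  · refine Or.inl ⟨iff_of_true a b, pos ?_⟩
    rw [← e, ← mul_assoc]
    exact mul_nonneg (mul_pos a b).le h0

/-- The points of the first arc that also lie on the second one. -/
def CommonArc (W W' : Fin 3 → ℝ × ℝ) : Set ℝ :=
  {x | ∃ ν y : ℝ, ν ≠ 0 ∧ y ∈ Icc (0 : ℝ) 1 ∧ chart W x = ν • chart W' y}

/-- Between two vectors that lie in the second cone, or both in its negative, every point of the
chart segment lies there as well. -/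
theorem posOn_convex (hW' : Ordered W') {x y z : ℝ} (hx : x ∈ CommonArc W W')
    (hz : z ∈ CommonArc W W') (hxy : x ≤ y) (hyz : y ≤ z)
    (h : PosOn W W' x ↔ PosOn W W' z) : PosOn W W' y ↔ PosOn W W' x := by
  rcases hxy.eq_or_lt with rfl | hxy
  · exact Iff.rfl
  obtain ⟨ν, s, hν, hs, h1⟩ := hx
  obtain ⟨ν', s', hν', hs', h2⟩ := hz
  rw [posOn_iff hW' hν hs h1, posOn_iff hW' hν' hs' h2] at h
  have hxz : 0 < z - x := by linarith
  have e1 : (z - y) / (z - x) + (y - x) / (z - x) = 1 := by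
    rw [← add_div, div_eq_one_iff_eq hxz.ne']; ring
  have e0 := chart_comb W (r := (z - y) / (z - x)) (s := (y - x) / (z - x))
    (by rw [e1]; exact one_ne_zero) x z
  have e2 : ((z - y) / (z - x) * x + (y - x) / (z - x) * z) = y := by field_simp; ring
  rw [e1, one_smul, div_one, e2, h1, h2, smul_smul, smul_smul] at e0
  have t1 : 0 ≤ (z - y) / (z - x) := div_nonneg (by linarith) hxz.le
  have t2 : 0 < (y - x) / (z - x) := div_pos (by linarith) hxz
  set r := (z - y) / (z - x)
  set τ := (y - x) / (z - x)
  have hmem : ∀ R S : ℝ, 0 ≤ R → 0 < S → (R * s + S * s') / (R + S) ∈ Icc (0 : ℝ) 1 := by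
    intro R S hR hS
    have a1 := mul_nonneg hR hs.1
    have a2 := mul_nonneg hS.le hs'.1
    have a3 := mul_nonneg hR (by linarith [hs.2] : 0 ≤ 1 - s)
    have a4 := mul_nonneg hS.le (by linarith [hs'.2] : 0 ≤ 1 - s')
    constructor
    · positivity
    · rw [div_le_one (by linarith)]
      linarith
  rw [posOn_iff hW' hν hs h1]
  rcases hν.lt_or_gt with hneg | hpos
  · have hneg' : ν' < 0 := lt_of_le_of_ne (not_lt.1 (fun h' => by linarith [h.2 h'])) hν'
    refine iff_of_false ?_ (by linarith)
    have hR : 0 ≤ r * -ν := mul_nonneg t1 (by linarith)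
    have hS : 0 < τ * -ν' := mul_pos t2 (by linarith)
    have e3 := chart_comb W' (r := r * ν) (s := τ * ν') (by
      have : r * ν + τ * ν' < 0 := by linarith
      exact this.ne) s s'
    have e4 : (r * ν * s + τ * ν' * s') / (r * ν + τ * ν') =
        (r * -ν * s + τ * -ν' * s') / (r * -ν + τ * -ν') := by
      rw [← neg_div_neg_eq]
      congr 1 <;> ring
    rw [e3, e4] at e0
    rw [posOn_iff hW' (by linarith : r * ν + τ * ν' < 0).ne (hmem _ _ hR hS) e0.symm]
    linarith
  · have hpos' := h.1 hpos
    refine iff_of_true ?_ hpos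
    have hR : 0 ≤ r * ν := mul_nonneg t1 hpos.le
    have hS : 0 < τ * ν' := mul_pos t2 hpos'
    have e3 := chart_comb W' (r := r * ν) (s := τ * ν') (by linarith) s s'
    rw [e3] at e0
    exact ⟨_, _, by linarith, hmem _ _ hR hS, e0.symm⟩

end Twist

/-- Nine quadratic forms with the linear relations coming from two triangles cannot all have
their roots in the prescribed arcs. -/
theorem nine_forms_contradiction {W W' : Fin 3 → ℝ × ℝ} (hW : Ordered W) (hW' : Ordered W')
    {q : Fin 3 → Fin 3 → ℝ × ℝ → ℝ}
    (hcol : ∀ Y z, br z (W 0) * q 0 Y z + br z (W 1) * q 1 Y z + br z (W 2) * q 2 Y z = 0)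
    (hrow : ∀ X z, br z (W' 0) * q X 0 z + br z (W' 1) * q X 1 z + br z (W' 2) * q X 2 z = 0)
    {k : Fin 3 → Fin 3 → ℝ} {u v : Fin 3 → Fin 3 → ℝ × ℝ} (hk : ∀ X Y, k X Y ≠ 0)
    (hu0 : ∀ X Y, u X Y ≠ 0) (hv0 : ∀ X Y, v X Y ≠ 0)
    (hq : ∀ X Y z, q X Y z = k X Y * (br z (u X Y) * br z (v X Y)))
    (hu : ∀ X Y, InArc (W (X + 1)) (W (X + 2)) (u X Y))
    (hv : ∀ X Y, InArc (W (X + 1)) (W (X + 2)) (v X Y))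
    (hu' : ∀ X Y, InArc (W' (Y + 1)) (W' (Y + 2)) (u X Y))
    (hv' : ∀ X Y, InArc (W' (Y + 1)) (W' (Y + 2)) (v X Y))
    (z1 : ∀ Y X X' m m', X ≠ m → X' ≠ m' → q X Y (W m) = 0 → q X' Y (W m') = 0 → m = m')
    (z2 : ∀ Y X X' m, X ≠ m → X' ≠ m → q X Y (W m) = 0 → br (u X' Y) (v X' Y) ≠ 0)
    (z1' : ∀ X Y Y' m m', Y ≠ m → Y' ≠ m' → q X Y (W' m) = 0 → q X Y' (W' m') = 0 → m = m')
    (z2' : ∀ X Y Y' m, Y ≠ m → Y' ≠ m → q X Y (W' m) = 0 → br (u X Y') (v X Y') ≠ 0) : False := by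
  obtain ⟨b, m, hm, hb0, hb1, hb⟩ := hW.exists_mid
  obtain ⟨b', m', hm', hb0', hb1', hb'⟩ := hW'.exists_mid
  have hD := hW.h02.ne'
  have hD' := hW'.h02.ne'
  -- coordinates of the roots
  have chartArc : ∀ {W : Fin 3 → ℝ × ℝ} {b m : ℝ}, 0 < m → 0 < b → b < 1 → W 1 = m • chart W b →
      ∀ X (u : ℝ × ℝ), u ≠ 0 → InArc (W (X + 1)) (W (X + 2)) u →
      ∃ μ x : ℝ, μ ≠ 0 ∧ (0 ≤ x ∧ x ≤ 1) ∧ (X = 2 → x ≤ b) ∧ (X = 0 → b ≤ x) ∧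
        u = μ • chart W x := by
    intro W b m hm hb0 hb1 hb X u hu0 hu
    have e0 : W 0 = (1 : ℝ) • chart W 0 := by rw [chart_zero, one_smul]
    have e2 : W 2 = (1 : ℝ) • chart W 1 := by rw [chart_one, one_smul]
    fin_cases X
    · obtain ⟨μ, x, h1, h2, h3⟩ := exists_chart_of_inArc hm one_pos hb e2 hu0 hu
      rw [uIcc_of_le hb1.le] at h2
      exact ⟨μ, x, h1, ⟨hb0.le.trans h2.1, h2.2⟩, fun h => by simp at h, fun _ => h2.1, h3⟩
    · obtain ⟨μ, x, h1, h2, h3⟩ := exists_chart_of_inArc one_pos one_pos e2 e0 hu0 hu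
      rw [uIcc_of_ge zero_le_one] at h2
      exact ⟨μ, x, h1, h2, fun h => by simp at h, fun h => by simp at h, h3⟩
    · obtain ⟨μ, x, h1, h2, h3⟩ := exists_chart_of_inArc one_pos hm e0 hb hu0 hu
      rw [uIcc_of_le hb0.le] at h2
      exact ⟨μ, x, h1, ⟨h2.1, h2.2.trans hb1.le⟩, fun _ => h2.2, fun h => by simp at h, h3⟩
  choose μ x hμ hx hxL hxR hux using fun X Y => chartArc hm hb0 hb1 hb X _ (hu0 X Y) (hu X Y)
  choose ν y hν hy hyL hyR hvy using fun X Y => chartArc hm hb0 hb1 hb X _ (hv0 X Y) (hv X Y)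
  choose μ' x' hμ' hx' hxL' hxR' hux' using
    fun X Y => chartArc hm' hb0' hb1' hb' Y _ (hu0 X Y) (hu' X Y)
  choose ν' y' hν' hy' hyL' hyR' hvy' using
    fun X Y => chartArc hm' hb0' hb1' hb' Y _ (hv0 X Y) (hv' X Y)
  have hroots : ∀ X Y, ChartRoots W (q X Y) (x X Y) (y X Y) := fun X Y =>
    chartRoots_of_eq hD (hk X Y) (hq X Y) (hμ X Y) (hν X Y) (hux X Y) (hvy X Y)
  have hroots' : ∀ X Y, ChartRoots W' (q X Y) (x' X Y) (y' X Y) := fun X Y =>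
    chartRoots_of_eq hD' (hk X Y) (hq X Y) (hμ' X Y) (hν' X Y) (hux' X Y) (hvy' X Y)
  have hW1 : ∀ {f : ℝ × ℝ → ℝ} {k : ℝ} {u v : ℝ × ℝ}, (∀ z, f z = k * (br z u * br z v)) →
      ∀ z, ∀ r : ℝ, f z = 0 → f (r • z) = 0 := by
    intro f k u v hf z r h
    rw [hf] at h ⊢
    rw [br_smul_left, br_smul_left]
    linear_combination r ^ 2 * h
  -- roots at the vertices
  have hzero : ∀ X Y, (x X Y = b ∨ y X Y = b → q X Y (W 1) = 0) ∧
      (x X Y = 0 ∨ y X Y = 0 → q X Y (W 0) = 0) ∧ (x X Y = 1 ∨ y X Y = 1 → q X Y (W 2) = 0) := by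
    intro X Y
    have h1 := (hroots X Y).left
    have h2 := (hroots X Y).right
    refine ⟨?_, ?_, ?_⟩
    · intro h
      rw [hb]
      apply hW1 (hq X Y)
      rcases h with h | h
      · rwa [h] at h1
      · rwa [h] at h2
    · intro h
      rw [← chart_zero W]
      rcases h with h | h
      · rwa [h] at h1
      · rwa [h] at h2
    · intro h
      rw [← chart_one W]
      rcases h with h | h
      · rwa [h] at h1
      · rwa [h] at h2
  have hzero' : ∀ X Y, (x' X Y = b' ∨ y' X Y = b' → q X Y (W' 1) = 0) ∧
      (x' X Y = 0 ∨ y' X Y = 0 → q X Y (W' 0) = 0) ∧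
      (x' X Y = 1 ∨ y' X Y = 1 → q X Y (W' 2) = 0) := by
    intro X Y
    have h1 := (hroots' X Y).left
    have h2 := (hroots' X Y).right
    refine ⟨?_, ?_, ?_⟩
    · intro h
      rw [hb']
      apply hW1 (hq X Y)
      rcases h with h | h
      · rwa [h] at h1
      · rwa [h] at h2
    · intro h
      rw [← chart_zero W']
      rcases h with h | h
      · rwa [h] at h1
      · rwa [h] at h2
    · intro h
      rw [← chart_one W']
      rcases h with h | h
      · rwa [h] at h1
      · rwa [h] at h2
  have hdouble : ∀ X Y, x X Y = y X Y → br (u X Y) (v X Y) = 0 := by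
    intro X Y h
    rw [hux, hvy, h, br_smul_left, br_smul_right, br_self]
    ring
  have hdouble' : ∀ X Y, x' X Y = y' X Y → br (u X Y) (v X Y) = 0 := by
    intro X Y h
    rw [hux', hvy', h, br_smul_left, br_smul_right, br_self]
    ring
  -- The relation among the three forms of a column is the cubic identity of `roots_interlace`. If a
  -- root sits at `b`, `z1` excludes roots at the outer vertices and `z2` excludes double roots.
  have col : ∀ Y, ((x 1 Y ≤ x 2 Y ∧ x 1 Y ≤ y 2 Y) ∨ (y 1 Y ≤ x 2 Y ∧ y 1 Y ≤ y 2 Y)) ∧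
      ((x 0 Y ≤ x 1 Y ∧ y 0 Y ≤ x 1 Y) ∨ (x 0 Y ≤ y 1 Y ∧ y 0 Y ≤ y 1 Y)) := by
    intro Y
    refine chartRoots_interlace hW (hcol Y) hm hb0 hb1 hb (hroots 2 Y) (hroots 0 Y) (hroots 1 Y)
      ⟨(hx 2 Y).1, hxL 2 Y rfl⟩ ⟨(hy 2 Y).1, hyL 2 Y rfl⟩ ⟨hxR 0 Y rfl, (hx 0 Y).2⟩
      ⟨hyR 0 Y rfl, (hy 0 Y).2⟩ (hx 1 Y) (hy 1 Y) ?_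
    intro h
    have h1 := (hzero 2 Y).1 h
    have no0 : ∀ X, X ≠ 0 → q X Y (W 0) ≠ 0 := fun X hX h' => by
      have := z1 Y 2 X 1 0 (by decide) hX h1 h'
      exact absurd this (by decide)
    have no2 : ∀ X, X ≠ 2 → q X Y (W 2) ≠ 0 := fun X hX h' => by
      have := z1 Y 2 X 1 2 (by decide) hX h1 h'
      exact absurd this (by decide)
    exact ⟨fun h => no0 2 (by decide) ((hzero 2 Y).2.1 (Or.inl h)),
      fun h => no0 2 (by decide) ((hzero 2 Y).2.1 (Or.inr h)),
      fun h => no2 0 (by decide) ((hzero 0 Y).2.2 (Or.inl h)),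
      fun h => no2 0 (by decide) ((hzero 0 Y).2.2 (Or.inr h)),
      fun h => z2 Y 2 2 1 (by decide) (by decide) h1 (hdouble 2 Y h),
      fun h => z2 Y 2 0 1 (by decide) (by decide) h1 (hdouble 0 Y h)⟩
  have row : ∀ X, ((x' X 1 ≤ x' X 2 ∧ x' X 1 ≤ y' X 2) ∨ (y' X 1 ≤ x' X 2 ∧ y' X 1 ≤ y' X 2)) ∧
      ((x' X 0 ≤ x' X 1 ∧ y' X 0 ≤ x' X 1) ∨ (x' X 0 ≤ y' X 1 ∧ y' X 0 ≤ y' X 1)) := by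
    intro X
    refine chartRoots_interlace hW' (hrow X) hm' hb0' hb1' hb' (hroots' X 2) (hroots' X 0)
      (hroots' X 1) ⟨(hx' X 2).1, hxL' X 2 rfl⟩ ⟨(hy' X 2).1, hyL' X 2 rfl⟩
      ⟨hxR' X 0 rfl, (hx' X 0).2⟩ ⟨hyR' X 0 rfl, (hy' X 0).2⟩ (hx' X 1) (hy' X 1) ?_
    intro h
    have h1 := (hzero' X 2).1 h
    have no0 : ∀ Y, Y ≠ 0 → q X Y (W' 0) ≠ 0 := fun Y hY h' => by
      have := z1' X 2 Y 1 0 (by decide) hY h1 h'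
      exact absurd this (by decide)
    have no2 : ∀ Y, Y ≠ 2 → q X Y (W' 2) ≠ 0 := fun Y hY h' => by
      have := z1' X 2 Y 1 2 (by decide) hY h1 h'
      exact absurd this (by decide)
    exact ⟨fun h => no0 2 (by decide) ((hzero' X 2).2.1 (Or.inl h)),
      fun h => no0 2 (by decide) ((hzero' X 2).2.1 (Or.inr h)),
      fun h => no2 0 (by decide) ((hzero' X 0).2.2 (Or.inl h)),
      fun h => no2 0 (by decide) ((hzero' X 0).2.2 (Or.inr h)),
      fun h => z2' X 2 2 1 (by decide) (by decide) h1 (hdouble' X 2 h),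
      fun h => z2' X 2 0 1 (by decide) (by decide) h1 (hdouble' X 0 h)⟩
  have hcx : ∀ X Y, chart W (x X Y) = ((μ X Y)⁻¹ * μ' X Y) • chart W' (x' X Y) := by
    intro X Y
    rw [mul_smul, ← hux', hux, smul_smul, inv_mul_cancel₀ (hμ X Y), one_smul]
  have hcy : ∀ X Y, chart W (y X Y) = ((ν X Y)⁻¹ * ν' X Y) • chart W' (y' X Y) := by
    intro X Y
    rw [mul_smul, ← hvy', hvy, smul_smul, inv_mul_cancel₀ (hν X Y), one_smul]
  have hnx : ∀ X Y, (μ X Y)⁻¹ * μ' X Y ≠ 0 := fun X Y => mul_ne_zero (inv_ne_zero (hμ X Y)) (hμ' X Y)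
  have hny : ∀ X Y, (ν X Y)⁻¹ * ν' X Y ≠ 0 := fun X Y => mul_ne_zero (inv_ne_zero (hν X Y)) (hν' X Y)
  have tw : ∀ X Y X' Y', (x' X Y ≤ x' X' Y' → TwistLE (PosOn W W') (x X Y) (x X' Y')) ∧
      (x' X Y ≤ y' X' Y' → TwistLE (PosOn W W') (x X Y) (y X' Y')) ∧
      (y' X Y ≤ x' X' Y' → TwistLE (PosOn W W') (y X Y) (x X' Y')) ∧
      (y' X Y ≤ y' X' Y' → TwistLE (PosOn W W') (y X Y) (y X' Y')) := fun X Y X' Y' =>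
    ⟨twistLE_of_le hW hW' (hnx _ _) (hnx _ _) (hx' _ _) (hx' _ _) (hcx _ _) (hcx _ _),
      twistLE_of_le hW hW' (hnx _ _) (hny _ _) (hx' _ _) (hy' _ _) (hcx _ _) (hcy _ _),
      twistLE_of_le hW hW' (hny _ _) (hnx _ _) (hy' _ _) (hx' _ _) (hcy _ _) (hcx _ _),
      twistLE_of_le hW hW' (hny _ _) (hny _ _) (hy' _ _) (hy' _ _) (hcy _ _) (hcy _ _)⟩
  let Rt : Fin 3 → Fin 3 → Set ℝ := fun X Y => {x X Y, y X Y}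
  have hRt : ∀ X Y (p : ℝ → Prop), (∀ z ∈ Rt X Y, p z) ↔ p (x X Y) ∧ p (y X Y) := by
    intro X Y p
    simp [Rt]
  have dom : ∀ X Y, Rt X Y ⊆ CommonArc W W' := fun X Y => (hRt X Y _).2
    ⟨⟨_, _, hnx X Y, hx' X Y, hcx X Y⟩, ⟨_, _, hny X Y, hy' X Y, hcy X Y⟩⟩
  -- On the second arc the roots for `Y = 2` lie below its middle vertex and those for `Y = 0` above
  -- it.
  have cross : ∀ X X', ∀ z ∈ Rt X 2, ∀ z' ∈ Rt X' 0, TwistLE (PosOn W W') z z' := by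
    intro X X'
    obtain ⟨t1, t2, t3, t4⟩ := tw X 2 X' 0
    have a1 := hxL' X 2 rfl
    have a2 := hyL' X 2 rfl
    have a3 := hxR' X' 0 rfl
    have a4 := hyR' X' 0 rfl
    exact (hRt X 2 _).2 ⟨(hRt X' 0 _).2 ⟨t1 (a1.trans a3), t2 (a1.trans a4)⟩,
      (hRt X' 0 _).2 ⟨t3 (a2.trans a3), t4 (a2.trans a4)⟩⟩
  have leb : ∀ Y, ∀ z ∈ Rt 2 Y, z ≤ b := fun Y => (hRt 2 Y _).2 ⟨hxL 2 Y rfl, hyL 2 Y rfl⟩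
  have geb : ∀ Y, ∀ z ∈ Rt 0 Y, b ≤ z := fun Y => (hRt 0 Y _).2 ⟨hxR 0 Y rfl, hyR 0 Y rfl⟩
  have mx : ∀ X Y, x X Y ∈ Rt X Y := fun X Y => by simp [Rt]
  have my : ∀ X Y, y X Y ∈ Rt X Y := fun X Y => by simp [Rt]
  have colL : ∀ Y, ∃ f ∈ Rt 1 Y, ∀ z ∈ Rt 2 Y, f ≤ z := by
    intro Y
    rcases (col Y).1 with h | h
    · exact ⟨_, mx 1 Y, (hRt 2 Y _).2 h⟩
    · exact ⟨_, my 1 Y, (hRt 2 Y _).2 h⟩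
  have colR : ∀ Y, ∃ f ∈ Rt 1 Y, ∀ z ∈ Rt 0 Y, z ≤ f := by
    intro Y
    rcases (col Y).2 with h | h
    · exact ⟨_, mx 1 Y, (hRt 0 Y _).2 h⟩
    · exact ⟨_, my 1 Y, (hRt 0 Y _).2 h⟩
  have hne : ∀ X Y, X ≠ 1 → ∃ z ∈ Rt X Y, z ≠ b := by
    intro X Y hX
    by_contra hn
    push Not at hn
    have h1 := hn _ (mx X Y)
    have h2 := hn _ (my X Y)
    exact z2 Y X X 1 hX hX ((hzero X Y).1 (Or.inl h1)) (hdouble X Y (h1.trans h2.symm))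
  -- Indices 2, 0, 1 become `L`, `R`, `F`; the first letter refers to `X`, the second one to `Y`.
  refine twisted_order_contradiction (P := PosOn W W') (D := CommonArc W W') (b := b)
    (LL := Rt 2 2) (LR := Rt 2 0) (RL := Rt 0 2) (RR := Rt 0 0) (FL := Rt 1 2) (FR := Rt 1 0)
    (FF := Rt 1 1) (fun x hx y _ z hz => posOn_convex hW' hx hz) (dom _ _) (dom _ _) (dom _ _)
    (dom _ _) (dom _ _) (dom _ _) (dom _ _) (leb 2) (leb 0) (geb 2) (geb 0) (cross 1 0)
    (cross 2 1) (cross 0 2) (cross 2 0) (colL 2) (colR 2) (colL 0) (colR 0) ?_ ?_ ?_ ?_ ?_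
    (hne 2 2 (by decide)) (hne 2 0 (by decide)) (hne 0 2 (by decide)) (hne 0 0 (by decide))
  · obtain ⟨g, hg, h⟩ := colL 1
    exact ⟨g, hg, (h _ (mx 2 1)).trans (leb 1 _ (mx 2 1))⟩
  · obtain ⟨g, hg, h⟩ := colR 1
    exact ⟨g, hg, (geb 1 _ (mx 0 1)).trans (h _ (mx 0 1))⟩
  · obtain ⟨t1, t2, t3, t4⟩ := tw 1 1 1 2
    rcases (row 1).1 with h | h
    · exact ⟨_, mx 1 1, (hRt 1 2 _).2 ⟨t1 h.1, t2 h.2⟩⟩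
    · exact ⟨_, my 1 1, (hRt 1 2 _).2 ⟨t3 h.1, t4 h.2⟩⟩
  · obtain ⟨t1, t2, t3, t4⟩ := tw 1 0 1 1
    rcases (row 1).2 with h | h
    · exact ⟨_, mx 1 1, (hRt 1 0 _).2 ⟨t1 h.1, t3 h.2⟩⟩
    · exact ⟨_, my 1 1, (hRt 1 0 _).2 ⟨t2 h.1, t4 h.2⟩⟩
  · intro z1 h1 z2 h2 z3 h3
    simp only [Rt, mem_insert_iff, mem_singleton_iff] at h1 h2 h3
    rcases h1 with rfl | rfl <;> rcases h2 with rfl | rfl <;> rcases h3 with rfl | rfl <;> simp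

end TriTangent

/-! ### Counting incidences, and the forms of pairs of edges -/

namespace TriTangent

open Set

theorem InArc.br_mul_nonpos {u v z : ℝ × ℝ} (h : InArc u v z) : br u z * br v z ≤ 0 := by
  have key : ∀ z, InCone u v z → br u z * br v z ≤ 0 := by
    rintro z ⟨r, s, hr, hs, rfl⟩
    have : br u (r • u + s • v) * br v (r • u + s • v) = -(r * s * br u v ^ 2) := by
      simp [br]; ring
    rw [this]
    have := mul_nonneg (mul_nonneg hr hs) (sq_nonneg (br u v))
    linarith
  rcases h with h | h
  · exact key z h
  · have := key _ h
    rw [← neg_one_smul ℝ, br_smul_right, br_smul_right] at this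
    linarith

/-- A nonzero quadratic form with a root splits. -/
theorem exists_factor (M N : ℝ × ℝ →ₗ[ℝ] ℝ × ℝ) {u z₀ : ℝ × ℝ} (hu : u ≠ 0)
    (h : br (M u) (N u) = 0) (hz : br (M z₀) (N z₀) ≠ 0) :
    ∃ v : ℝ × ℝ, v ≠ 0 ∧ ∀ z, br (M z) (N z) = br z u * br z v := by
  have hD : u.1 ^ 2 + u.2 ^ 2 ≠ 0 := by
    intro h0
    apply hu
    ext
    · simpa using (by nlinarith [sq_nonneg u.1, sq_nonneg u.2] : u.1 ^ 2 = 0)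
    · simpa using (by nlinarith [sq_nonneg u.1, sq_nonneg u.2] : u.2 ^ 2 = 0)
  set u' : ℝ × ℝ := (-u.2, u.1)
  have hdec : ∀ z : ℝ × ℝ, (u.1 ^ 2 + u.2 ^ 2) • z = br z u' • u + br u z • u' := by
    intro z
    ext <;> simp [br, u'] <;> ring
  set b := br (M u) (N u') + br (M u') (N u)
  set Q := br (M u') (N u')
  have key : ∀ z, br (M z) (N z) =
      br z u * br z (((u.1 ^ 2 + u.2 ^ 2) ^ 2)⁻¹ • (Q • u - b • u')) := by
    intro z
    have h1 : br (M ((u.1 ^ 2 + u.2 ^ 2) • z)) (N ((u.1 ^ 2 + u.2 ^ 2) • z)) =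
        br u z * (br z u' * b + br u z * Q) := by
      rw [hdec, map_add, map_add, map_smul, map_smul, map_smul, map_smul]
      have : ∀ (x y : ℝ) (p q r s : ℝ × ℝ), br (x • p + y • q) (x • r + y • s) =
          x ^ 2 * br p r + y * (x * (br p s + br q r) + y * br q s) := by
        intro x y p q r s; simp [br]; ring
      rw [this, h]
      ring
    rw [map_smul, map_smul, br_smul_left, br_smul_right] at h1
    rw [br_smul_right, br_sub_right, br_smul_right, br_smul_right, br_anticomm z u]
    have h2 : br (M z) (N z) = ((u.1 ^ 2 + u.2 ^ 2) ^ 2)⁻¹ *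
        (br u z * (br z u' * b + br u z * Q)) := by
      rw [← h1]
      field_simp
    rw [h2]
    ring
  refine ⟨_, ?_, key⟩
  intro h0
  apply hz
  rw [key, h0]
  simp [br]

theorem exists_factor_of_two_roots (M N : ℝ × ℝ →ₗ[ℝ] ℝ × ℝ) {u v z₀ : ℝ × ℝ} (huv : br u v ≠ 0)
    (hu : br (M u) (N u) = 0) (hv : br (M v) (N v) = 0) (hz : br (M z₀) (N z₀) ≠ 0) :
    ∃ k : ℝ, k ≠ 0 ∧ ∀ z, br (M z) (N z) = k * (br z u * br z v) := by
  obtain ⟨v', hv', h⟩ := exists_factor M N (ne_zero_of_br_ne_left huv) hu hz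
  have h1 : br v v' = 0 := by
    have := h v
    rw [hv, br_anticomm v u] at this
    rcases mul_eq_zero.1 this.symm with h0 | h0
    · exact absurd (neg_eq_zero.1 h0) huv
    · exact h0
  obtain ⟨k, rfl⟩ := exists_smul_of_br_eq_zero (ne_zero_of_br_ne_right huv) h1
  refine ⟨k, fun h0 => hv' (by rw [h0, zero_smul]), fun z => ?_⟩
  rw [h, br_smul_right]
  ring

/-- Count incidences between lines and cells. There are at most two lines per cell and at least one
cell per line, so with one line fewer than twice the number of cells the total defect is at most 1:
either a single cell lacks a line, or a single line lies in two cells, or neither. -/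
theorem incidence_of_no_three {ι α : Type*} [Fintype ι] {G : ι → Set α} {R : Finset α}
    (hR : ∀ L ∈ R, ∃ i, L ∈ G i)
    (h3 : ∀ i, ∀ a ∈ G i, ∀ b ∈ G i, ∀ c ∈ G i, a = b ∨ a = c ∨ b = c)
    (hc : 2 * Fintype.card ι ≤ R.card + 1) :
    (∀ i, ∃ L ∈ R, L ∈ G i) ∧
    (∀ L ∈ R, ∀ L' ∈ R, ∀ i j i' j', i ≠ j → i' ≠ j' → L ∈ G i → L ∈ G j → L' ∈ G i' → L' ∈ G j' →
      L = L') ∧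
    ∀ i, (∃ L ∈ R, ∃ L' ∈ R, L ≠ L' ∧ L ∈ G i ∧ L' ∈ G i) ∨
      ((∀ j, j ≠ i → ∃ L ∈ R, ∃ L' ∈ R, L ≠ L' ∧ L ∈ G j ∧ L' ∈ G j) ∧
        ∀ L ∈ R, ∀ j j', L ∈ G j → L ∈ G j' → j = j') := by
  classical
  let c : ι → ℤ := fun i => (R.filter fun L => L ∈ G i).card
  let n : α → ℤ := fun L => (Finset.univ.filter fun i => L ∈ G i).card
  have hsum : ∑ L ∈ R, n L = ∑ i, c i := by
    have := Finset.sum_card_bipartiteAbove_eq_sum_card_bipartiteBelow (s := R)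
      (t := (Finset.univ : Finset ι)) (fun L i => L ∈ G i)
    simp only [n, c]
    exact_mod_cast this
  have hn : ∀ L ∈ R, 1 ≤ n L := by
    intro L hL
    obtain ⟨i, hi⟩ := hR L hL
    have : 0 < (Finset.univ.filter fun i => L ∈ G i).card :=
      Finset.card_pos.2 ⟨i, by simpa using hi⟩
    simp only [n]
    omega
  have hn2 : ∀ L, ∀ i j, i ≠ j → L ∈ G i → L ∈ G j → 2 ≤ n L := by
    intro L i j hij hi hj
    have : 1 < (Finset.univ.filter fun i => L ∈ G i).card :=
      Finset.one_lt_card.2 ⟨i, by simpa using hi, j, by simpa using hj, hij⟩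
    simp only [n]
    omega
  have hc2 : ∀ i, c i ≤ 2 := by
    intro i
    by_contra h
    have : 2 < (R.filter fun L => L ∈ G i).card := by simp only [c] at h; omega
    obtain ⟨x, hx, y, hy, z, hz, h1, h2, h4⟩ := Finset.two_lt_card.1 this
    simp only [Finset.mem_filter] at hx hy hz
    rcases h3 i x hx.2 y hy.2 z hz.2 with h | h | h
    · exact h1 h
    · exact h2 h
    · exact h4 h
  have hc1 : ∀ i, (¬ ∃ L ∈ R, ∃ L' ∈ R, L ≠ L' ∧ L ∈ G i ∧ L' ∈ G i) → c i ≤ 1 := by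
    intro i h
    by_contra h'
    have : 1 < (R.filter fun L => L ∈ G i).card := by simp only [c] at h'; omega
    obtain ⟨x, hx, y, hy, hxy⟩ := Finset.one_lt_card.1 this
    simp only [Finset.mem_filter] at hx hy
    exact h ⟨x, hx.1, y, hy.1, hxy, hx.2, hy.2⟩
  have lossC : ∀ s : Finset ι, ∑ i ∈ s, (2 - c i) ≤ ∑ i, (2 - c i) := fun s =>
    Finset.sum_le_sum_of_subset_of_nonneg (Finset.subset_univ s) fun i _ _ => by linarith [hc2 i]
  have lossN : ∀ s ⊆ R, ∑ L ∈ s, (n L - 1) ≤ ∑ L ∈ R, (n L - 1) := fun s hs =>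
    Finset.sum_le_sum_of_subset_of_nonneg hs fun L hL _ => by linarith [hn L hL]
  -- The defect consists of the missing lines of the cells and the superfluous cells of the lines.
  have htot : ∑ i, (2 - c i) + ∑ L ∈ R, (n L - 1) ≤ 1 := by
    rw [Finset.sum_sub_distrib, Finset.sum_sub_distrib, hsum]
    simp only [Finset.sum_const, Finset.card_univ, nsmul_eq_mul, mul_one]
    have : (2 * Fintype.card ι : ℤ) ≤ R.card + 1 := by exact_mod_cast hc
    linarith
  have hC0 := lossC ∅
  have hN0 := lossN ∅ (by simp)
  rw [Finset.sum_empty] at hC0 hN0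
  refine ⟨fun i => ?_, fun L hL L' hL' i j i' j' hij hij' h1 h2 h1' h2' => ?_, fun i => ?_⟩
  · by_contra h
    have h0 : c i = 0 := by
      simp only [c, Nat.cast_eq_zero, Finset.card_eq_zero]
      exact Finset.filter_eq_empty_iff.2 fun L hL hG => h ⟨L, hL, hG⟩
    have := lossC {i}
    rw [Finset.sum_singleton, h0] at this
    linarith
  · by_contra hne
    have := lossN {L, L'} (by
      intro x hx
      simp only [Finset.mem_insert, Finset.mem_singleton] at hx
      rcases hx with rfl | rfl <;> assumption)
    rw [Finset.sum_pair hne] at this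
    linarith [hn2 L i j hij h1 h2, hn2 L' i' j' hij' h1' h2']
  · by_cases hi : ∃ L ∈ R, ∃ L' ∈ R, L ≠ L' ∧ L ∈ G i ∧ L' ∈ G i
    · exact Or.inl hi
    refine Or.inr ⟨fun j hj => ?_, fun L hL j j' h1 h2 => ?_⟩
    · by_contra h
      have := lossC {j, i}
      rw [Finset.sum_pair hj] at this
      linarith [hc1 i hi, hc1 j h]
    · by_contra hne
      have h4 := lossC {i}
      have h5 := lossN {L} (by simpa using hL)
      rw [Finset.sum_singleton] at h4 h5
      linarith [hc1 i hi, hn2 L j j' hne h1 h2]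

/-- The lines meeting two segments and given edges of two triangles. -/
def Good (a b c d : E3) (p p' : Fin 3 → E3) (X Y : Fin 3) : Set Line3 :=
  {L | Meets L a b ∧ Meets L c d ∧ Meets L (p (X + 1)) (p (X + 2)) ∧
    Meets L (p' (Y + 1)) (p' (Y + 2))}

theorem mem_good_symm {a b c d : E3} {p p' : Fin 3 → E3} {X Y : Fin 3} {L : Line3} :
    L ∈ Good a b c d p' p Y X ↔ L ∈ Good a b c d p p' X Y := by
  simp only [Good, mem_ofPred_eq]
  constructor <;> rintro ⟨h1, h2, h3, h4⟩ <;> exact ⟨h1, h2, h4, h3⟩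

namespace Frame

variable {a b c d : E3} (F : Frame a b c d)

/-- A triangle in general position with respect to the base lines. -/
structure Spread (p : Fin 3 → E3) : Prop where
  ordered : Ordered fun m => F.W (p m)
  br_Y_ne : ∀ X, br (F.Y (p (X + 1))) (F.Y (p (X + 2))) ≠ 0
  affineIndependent : AffineIndependent ℝ p

/-- The projection through an edge. -/
noncomputable def edgeMap (p : Fin 3 → E3) (X : Fin 3) : ℝ × ℝ →ₗ[ℝ] ℝ × ℝ :=
  F.pj (p (X + 1)) (p (X + 2))

/-- The quadratic form whose roots are the common transversals of two edges and the base lines. -/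
noncomputable def form (p p' : Fin 3 → E3) (X Y : Fin 3) (z : ℝ × ℝ) : ℝ :=
  br (F.edgeMap p X z) (F.edgeMap p' Y z)

theorem form_symm (p p' : Fin 3 → E3) (X Y : Fin 3) (z : ℝ × ℝ) :
    F.form p' p Y X z = - F.form p p' X Y z := br_anticomm _ _

/-- The three edge maps of a triangle, weighted by the determinants of `z` with the opposite
vertices, add up to zero already as vectors. -/
theorem form_sum (p p' : Fin 3 → E3) (Y : Fin 3) (z : ℝ × ℝ) :
    br z (F.W (p 0)) * F.form p p' 0 Y z + br z (F.W (p 1)) * F.form p p' 1 Y z +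
      br z (F.W (p 2)) * F.form p p' 2 Y z = 0 := by
  simp only [form, edgeMap]
  generalize F.pj (p' (Y + 1)) (p' (Y + 2)) z = y
  change _ * br (F.pj (p 1) (p 2) z) y + _ * br (F.pj (p 2) (p 0) z) y +
    _ * br (F.pj (p 0) (p 1) z) y = 0
  simp only [pj_apply]
  simp [br]
  ring

variable {F} {p p' : Fin 3 → E3}

theorem Spread.br_ne (hp : F.Spread p) {m n : Fin 3} (h : m ≠ n) :
    br (F.W (p m)) (F.W (p n)) ≠ 0 := by
  have h01 := hp.ordered.h01.ne'
  have h12 := hp.ordered.h12.ne'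
  have h02 := hp.ordered.h02.ne'
  have sw : ∀ {u v : ℝ × ℝ}, br u v ≠ 0 → br v u ≠ 0 := fun {u v} h => by
    rw [br_anticomm]; exact neg_ne_zero.2 h
  fin_cases m <;> fin_cases n <;> first | exact absurd rfl h | assumption | exact sw ‹_›

theorem add_one_ne_add_two (X : Fin 3) : X + 1 ≠ X + 2 := by revert X; decide

theorem eq_add_of_ne {m X : Fin 3} (h : m ≠ X) : m = X + 1 ∨ m = X + 2 := by
  revert m X; decide

theorem edgeMap_vertex {m X : Fin 3} (h : m ≠ X) : F.edgeMap p X (F.W (p m)) =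
    br (F.W (p (X + 1))) (F.W (p (X + 2))) • F.Y (p m) := by
  rcases eq_add_of_ne h with rfl | rfl
  · exact F.pj_left _ _
  · exact F.pj_right _ _

theorem form_vertex {m X Y : Fin 3} (h : m ≠ X) : F.form p p' X Y (F.W (p m)) =
    br (F.W (p (X + 1))) (F.W (p (X + 2))) * br (F.Y (p m)) (F.edgeMap p' Y (F.W (p m))) := by
  rw [form, edgeMap_vertex h, br_smul_left]

/-- At a vertex both edges through it send the foot to a nonzero multiple of the same vector, so
their forms vanish there simultaneously. -/
theorem Spread.form_vertex_eq_zero (hp : F.Spread p) {m X X' Y : Fin 3} (h : m ≠ X) (h' : m ≠ X')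
    (h0 : F.form p p' X Y (F.W (p m)) = 0) : F.form p p' X' Y (F.W (p m)) = 0 := by
  rw [form_vertex h] at h0
  rw [form_vertex h', (mul_eq_zero.1 h0).resolve_left (hp.br_ne (add_one_ne_add_two X)), mul_zero]

variable (F p p') in
/-- A common transversal in normal form. -/
structure Param (X Y : Fin 3) (L : Line3) (w : ℝ × ℝ) : Prop where
  exists_eq : ∃ (y : ℝ × ℝ) (κ κ' : ℝ), y.1 + y.2 = 1 ∧ κ ≠ 0 ∧ κ' ≠ 0 ∧ L = join a b c d y w ∧
    F.edgeMap p X w = κ • y ∧ F.edgeMap p' Y w = κ' • y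
  sum_eq : w.1 + w.2 = 1
  inArc : InArc (F.W (p (X + 1))) (F.W (p (X + 2))) w
  inArc' : InArc (F.W (p' (Y + 1))) (F.W (p' (Y + 2))) w

theorem exists_param (hp : F.Spread p) (hp' : F.Spread p') {X Y : Fin 3} {L : Line3}
    (h : L ∈ Good a b c d p p' X Y) : ∃ w, F.Param p p' X Y L w := by
  obtain ⟨h1, h2, h3, h4⟩ := h
  obtain ⟨y, w, -, -, hy, -, -, hw, rfl⟩ := F.exists_eq_join h1 h2
  have hy0 : y.1 + y.2 ≠ 0 := by rw [hy]; exact one_ne_zero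
  have hw0 : w.1 + w.2 ≠ 0 := by rw [hw]; exact one_ne_zero
  obtain ⟨i1, κ, hκ, e1⟩ := F.of_meets_join (hp.br_ne (add_one_ne_add_two X)) (hp.br_Y_ne X) hy0
    hw0 h3
  obtain ⟨i2, κ', hκ', e2⟩ := F.of_meets_join (hp'.br_ne (add_one_ne_add_two Y)) (hp'.br_Y_ne Y)
    hy0 hw0 h4
  exact ⟨w, ⟨y, κ, κ', hy, hκ, hκ', rfl, e1, e2⟩, hw, i1, i2⟩

section Param

variable {X Y : Fin 3} {L L' : Line3} {w w' : ℝ × ℝ}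

theorem Param.symm (h : F.Param p p' X Y L w) : F.Param p' p Y X L w := by
  obtain ⟨y, κ, κ', h1, h2, h3, h4, h5, h6⟩ := h.exists_eq
  exact ⟨⟨y, κ', κ, h1, h3, h2, h4, h6, h5⟩, h.sum_eq, h.inArc', h.inArc⟩

theorem Param.ne_zero (h : F.Param p p' X Y L w) : w ≠ 0 := by
  rintro rfl
  have := h.sum_eq
  simp at this

theorem Param.form_eq_zero (h : F.Param p p' X Y L w) : F.form p p' X Y w = 0 := by
  obtain ⟨y, κ, κ', -, -, -, -, h5, h6⟩ := h.exists_eq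
  rw [form, h5, h6, br_smul_left, br_smul_right, br_self]
  ring

theorem Param.br_ne (h : F.Param p p' X Y L w) (h' : F.Param p p' X Y L' w') (hne : L ≠ L') :
    br w w' ≠ 0 := by
  intro h0
  obtain ⟨y, κ, -, h1, h2, -, h4, h5, -⟩ := h.exists_eq
  obtain ⟨y', ν, -, -, h2', -, h4', h5', -⟩ := h'.exists_eq
  apply hne
  rw [h4, h4']
  exact (F.join_eq_of_pj h1 h.sum_eq h'.sum_eq h2 h2' h5 h5' h0).symm

/-- If the foot is parallel to the coordinates of a vertex of the edge, the other foot is forced by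
the projectivity, and the line passes through this vertex. -/
theorem Param.vertex_mem (h : F.Param p p' X Y L w) (hp : F.Spread p) {m : Fin 3} (hm : m ≠ X)
    (h0 : br (F.W (p m)) w = 0) : p m ∈ L.1 := by
  obtain ⟨y, κ, -, h1, h2, -, rfl, h5, -⟩ := h.exists_eq
  have hy0 : y.1 + y.2 ≠ 0 := by rw [h1]; exact one_ne_zero
  have hw0 : w.1 + w.2 ≠ 0 := by rw [h.sum_eq]; exact one_ne_zero
  rw [F.mem_join hy0 hw0]
  obtain ⟨s, hs⟩ := exists_smul_of_br_eq_zero (u := w) h.ne_zero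
    (by rw [br_anticomm, h0, neg_zero] : br w (F.W (p m)) = 0)
  have e := edgeMap_vertex (F := F) (p := p) hm
  rw [hs, map_smul, h5] at e
  have hS := hp.br_ne (add_one_ne_add_two X)
  refine ⟨(br (F.W (p (X + 1))) (F.W (p (X + 2))))⁻¹ * (s * κ), s, ?_, hs⟩
  rw [mul_smul, mul_smul, e, smul_smul, inv_mul_cancel₀ hS, one_smul]

theorem Param.vertex_unique (h : F.Param p p' X Y L w) (hp : F.Spread p) {m n : Fin 3}
    (hm : p m ∈ L.1) (hn : p n ∈ L.1) : m = n := by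
  obtain ⟨y, κ, -, h1, h2, -, rfl, h5, -⟩ := h.exists_eq
  have hy0 : y.1 + y.2 ≠ 0 := by rw [h1]; exact one_ne_zero
  have hw0 : w.1 + w.2 ≠ 0 := by rw [h.sum_eq]; exact one_ne_zero
  rw [F.mem_join hy0 hw0] at hm hn
  obtain ⟨-, s, -, hs⟩ := hm
  obtain ⟨-, r, -, hr⟩ := hn
  by_contra hne
  apply hp.br_ne hne
  rw [hs, hr, br_smul_left, br_smul_right, br_self]
  ring

theorem meets_left_of_mem {u v : E3} (h : u ∈ L.1) : Meets L u v := ⟨u, left_mem_segment ℝ u v, h⟩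

theorem good_of_vertex_mem {m X' : Fin 3} (h : L ∈ Good a b c d p p' X Y) (hm : m ≠ X')
    (hL : p m ∈ L.1) : L ∈ Good a b c d p p' X' Y := by
  refine ⟨h.1, h.2.1, ?_, h.2.2.2⟩
  rcases eq_add_of_ne hm with rfl | rfl
  · exact meets_left_of_mem hL
  · exact (meets_left_of_mem hL).symm

/-- A root at a vertex forces one of two transversals to pass through the vertex. -/
theorem Param.exists_vertex_line (h : F.Param p p' X Y L w) (h' : F.Param p p' X Y L' w')
    (hp : F.Spread p) {k : ℝ} (hk : k ≠ 0)
    (hq : ∀ z, F.form p p' X Y z = k * (br z w * br z w')) {m : Fin 3} (hm : m ≠ X)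
    (h0 : F.form p p' X Y (F.W (p m)) = 0) : p m ∈ L.1 ∨ p m ∈ L'.1 := by
  rw [hq] at h0
  rcases mul_eq_zero.1 ((mul_eq_zero.1 h0).resolve_left hk) with h0 | h0
  · exact Or.inl (h.vertex_mem hp hm h0)
  · exact Or.inr (h'.vertex_mem hp hm h0)

end Param

/-- No three lines meet all four segments. -/
theorem good_no_three (hp : F.Spread p) (hp' : F.Spread p') {X Y : Fin 3}
    (hz : ∃ z, F.form p p' X Y z ≠ 0) : ∀ A ∈ Good a b c d p p' X Y,
    ∀ B ∈ Good a b c d p p' X Y, ∀ C ∈ Good a b c d p p' X Y, A = B ∨ A = C ∨ B = C := by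
  intro A hA B hB C hC
  obtain ⟨u, hu⟩ := exists_param hp hp' hA
  obtain ⟨v, hv⟩ := exists_param hp hp' hB
  obtain ⟨w, hw⟩ := exists_param hp hp' hC
  obtain ⟨z, hz⟩ := hz
  by_contra hne
  push Not at hne
  exact hz (bilinear_eq_zero_of_three (F.edgeMap p X) (F.edgeMap p' Y) (hu.br_ne hv hne.1)
    (hu.br_ne hw hne.2.1) (hv.br_ne hw hne.2.2) hu.form_eq_zero hv.form_eq_zero hw.form_eq_zero z)

/-- The roots of the three forms of a triangle: an even number of them lies outside the arcs. -/
theorem inArc_of_parity (hp : F.Spread p) {Y : Fin 3}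
    (h0 : ∀ X m, m ≠ X → F.form p p' X Y (F.W (p m)) ≠ 0) {X : Fin 3} {k : Fin 3 → ℝ}
    {u v : Fin 3 → ℝ × ℝ} (hq : ∀ X z, F.form p p' X Y z = k X * (br z (u X) * br z (v X)))
    (hu : ∀ X, InArc (F.W (p (X + 1))) (F.W (p (X + 2))) (u X))
    (hv : ∀ X', X' ≠ X → InArc (F.W (p (X' + 1))) (F.W (p (X' + 2))) (v X')) :
    InArc (F.W (p (X + 1))) (F.W (p (X + 2))) (v X) := by
  let E : Fin 3 → ℝ := fun X => F.form p p' X Y (F.W (p (X + 1))) * F.form p p' X Y (F.W (p (X + 2)))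
  have a1 : ∀ X : Fin 3, X + 1 ≠ X := by decide
  have a2 : ∀ X : Fin 3, X + 2 ≠ X := by decide
  have hE0 : ∀ X, E X ≠ 0 := fun X => mul_ne_zero (h0 _ _ (a1 X)) (h0 _ _ (a2 X))
  have hEq : ∀ X, E X = k X ^ 2 * ((br (F.W (p (X + 1))) (u X) * br (F.W (p (X + 2))) (u X)) *
      (br (F.W (p (X + 1))) (v X) * br (F.W (p (X + 2))) (v X))) := by
    intro X
    simp only [E, hq]
    ring
  have hpos : ∀ X', X' ≠ X → 0 < E X' := by
    intro X' hX'
    refine lt_of_le_of_ne ?_ (hE0 X').symm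
    rw [hEq]
    exact mul_nonneg (sq_nonneg _)
      (mul_nonneg_of_nonpos_of_nonpos (hu X').br_mul_nonpos (hv X' hX').br_mul_nonpos)
  -- Every vertex enters through two edges, so the product of all six values is a square. A form
  -- takes end values of opposite signs exactly when one of its two roots is inside the arc and the
  -- other outside, so this cannot happen for a single edge.
  have hprod : 0 ≤ E X * E (X + 1) * E (X + 2) := by
    have e11 : X + 1 + 1 = X + 2 := by generalize X = x; revert x; decide
    have e12 : X + 1 + 2 = X := by generalize X = x; revert x; decide
    have e21 : X + 2 + 1 = X := by generalize X = x; revert x; decide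
    have e22 : X + 2 + 2 = X + 1 := by generalize X = x; revert x; decide
    have n1 : X ≠ X + 1 := (a1 X).symm
    have n2 : X ≠ X + 2 := (a2 X).symm
    have n3 : X + 1 ≠ X + 2 := add_one_ne_add_two X
    simp only [E, e11, e12, e21, e22]
    rw [form_vertex (a1 X), form_vertex (a2 X), form_vertex n3.symm, form_vertex n1,
      form_vertex n2, form_vertex n3, e11, e12, e21, e22]
    set s₀ := br (F.W (p (X + 1))) (F.W (p (X + 2)))
    set s₁ := br (F.W (p (X + 2))) (F.W (p X))
    set s₂ := br (F.W (p X)) (F.W (p (X + 1)))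
    set c₀ := br (F.Y (p X)) (F.edgeMap p' Y (F.W (p X)))
    set c₁ := br (F.Y (p (X + 1))) (F.edgeMap p' Y (F.W (p (X + 1))))
    set c₂ := br (F.Y (p (X + 2))) (F.edgeMap p' Y (F.W (p (X + 2))))
    have : s₀ * c₁ * (s₀ * c₂) * (s₁ * c₂ * (s₁ * c₀)) * (s₂ * c₀ * (s₂ * c₁)) =
        (s₀ * s₁ * s₂ * c₀ * c₁ * c₂) ^ 2 := by ring
    rw [this]
    exact sq_nonneg _
  have h1 := mul_pos (hpos _ (a1 X)) (hpos _ (a2 X))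
  have hEX : 0 < E X := by
    refine lt_of_le_of_ne ?_ (hE0 X).symm
    rw [mul_assoc] at hprod
    exact nonneg_of_mul_nonneg_left hprod h1
  apply inArc_of_br_mul_nonpos (pointed_of_br_ne (hp.br_ne (add_one_ne_add_two X)))
  rw [hEq] at hEX
  have h2 := (hu X).br_mul_nonpos
  rw [br_anticomm (v X), br_anticomm (v X), neg_mul_neg]
  by_contra hn
  push Not at hn
  have h3 := mul_nonneg (sq_nonneg (k X)) (mul_nonneg (neg_nonneg.2 h2) hn.le)
  linarith

end Frame

end TriTangent

/-! ### At most sixteen transversals for nine cells -/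

namespace TriTangent

open Set

namespace Frame

variable {a b c d : E3} {F : Frame a b c d} {p p' : Fin 3 → E3}

/-- Among two transversals of a cell, one passes through a given vertex that is a root, and this
one belongs to a second cell of the same column. -/
theorem Param.exists_vertex_line_good {X Y : Fin 3} {L L' : Line3} {w w' : ℝ × ℝ}
    (h : F.Param p p' X Y L w) (h' : F.Param p p' X Y L' w') (hL : L ∈ Good a b c d p p' X Y)
    (hL' : L' ∈ Good a b c d p p' X Y) (hp : F.Spread p) {k : ℝ} (hk : k ≠ 0)
    (hq : ∀ z, F.form p p' X Y z = k * (br z w * br z w')) {m : Fin 3} (hm : m ≠ X)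
    (h0 : F.form p p' X Y (F.W (p m)) = 0) : ∃ M, (M = L ∨ M = L') ∧ p m ∈ M.1 ∧
      (∃ w, F.Param p p' X Y M w) ∧ M ∈ Good a b c d p p' X Y ∧
      ∃ X', X' ≠ X ∧ M ∈ Good a b c d p p' X' Y := by
  obtain ⟨X', hX', hm'⟩ : ∃ X', X' ≠ X ∧ m ≠ X' := by
    clear * - hm; revert m X; decide
  rcases h.exists_vertex_line h' hp hk hq hm h0 with h1 | h1
  · exact ⟨L, Or.inl rfl, h1, ⟨w, h⟩, hL, X', hX', good_of_vertex_mem hL hm' h1⟩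
  · exact ⟨L', Or.inr rfl, h1, ⟨w', h'⟩, hL', X', hX', good_of_vertex_mem hL' hm' h1⟩

/-- Two distinct transversals give a factorization of the form. -/
theorem exists_roots (hp : F.Spread p) (hp' : F.Spread p') {X Y : Fin 3}
    (hz : ∃ z, F.form p p' X Y z ≠ 0) {L L' : Line3} (hL : L ∈ Good a b c d p p' X Y)
    (hL' : L' ∈ Good a b c d p p' X Y) (hne : L ≠ L') : ∃ w w' : ℝ × ℝ, ∃ k : ℝ,
      F.Param p p' X Y L w ∧ F.Param p p' X Y L' w' ∧ br w w' ≠ 0 ∧ k ≠ 0 ∧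
      ∀ z, F.form p p' X Y z = k * (br z w * br z w') := by
  obtain ⟨w, hw⟩ := exists_param hp hp' hL
  obtain ⟨w', hw'⟩ := exists_param hp hp' hL'
  obtain ⟨z, hz⟩ := hz
  have hb := hw.br_ne hw' hne
  obtain ⟨k, hk, hq⟩ := exists_factor_of_two_roots (F.edgeMap p X) (F.edgeMap p' Y) hb
    hw.form_eq_zero hw'.form_eq_zero hz
  exact ⟨w, w', k, hw, hw', hb, hk, hq⟩

/-- All roots of the nine forms lie in the arcs, and there are few roots at vertices. -/
theorem false_of_roots (hp : F.Spread p) (hp' : F.Spread p') {k : Fin 3 → Fin 3 → ℝ}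
    {u v : Fin 3 → Fin 3 → ℝ × ℝ} (hk : ∀ X Y, k X Y ≠ 0)
    (hu0 : ∀ X Y, u X Y ≠ 0) (hv0 : ∀ X Y, v X Y ≠ 0)
    (hq : ∀ X Y z, F.form p p' X Y z = k X Y * (br z (u X Y) * br z (v X Y)))
    (hu : ∀ X Y, InArc (F.W (p (X + 1))) (F.W (p (X + 2))) (u X Y))
    (hv : ∀ X Y, InArc (F.W (p (X + 1))) (F.W (p (X + 2))) (v X Y))
    (hu' : ∀ X Y, InArc (F.W (p' (Y + 1))) (F.W (p' (Y + 2))) (u X Y))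
    (hv' : ∀ X Y, InArc (F.W (p' (Y + 1))) (F.W (p' (Y + 2))) (v X Y))
    (z1 : ∀ Y X X' m m', X ≠ m → X' ≠ m' → F.form p p' X Y (F.W (p m)) = 0 →
      F.form p p' X' Y (F.W (p m')) = 0 → m = m')
    (z2 : ∀ Y X m, X ≠ m → F.form p p' X Y (F.W (p m)) = 0 → ∀ X' Y', br (u X' Y') (v X' Y') ≠ 0)
    (z1' : ∀ X Y Y' m m', Y ≠ m → Y' ≠ m' → F.form p p' X Y (F.W (p' m)) = 0 →
      F.form p p' X Y' (F.W (p' m')) = 0 → m = m')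
    (z2' : ∀ X Y m, Y ≠ m → F.form p p' X Y (F.W (p' m)) = 0 →
      ∀ X' Y', br (u X' Y') (v X' Y') ≠ 0) : False := by
  refine nine_forms_contradiction hp.ordered hp'.ordered (fun Y z => F.form_sum p p' Y z)
    (fun X z => ?_) hk hu0 hv0 hq hu hv hu' hv' z1 (fun Y X X' m h _ h0 => z2 Y X m h h0 X' Y) z1'
    (fun X Y Y' m h _ h0 => z2' X Y m h h0 X Y')
  have := F.form_sum p' p X z
  simp only [F.form_symm p p'] at this
  linarith

/-- Two triangles and two segments have at most sixteen common transversals, unless there are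
infinitely many for some choice of edges. -/
theorem card_le_sixteen (hp : F.Spread p) (hp' : F.Spread p')
    (hz : ∀ X Y, ∃ z, F.form p p' X Y z ≠ 0) {R : Finset Line3}
    (hR : ∀ L ∈ R, ∃ X Y, L ∈ Good a b c d p p' X Y) : R.card ≤ 16 := by
  by_contra hcard
  -- Seventeen lines in nine cells with at most two each: the defect is at most 1.
  obtain ⟨hne, hdup, halt⟩ := incidence_of_no_three (ι := Fin 3 × Fin 3)
    (G := fun P => Good a b c d p p' P.1 P.2) (R := R)
    (fun L hL => by obtain ⟨X, Y, h⟩ := hR L hL; exact ⟨(X, Y), h⟩)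
    (fun P => good_no_three hp hp' (hz P.1 P.2)) (by simp; omega)
  have hz' : ∀ X Y, ∃ z, F.form p' p Y X z ≠ 0 := fun X Y => by
    obtain ⟨z, h⟩ := hz X Y
    exact ⟨z, by rw [form_symm]; exact neg_ne_zero.2 h⟩
  have flip : ∀ {X Y : Fin 3} {k : ℝ} {u v : ℝ × ℝ},
      (∀ z, F.form p p' X Y z = k * (br z u * br z v)) →
      ∀ z, F.form p' p Y X z = -k * (br z u * br z v) := fun h z => by
    rw [form_symm, h]; ring
  by_cases hall : ∀ P : Fin 3 × Fin 3, ∃ L ∈ R, ∃ L' ∈ R, L ≠ L' ∧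
      L ∈ Good a b c d p p' P.1 P.2 ∧ L' ∈ Good a b c d p p' P.1 P.2
  -- If each cell has two lines, all roots are feet of transversals and hence lie in the arcs. A
  -- root at a vertex belongs to a line of two cells; there is at most one such line, and it passes
  -- through at most one vertex of each triangle.
  · choose L hL L' hL' hLL hG hG' using hall
    choose u v k hu hv huv hk hq using fun X Y =>
      exists_roots hp hp' (hz X Y) (hG (X, Y)) (hG' (X, Y)) (hLL (X, Y))
    refine false_of_roots hp hp' hk (fun X Y => (hu X Y).ne_zero) (fun X Y => (hv X Y).ne_zero) hq
      (fun X Y => (hu X Y).inArc) (fun X Y => (hv X Y).inArc) (fun X Y => (hu X Y).inArc')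
      (fun X Y => (hv X Y).inArc') ?_ (fun _ _ _ _ _ X' Y' => huv X' Y') ?_
      (fun _ _ _ _ _ X' Y' => huv X' Y')
    · intro Y X X' m m' hm hm' h1 h2
      obtain ⟨M, hM, hpM, ⟨w, hw⟩, hMG, X₁, hX₁, hMG₁⟩ := (hu X Y).exists_vertex_line_good
        (hv X Y) (hG (X, Y)) (hG' (X, Y)) hp (hk X Y) (hq X Y) hm.symm h1
      obtain ⟨M', hM', hpM', -, hMG', X₂, hX₂, hMG₂⟩ := (hu X' Y).exists_vertex_line_good
        (hv X' Y) (hG (X', Y)) (hG' (X', Y)) hp (hk X' Y) (hq X' Y) hm'.symm h2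
      have e : M = M' := hdup M (by rcases hM with rfl | rfl; exacts [hL _, hL' _]) M'
        (by rcases hM' with rfl | rfl; exacts [hL _, hL' _]) (X, Y) (X₁, Y) (X', Y) (X₂, Y)
        (fun h => hX₁ (congrArg Prod.fst h).symm) (fun h => hX₂ (congrArg Prod.fst h).symm) hMG
        hMG₁ hMG' hMG₂
      subst e
      exact hw.vertex_unique hp hpM hpM'
    · intro X Y Y' m m' hm hm' h1 h2
      have h1' : F.form p' p Y X (F.W (p' m)) = 0 := by rw [form_symm, h1, neg_zero]
      have h2' : F.form p' p Y' X (F.W (p' m')) = 0 := by rw [form_symm, h2, neg_zero]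
      obtain ⟨M, hM, hpM, ⟨w, hw⟩, hMG, Y₁, hY₁, hMG₁⟩ := (hu X Y).symm.exists_vertex_line_good
        (hv X Y).symm (mem_good_symm.2 (hG (X, Y))) (mem_good_symm.2 (hG' (X, Y))) hp'
        (neg_ne_zero.2 (hk X Y)) (flip (hq X Y)) hm.symm h1'
      obtain ⟨M', hM', hpM', -, hMG', Y₂, hY₂, hMG₂⟩ := (hu X Y').symm.exists_vertex_line_good
        (hv X Y').symm (mem_good_symm.2 (hG (X, Y'))) (mem_good_symm.2 (hG' (X, Y'))) hp'
        (neg_ne_zero.2 (hk X Y')) (flip (hq X Y')) hm'.symm h2'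
      have e : M = M' := hdup M (by rcases hM with rfl | rfl; exacts [hL _, hL' _]) M'
        (by rcases hM' with rfl | rfl; exacts [hL _, hL' _]) (X, Y) (X, Y₁) (X, Y') (X, Y₂)
        (fun h => hY₁ (congrArg Prod.snd h).symm) (fun h => hY₂ (congrArg Prod.snd h).symm)
        (mem_good_symm.1 hMG) (mem_good_symm.1 hMG₁) (mem_good_symm.1 hMG') (mem_good_symm.1 hMG₂)
      subst e
      exact hw.vertex_unique hp' hpM hpM'
  · push Not at hall
    obtain ⟨⟨X₀, Y₀⟩, h₀⟩ := hall
    obtain ⟨hoth, hdis⟩ := (halt (X₀, Y₀)).resolve_left (by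
      rintro ⟨L, hL, L', hL', h1, h2, h3⟩
      exact h₀ L hL L' hL' h1 h2 h3)
    -- The defect is used up by the cell `(X₀, Y₀)`, so no line lies in two cells and no form has a
    -- root at a vertex. For the exceptional cell the zero is carried over to the neighbouring edge
    -- at the same vertex.
    have noV : ∀ X Y m, m ≠ X → F.form p p' X Y (F.W (p m)) ≠ 0 := by
      have main : ∀ X Y m, m ≠ X → (X, Y) ≠ (X₀, Y₀) → F.form p p' X Y (F.W (p m)) ≠ 0 := by
        intro X Y m hm hXY h
        obtain ⟨L, hL, L', hL', hLL, hG, hG'⟩ := hoth (X, Y) hXY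
        obtain ⟨u, v, k, hu, hv, -, hk, hq⟩ := exists_roots hp hp' (hz X Y) hG hG' hLL
        obtain ⟨M, hM, -, -, hMG, X₁, hX₁, hMG₁⟩ := hu.exists_vertex_line_good hv hG hG' hp hk hq
          hm h
        have := hdis M (by rcases hM with rfl | rfl <;> assumption) (X, Y) (X₁, Y) hMG hMG₁
        exact hX₁ (congrArg Prod.fst this).symm
      intro X Y m hm h
      by_cases hXY : (X, Y) = (X₀, Y₀)
      · obtain ⟨X', hX', hm'⟩ : ∃ X', X' ≠ X ∧ m ≠ X' := by
          clear * - hm; revert m X; decide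
        refine main X' Y m hm' (fun h' => ?_) (hp.form_vertex_eq_zero hm hm' h)
        exact hX' ((congrArg Prod.fst h').trans (congrArg Prod.fst hXY).symm)
      · exact main X Y m hm hXY h
    have noV' : ∀ Y X m, m ≠ Y → F.form p' p Y X (F.W (p' m)) ≠ 0 := by
      have main : ∀ X Y m, m ≠ Y → (X, Y) ≠ (X₀, Y₀) → F.form p' p Y X (F.W (p' m)) ≠ 0 := by
        intro X Y m hm hXY h
        obtain ⟨L, hL, L', hL', hLL, hG, hG'⟩ := hoth (X, Y) hXY
        obtain ⟨u, v, k, hu, hv, -, hk, hq⟩ := exists_roots hp hp' (hz X Y) hG hG' hLL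
        obtain ⟨M, hM, -, -, hMG, Y₁, hY₁, hMG₁⟩ := hu.symm.exists_vertex_line_good hv.symm
          (mem_good_symm.2 hG) (mem_good_symm.2 hG') hp' (neg_ne_zero.2 hk) (flip hq) hm h
        have := hdis M (by rcases hM with rfl | rfl <;> assumption) (X, Y) (X, Y₁)
          (mem_good_symm.1 hMG) (mem_good_symm.1 hMG₁)
        exact hY₁ (congrArg Prod.snd this).symm
      intro Y X m hm h
      by_cases hXY : (X, Y) = (X₀, Y₀)
      · obtain ⟨Y', hY', hm'⟩ : ∃ Y', Y' ≠ Y ∧ m ≠ Y' := by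
          clear * - hm; revert m Y; decide
        refine main X Y' m hm' (fun h' => ?_) (hp'.form_vertex_eq_zero hm hm' h)
        exact hY' ((congrArg Prod.snd h').trans (congrArg Prod.snd hXY).symm)
      · exact main X Y m hm hXY h
    have hroots : ∀ X Y, ∃ (k : ℝ) (u v : ℝ × ℝ), k ≠ 0 ∧ u ≠ 0 ∧ v ≠ 0 ∧
        (∀ z, F.form p p' X Y z = k * (br z u * br z v)) ∧
        InArc (F.W (p (X + 1))) (F.W (p (X + 2))) u ∧
        InArc (F.W (p' (Y + 1))) (F.W (p' (Y + 2))) u ∧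
        ((X, Y) ≠ (X₀, Y₀) → InArc (F.W (p (X + 1))) (F.W (p (X + 2))) v ∧
          InArc (F.W (p' (Y + 1))) (F.W (p' (Y + 2))) v) := by
      intro X Y
      by_cases hXY : (X, Y) = (X₀, Y₀)
      · obtain ⟨L, hL, hG⟩ := hne (X, Y)
        obtain ⟨u, hu⟩ := exists_param hp hp' hG
        obtain ⟨z, hz⟩ := hz X Y
        obtain ⟨v, hv, hq⟩ := exists_factor (F.edgeMap p X) (F.edgeMap p' Y) hu.ne_zero
          hu.form_eq_zero hz
        exact ⟨1, u, v, one_ne_zero, hu.ne_zero, hv, fun z => by rw [one_mul]; exact hq z,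
          hu.inArc, hu.inArc', fun h => absurd hXY h⟩
      · obtain ⟨L, hL, L', hL', hLL, hG, hG'⟩ := hoth (X, Y) hXY
        obtain ⟨u, v, k, hu, hv, -, hk, hq⟩ := exists_roots hp hp' (hz X Y) hG hG' hLL
        exact ⟨k, u, v, hk, hu.ne_zero, hv.ne_zero, hq, hu.inArc, hu.inArc',
          fun _ => ⟨hv.inArc, hv.inArc'⟩⟩
    choose k u v hk hu0 hv0 hq hu hu' hv using hroots
    -- The second root of the exceptional form is not known to come from a transversal; parity
    -- places it in the arc.
    have hvA : ∀ X Y, InArc (F.W (p (X + 1))) (F.W (p (X + 2))) (v X Y) := by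
      intro X Y
      by_cases hXY : (X, Y) = (X₀, Y₀)
      · exact inArc_of_parity hp (fun X m hm => noV X Y m hm) (hq · Y) (hu · Y)
          (fun X' hX' => (hv X' Y fun h => hX' ((congrArg Prod.fst h).trans
            (congrArg Prod.fst hXY).symm)).1)
      · exact (hv X Y hXY).1
    have hvA' : ∀ X Y, InArc (F.W (p' (Y + 1))) (F.W (p' (Y + 2))) (v X Y) := by
      intro X Y
      by_cases hXY : (X, Y) = (X₀, Y₀)
      · exact inArc_of_parity hp' (fun Y m hm => noV' Y X m hm) (fun Y => flip (hq X Y)) (hu' X ·)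
          (fun Y' hY' => (hv X Y' fun h => hY' ((congrArg Prod.snd h).trans
            (congrArg Prod.snd hXY).symm)).2)
      · exact (hv X Y hXY).2
    have noV'' : ∀ X Y m, Y ≠ m → F.form p p' X Y (F.W (p' m)) ≠ 0 := fun X Y m hm h =>
      noV' Y X m hm.symm (by rw [form_symm, h, neg_zero])
    exact false_of_roots hp hp' hk hu0 hv0 hq hu hvA hu' hvA'
      (fun Y X X' m m' hm _ h _ => absurd h (noV X Y m hm.symm))
      (fun Y X m hm h => absurd h (noV X Y m hm.symm))
      (fun X Y Y' m m' hm _ h _ => absurd h (noV'' X Y m hm))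
      (fun X Y m hm h => absurd h (noV'' X Y m hm))

/-- The forms of two edges of a triangle do not both vanish. -/
theorem Spread.exists_form_ne_zero (hp : F.Spread p) (hp' : F.Spread p') {X X' Y : Fin 3}
    (hX : X ≠ X') (h : ∀ z, F.form p p' X Y z = 0) : ∃ z, F.form p p' X' Y z ≠ 0 := by
  have key : ∀ X : Fin 3, (∀ z, F.form p p' X Y z = 0) → (∀ z, F.form p p' (X + 1) Y z = 0) →
      False := by
    intro X h h'
    have inj : ∀ {p : Fin 3 → E3}, F.Spread p → ∀ X, Function.Injective (F.edgeMap p X) :=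
      fun hp X => F.pj_injective (hp.br_ne (add_one_ne_add_two X)) (hp.br_Y_ne X)
    -- Both edge maps are proportional to that of the other triangle, hence to each other: the two
    -- edges would lie on one regulus although they share a vertex.
    obtain ⟨κ, hκ, h1⟩ := exists_smul_of_forall_parallel (inj hp' Y) (inj hp X) fun z => by
      rw [br_anticomm]; exact neg_eq_zero.2 (h z)
    obtain ⟨ν, hν, h2⟩ := exists_smul_of_forall_parallel (inj hp' Y) (inj hp (X + 1)) fun z => by
      rw [br_anticomm]; exact neg_eq_zero.2 (h' z)
    have e1 : X + 1 + 1 = X + 2 := by clear * -; revert X; decide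
    have e2 : X + 1 + 2 = X := by clear * -; revert X; decide
    have n1 : X ≠ X + 1 := by clear * -; revert X; decide
    have n2 : X ≠ X + 2 := by clear * -; revert X; decide
    have n3 : X + 1 ≠ X + 2 := add_one_ne_add_two X
    have h3 : ∀ z, ν • F.pj (p (X + 1)) (p (X + 2)) z = κ • F.pj (p (X + 2)) (p X) z := by
      intro z
      have a1 := h1 z
      have a2 := h2 z
      rw [edgeMap] at a1 a2
      rw [e1, e2] at a2
      rw [a1, a2, smul_smul, smul_smul, mul_comm]
    have hY2 : F.Y (p (X + 2)) ≠ 0 := ne_zero_of_br_ne_right (hp.br_Y_ne X)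
    set s₀ := br (F.W (p (X + 1))) (F.W (p (X + 2))) with hs₀
    set s₁ := br (F.W (p (X + 2))) (F.W (p X)) with hs₁
    set s₂ := br (F.W (p X)) (F.W (p (X + 1))) with hs₂
    have hs₁0 : s₁ ≠ 0 := hp.br_ne n2.symm
    have hκs : ν * s₀ = κ * s₁ := by
      have := h3 (F.W (p (X + 2)))
      rw [F.pj_right, F.pj_left, smul_smul, smul_smul] at this
      exact smul_left_injective ℝ hY2 this
    have hs₀0 : s₀ ≠ 0 := hp.br_ne n3
    have hYsum : s₀ • F.Y (p X) + s₁ • F.Y (p (X + 1)) + s₂ • F.Y (p (X + 2)) = 0 := by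
      have := h3 (F.W (p (X + 1)))
      rw [F.pj_left, F.pj_apply, br_anticomm (F.W (p (X + 1))) (F.W (p X)), ← hs₂,
        br_anticomm (F.W (p (X + 2))), ← hs₀] at this
      have h4 : (ν * s₀) • (s₀ • F.Y (p X) + s₁ • F.Y (p (X + 1)) + s₂ • F.Y (p (X + 2))) = 0 := by
        have h5 : (ν * s₀) • (s₁ • F.Y (p (X + 1))) = s₁ • (ν • s₀ • F.Y (p (X + 1))) := by module
        rw [smul_add, smul_add, h5, this, hκs]
        module
      exact (smul_eq_zero.1 h4).resolve_left (mul_ne_zero hν hs₀0)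
    have hWsum : s₀ • F.W (p X) + s₁ • F.W (p (X + 1)) + s₂ • F.W (p (X + 2)) = 0 := by
      ext <;> simp [hs₀, hs₁, hs₂, br] <;> ring
    have hsum : s₀ + s₁ + s₂ = 0 := by
      have b1 := congrArg Prod.fst hYsum
      have b2 := congrArg Prod.snd hYsum
      have b3 := congrArg Prod.fst hWsum
      have b4 := congrArg Prod.snd hWsum
      simp only [Prod.fst_add, Prod.snd_add, Prod.smul_fst, Prod.smul_snd, smul_eq_mul,
        Prod.fst_zero, Prod.snd_zero] at b1 b2 b3 b4
      linear_combination b1 + b2 + b3 + b4 - s₀ * F.sum (p X) - s₁ * F.sum (p (X + 1)) -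
        s₂ * F.sum (p (X + 2))
    have hpt : s₀ • p X + s₁ • p (X + 1) + s₂ • p (X + 2) = 0 := by
      rw [F.comb (p X), F.comb (p (X + 1)), F.comb (p (X + 2))]
      have b1 := congrArg Prod.fst hYsum
      have b2 := congrArg Prod.snd hYsum
      have b3 := congrArg Prod.fst hWsum
      have b4 := congrArg Prod.snd hWsum
      simp only [Prod.fst_add, Prod.snd_add, Prod.smul_fst, Prod.smul_snd, smul_eq_mul,
        Prod.fst_zero, Prod.snd_zero] at b1 b2 b3 b4
      match_scalars <;> linarith
    -- The relation of the `F.W` parts now holds for the `F.Y` parts as well, so it is an affine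
    -- dependence of the three vertices.
    have haff := (affineIndependent_iff.1 hp.affineIndependent) {X, X + 1, X + 2}
      (fun m => if m = X then s₀ else if m = X + 1 then s₁ else s₂)
    rw [Finset.sum_insert (by simp [n1, n2]), Finset.sum_pair n3, Finset.sum_insert
      (by simp [n1, n2]), Finset.sum_pair n3] at haff
    simp only [n1.symm, n2.symm, n3.symm, if_true, if_false] at haff
    have := haff (by linarith) (by rw [← add_assoc]; exact hpt) X (by simp)
    simp only [if_true] at this
    exact hs₀0 this
  by_contra hn
  push Not at hn
  have : X' = X + 1 ∨ X = X' + 1 := by clear * - hX; revert X X'; decide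
  rcases this with rfl | rfl
  · exact key X h hn
  · exact key X' hn h

end Frame

end TriTangent

/-! ### The nine cells of two triangles and the final count -/

namespace TriTangent

open Set

/-- The determinants are the coefficients of the linear relation `id1`. If all have one sign, the
relation is positive, which is excluded; in the six other sign patterns the vectors lie in a half
plane and can be listed counterclockwise. -/
theorem exists_perm_ordered {w : Fin 3 → ℝ × ℝ} (h01 : br (w 0) (w 1) ≠ 0)
    (h12 : br (w 1) (w 2) ≠ 0) (h20 : br (w 2) (w 0) ≠ 0)
    (h : ∀ r s u : ℝ, 0 < r → 0 < s → 0 < u → r • w 0 + s • w 1 + u • w 2 ≠ 0) :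
    ∃ σ : Equiv.Perm (Fin 3), Ordered (w ∘ σ) := by
  have id1 : br (w 1) (w 2) • w 0 + br (w 2) (w 0) • w 1 + br (w 0) (w 1) • w 2 = 0 := by
    ext <;> simp [br] <;> ring
  have s01 := br_anticomm (w 1) (w 0)
  have s12 := br_anticomm (w 2) (w 1)
  have s20 := br_anticomm (w 0) (w 2)
  rcases h01.lt_or_gt with a | a <;> rcases h12.lt_or_gt with b | b <;>
    rcases h20.lt_or_gt with c | c
  · exfalso
    apply h _ _ _ (neg_pos.2 b) (neg_pos.2 c) (neg_pos.2 a)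
    rw [neg_smul, neg_smul, neg_smul, ← neg_add, ← neg_add, id1, neg_zero]
  · refine ⟨Equiv.swap 0 2, ?_⟩
    constructor <;> change 0 < br (w _) (w _)
    · change 0 < br (w 2) (w 1); linarith
    · change 0 < br (w 1) (w 0); linarith
    · change 0 < br (w 2) (w 0); linarith
  · refine ⟨Equiv.swap 0 1, ?_⟩
    constructor
    · change 0 < br (w 1) (w 0); linarith
    · change 0 < br (w 0) (w 2); linarith
    · change 0 < br (w 1) (w 2); linarith
  · refine ⟨Equiv.addRight 1, ?_⟩
    constructor
    · change 0 < br (w 1) (w 2); linarith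
    · change 0 < br (w 2) (w 0); linarith
    · change 0 < br (w 1) (w 0); linarith
  · refine ⟨Equiv.swap 1 2, ?_⟩
    constructor
    · change 0 < br (w 0) (w 2); linarith
    · change 0 < br (w 2) (w 1); linarith
    · change 0 < br (w 0) (w 1); linarith
  · refine ⟨Equiv.addRight 2, ?_⟩
    constructor
    · change 0 < br (w 2) (w 0); linarith
    · change 0 < br (w 0) (w 1); linarith
    · change 0 < br (w 2) (w 1); linarith
  · refine ⟨Equiv.refl _, ?_⟩
    constructor
    · exact a
    · exact b
    · change 0 < br (w 0) (w 2); linarith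
  · exact absurd id1 (h _ _ _ b c a)

variable {t : Fin 4 → Affine.Triangle ℝ E3}

/-- Since no edges are coplanar, all determinants are nonzero; the missed triangle provides the half
plane. -/
theorem exists_spread (hc : ∀ (e : Fin 4 → Fin 3) (i j : Fin 4), i ≠ j → ¬ CopAt t e i j)
    {i j l : Fin 4} (hij : i ≠ j) (hjl : j ≠ l) {m n : Fin 3}
    (F : Frame ((t i).points (m + 1)) ((t i).points (m + 2)) ((t l).points (n + 1))
      ((t l).points (n + 2))) (hit : ¬ Hit t i m j) :
    ∃ σ : Equiv.Perm (Fin 3), F.Spread ((t j).points ∘ σ) := by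
  have cop : ∀ (q : Fin 4) (r u v : Fin 3), q ≠ j → u ≠ v →
      ¬ Cop ((t j).points u) ((t j).points v) ((t q).points (r + 1)) ((t q).points (r + 2)) := by
    intro q r u v hq huv h
    have : ∃ s : Fin 3, (u = s + 1 ∧ v = s + 2) ∨ (v = s + 1 ∧ u = s + 2) := by
      clear * - huv; revert u v; decide
    obtain ⟨s, hs⟩ := this
    apply hc (Function.update (fun _ => r) j s) j q hq.symm
    simp only [CopAt, cellA, cellB, Function.update_self, Function.update_of_ne hq]
    rcases hs with ⟨rfl, rfl⟩ | ⟨rfl, rfl⟩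
    · exact h
    · obtain ⟨f, hf, κ, h1, h2, h3, h4⟩ := h
      exact ⟨f, hf, κ, h2, h1, h3, h4⟩
  have hW : ∀ u v, u ≠ v → br (F.W ((t j).points u)) (F.W ((t j).points v)) ≠ 0 :=
    fun u v huv h => cop i m u v hij huv (F.cop_left_of_br_eq_zero h)
  have hY : ∀ u v, u ≠ v → br (F.Y ((t j).points u)) (F.Y ((t j).points v)) ≠ 0 :=
    fun u v huv h => cop l n u v hjl.symm huv (F.cop_right_of_br_eq_zero h)
  obtain ⟨σ, hσ⟩ := exists_perm_ordered (w := fun u => F.W ((t j).points u)) (hW 0 1 (by decide))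
    (hW 1 2 (by decide)) (hW 2 0 (by decide)) (by
      -- A positive relation would give a point of the triangle with vanishing `F.W`, that is, a
      -- point on the line of the chosen edge of `i`.
      intro r s u hr hs hu h0
      apply hit
      have hpos : 0 < r + s + u := by linarith
      have hmem : ∀ v, (t j).points v ∈ triangleSet (t j) := fun v =>
        subset_convexHull ℝ _ (mem_range_self v)
      set x := (r / (r + s + u)) • (t j).points 0 + ((s + u) / (r + s + u)) •
        ((s / (s + u)) • (t j).points 1 + (u / (s + u)) • (t j).points 2) with hx
      have e1 : r / (r + s + u) + (s + u) / (r + s + u) = 1 := by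
        rw [← add_div, div_eq_one_iff_eq hpos.ne']; ring
      have e2 : s / (s + u) + u / (s + u) = 1 := by
        rw [← add_div, div_eq_one_iff_eq (by linarith)]
      have hconv := convex_convexHull ℝ (range (t j).points)
      have hxm : x ∈ triangleSet (t j) := hconv (hmem 0) (hconv (hmem 1) (hmem 2) (by positivity)
        (by positivity) e2) (by positivity) (by positivity) e1
      have hWx : F.W x = 0 := by
        have hsu : s + u ≠ 0 := by linarith
        have h1 : F.W x = (r + s + u)⁻¹ • (r • F.W ((t j).points 0) + s • F.W ((t j).points 1) +
            u • F.W ((t j).points 2)) := by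
          rw [hx, Frame.affine_comb _ e1, Frame.affine_comb _ e2]
          match_scalars <;> field_simp
        rw [h1, h0, smul_zero]
      refine ⟨x, hxm, (F.Y x).2, ?_⟩
      have h1 := F.sum x
      have h2 := F.comb x
      rw [hWx] at h1 h2
      simp only [Prod.fst_zero, Prod.snd_zero, add_zero, zero_smul] at h1 h2
      rw [← h1, add_sub_cancel_right]
      exact h2)
  exact ⟨σ, hσ, fun X => hY _ _ fun h => Frame.add_one_ne_add_two X (σ.injective h),
    (t j).independent.comp_embedding σ.toEmbedding⟩

/-- If there are two transversals, their feet are the roots of the form, so the root at the vertex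
makes one of them pass through the vertex: 1 + 1/2. -/
theorem cellBound_of_vertex_root {e : Fin 4 → Fin 3} {a b c d : E3} {F : Frame a b c d}
    {p p' : Fin 3 → E3} (hp : F.Spread p) (hp' : F.Spread p') {X Y : Fin 3} {j : Fin 4}
    (hmem : ∀ L, L ∈ cell t e ↔ L ∈ Good a b c d p p' X Y)
    (hend : ∀ L m, m ≠ X → p m ∈ L.1 → ThroughEnd t e j L) (hz : ∃ z, F.form p p' X Y z ≠ 0)
    {m : Fin 3} (hm : m ≠ X) (h0 : F.form p p' X Y (F.W (p m)) = 0) : CellBound t e (3 / 2) := by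
  classical
  obtain ⟨R, hR2, hR, hcov⟩ := exists_finset_of_no_three (Frame.good_no_three hp hp' hz)
  have hcov' : ∀ L ∈ cell t e, ∃ M ∈ R, JoinedIn (commonTangents t) L M := fun L hL =>
    ⟨L, hcov L ((hmem L).1 hL), JoinedIn.refl (cell_subset hL)⟩
  by_cases h : ∃ L ∈ R, ∃ L' ∈ R, L ≠ L'
  · obtain ⟨L, hL, L', hL', hne⟩ := h
    obtain ⟨w, w', k, hw, hw', -, hk, hq⟩ := Frame.exists_roots hp hp' hz (hR L hL) (hR L' hL') hne
    have hRe : R = {L, L'} := by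
      symm
      apply Finset.eq_of_subset_of_card_le
      · intro x hx
        simp only [Finset.mem_insert, Finset.mem_singleton] at hx
        rcases hx with rfl | rfl <;> assumption
      · rw [Finset.card_pair hne]; exact hR2
    refine ⟨R, fun M hM => (hmem M).2 (hR M hM), hcov', ?_⟩
    rw [hRe, Finset.sum_pair hne]
    have one : ∀ M ∈ R, (1 / mult t M : ℚ) ≤ 1 := fun M hM => by
      have : (1 : ℚ) ≤ mult t M := by exact_mod_cast one_le_mult ((hmem M).2 (hR M hM))
      exact div_le_one_of_le₀ this (by linarith)
    have half : ∀ M ∈ R, p m ∈ M.1 → (1 / mult t M : ℚ) ≤ 1 / 2 := fun M hM hpM => by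
      have : (2 : ℚ) ≤ mult t M := by
        exact_mod_cast two_le_mult ((hmem M).2 (hR M hM)) (hend M m hm hpM)
      exact one_div_le_one_div_of_le two_pos this
    rcases hw.exists_vertex_line hw' hp hk hq hm h0 with h1 | h1
    · linarith [half L hL h1, one L' hL']
    · linarith [one L hL, half L' hL' h1]
  · push Not at h
    have := cellBound_of_representatives (n := 1) (m := 1) one_pos
      (Finset.card_le_one.2 h) (fun L hL => ⟨(hmem L).2 (hR L hL), one_le_mult
        ((hmem L).2 (hR L hL))⟩) hcov'
    exact this.mono (by norm_num)

/-- A line occurs in at most `mult` of the sets, so it contributes at most 1 altogether. Lines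
shared between cells are thus counted once, and a bound on the number of lines suffices. -/
theorem sum_sum_inv_mult_le {ι : Type*} [Fintype ι] [DecidableEq Line3] {E : ι → Fin 4 → Fin 3}
    (hE : Function.Injective E) {T : ι → Finset Line3} (hT : ∀ i, ∀ L ∈ T i, L ∈ cell t (E i)) :
    ∑ i, ∑ L ∈ T i, (1 / mult t L : ℚ) ≤ (Finset.univ.biUnion T).card := by
  classical
  rw [Finset.sum_comm' (t' := Finset.univ.biUnion T)
    (s' := fun L => Finset.univ.filter fun i => L ∈ T i) (by
      intro i L
      simp only [Finset.mem_univ, true_and, Finset.mem_filter, Finset.mem_biUnion]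
      exact ⟨fun h => ⟨h, i, h⟩, fun h => h.1⟩)]
  have : ∀ L ∈ Finset.univ.biUnion T,
      ∑ _i ∈ Finset.univ.filter fun i => L ∈ T i, (1 / mult t L : ℚ) ≤ 1 := by
    intro L _
    rw [Finset.sum_const, nsmul_eq_mul, mul_one_div]
    apply div_le_one_of_le₀ _ (Nat.cast_nonneg _)
    rw [mult]
    norm_cast
    refine Finset.card_le_card_of_injOn E (fun i hi => ?_) hE.injOn
    simp only [Finset.coe_filter, Finset.mem_univ, true_and, mem_ofPred_eq] at hi ⊢
    exact hT i L hi
  refine (Finset.sum_le_sum this).trans ?_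
  simp

/-- The nine cells of two triangles that miss a base line. -/
theorem exists_nine_cellBounds
    (hc : ∀ (e : Fin 4 → Fin 3) (i j : Fin 4), i ≠ j → ¬ CopAt t e i j) {i j k l : Fin 4}
    (hij : i ≠ j) (hik : i ≠ k) (hil : i ≠ l) (hjk : j ≠ k) (hjl : j ≠ l) (hkl : k ≠ l)
    (e : Fin 4 → Fin 3) (hj : ¬ Hit t i (e i) j) (hk : ¬ Hit t i (e i) k) :
    ∃ β : Fin 3 → Fin 3 → ℚ,
      (∀ X Y, CellBound t (Function.update (Function.update e j X) k Y) (β X Y)) ∧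
      ∑ X, ∑ Y, β X Y ≤ 16 := by
  classical
  have hex : ∀ q, q = i ∨ q = j ∨ q = k ∨ q = l := by
    clear * - hij hik hil hjk hjl hkl; revert i j k l; decide
  obtain ⟨F⟩ := Frame.exists_of_not_cop (hc e i l hil)
  change Frame ((t i).points (e i + 1)) ((t i).points (e i + 2)) ((t l).points (e l + 1))
    ((t l).points (e l + 2)) at F
  obtain ⟨σ, hp⟩ := exists_spread hc hij hjl F hj
  obtain ⟨τ, hp'⟩ := exists_spread hc hik hkl F hk
  set p := (t j).points ∘ σ
  set p' := (t k).points ∘ τ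
  let E : Fin 3 × Fin 3 → Fin 4 → Fin 3 := fun P =>
    Function.update (Function.update e j (σ P.1)) k (τ P.2)
  have Ei : ∀ P, E P i = e i := fun P => by
    simp only [E]; rw [Function.update_of_ne hik, Function.update_of_ne hij]
  have El : ∀ P, E P l = e l := fun P => by
    simp only [E]; rw [Function.update_of_ne hkl.symm, Function.update_of_ne hjl.symm]
  have Ej : ∀ P, E P j = σ P.1 := fun P => by
    simp only [E]; rw [Function.update_of_ne hjk, Function.update_self]
  have Ek : ∀ P, E P k = τ P.2 := fun P => by simp only [E]; rw [Function.update_self]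
  have hE : Function.Injective E := by
    intro P Q h
    have h1 := congrFun h j
    have h2 := congrFun h k
    rw [Ej, Ej] at h1
    rw [Ek, Ek] at h2
    exact Prod.ext (σ.injective h1) (τ.injective h2)
  -- A relabelling maps the edge opposite to `X` to the edge opposite to `σ X`, possibly reversed.
  have perm : ∀ (σ : Equiv.Perm (Fin 3)) X, (σ (X + 1) = σ X + 1 ∧ σ (X + 2) = σ X + 2) ∨
      (σ (X + 1) = σ X + 2 ∧ σ (X + 2) = σ X + 1) := by
    intro σ X
    have n1 : σ X ≠ σ (X + 1) := fun h => by
      have := σ.injective h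
      clear * - this; revert X; decide
    have n2 : σ X ≠ σ (X + 2) := fun h => by
      have := σ.injective h
      clear * - this; revert X; decide
    have n3 : σ (X + 1) ≠ σ (X + 2) := fun h => Frame.add_one_ne_add_two X (σ.injective h)
    clear * - n1 n2 n3
    generalize σ X = a at *
    generalize σ (X + 1) = b at *
    generalize σ (X + 2) = c at *
    revert a b c
    decide
  have meets : ∀ (σ : Equiv.Perm (Fin 3)) (q : Fin 4) X L,
      Meets L ((t q).points (σ X + 1)) ((t q).points (σ X + 2)) ↔
        Meets L ((t q).points (σ (X + 1))) ((t q).points (σ (X + 2))) := by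
    intro σ q X L
    rcases perm σ X with ⟨h1, h2⟩ | ⟨h1, h2⟩
    · rw [h1, h2]
    · rw [h1, h2]; exact ⟨Meets.symm, Meets.symm⟩
  have hmem : ∀ P L, L ∈ cell t (E P) ↔ L ∈ Good ((t i).points (e i + 1)) ((t i).points (e i + 2))
      ((t l).points (e l + 1)) ((t l).points (e l + 2)) p p' P.1 P.2 := by
    intro P L
    have gi : Meets L (cellA t (E P) i) (cellB t (E P) i) ↔
        Meets L ((t i).points (e i + 1)) ((t i).points (e i + 2)) := by
      rw [cellA, cellB, Ei]
    have gl : Meets L (cellA t (E P) l) (cellB t (E P) l) ↔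
        Meets L ((t l).points (e l + 1)) ((t l).points (e l + 2)) := by
      rw [cellA, cellB, El]
    have gj : Meets L (cellA t (E P) j) (cellB t (E P) j) ↔
        Meets L (p (P.1 + 1)) (p (P.1 + 2)) := by
      rw [cellA, cellB, Ej]; exact meets σ j P.1 L
    have gk : Meets L (cellA t (E P) k) (cellB t (E P) k) ↔
        Meets L (p' (P.2 + 1)) (p' (P.2 + 2)) := by
      rw [cellA, cellB, Ek]; exact meets τ k P.2 L
    constructor
    · intro h
      exact ⟨gi.1 (h i), gl.1 (h l), gj.1 (h j), gk.1 (h k)⟩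
    · rintro ⟨h1, h2, h3, h4⟩ q
      rcases hex q with rfl | rfl | rfl | rfl
      · exact gi.2 h1
      · exact gj.2 h3
      · exact gk.2 h4
      · exact gl.2 h2
  have hend : ∀ (σ : Equiv.Perm (Fin 3)) (q : Fin 4) (e : Fin 4 → Fin 3) X, e q = σ X → ∀ L m,
      m ≠ X → (t q).points (σ m) ∈ (L : Line3).1 → ThroughEnd t e q L := by
    intro σ q e X he L m hm h
    rw [ThroughEnd, cellA, cellB, he]
    rcases perm σ X with ⟨h1, h2⟩ | ⟨h1, h2⟩ <;> rw [← h1, ← h2] <;>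
      rcases Frame.eq_add_of_ne hm with rfl | rfl
    · exact Or.inl h
    · exact Or.inr h
    · exact Or.inr h
    · exact Or.inl h
  suffices h : ∃ β : Fin 3 × Fin 3 → ℚ, (∀ P, CellBound t (E P) (β P)) ∧ ∑ P, β P ≤ 16 by
    obtain ⟨β, h1, h2⟩ := h
    refine ⟨fun X Y => β (σ.symm X, τ.symm Y), fun X Y => ?_, ?_⟩
    · have := h1 (σ.symm X, τ.symm Y)
      simpa only [E, Equiv.apply_symm_apply] using this
    · rw [Fintype.sum_prod_type] at h2
      rw [Equiv.sum_comp σ.symm fun X => ∑ Y, β (X, τ.symm Y)]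
      refine le_of_eq_of_le (Finset.sum_congr rfl fun X _ => ?_) h2
      exact Equiv.sum_comp τ.symm fun Y => β (X, Y)
  by_cases hz : ∀ X Y, ∃ z, F.form p p' X Y z ≠ 0
  · choose T hT2 hT hcov using fun P : Fin 3 × Fin 3 =>
      exists_finset_of_no_three (Frame.good_no_three hp hp' (hz P.1 P.2))
    have hTc : ∀ P, ∀ L ∈ T P, L ∈ cell t (E P) := fun P L hL => (hmem P L).2 (hT P L hL)
    refine ⟨fun P => ∑ L ∈ T P, (1 / mult t L : ℚ), fun P => ⟨T P, hTc P, fun L hL =>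
      ⟨L, hcov P L ((hmem P L).1 hL), JoinedIn.refl (cell_subset hL)⟩, le_rfl⟩,
      (sum_sum_inv_mult_le hE hTc).trans ?_⟩
    have := Frame.card_le_sixteen hp hp' hz (R := Finset.univ.biUnion T) (fun L hL => by
      simp only [Finset.mem_biUnion, Finset.mem_univ, true_and] at hL
      obtain ⟨P, hP⟩ := hL
      exact ⟨P.1, P.2, hT P L hP⟩)
    exact_mod_cast this
  · push Not at hz
    obtain ⟨X₀, Y₀, h0⟩ := hz
    have h0' : ∀ z, F.form p' p Y₀ X₀ z = 0 := fun z => by rw [Frame.form_symm, h0, neg_zero]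
    have hthird : ∀ X X' : Fin 3, X ≠ X' → ∃ m, m ≠ X ∧ m ≠ X' := by decide
    -- The vanishing form gives roots at vertices in the four cells that share exactly one edge with
    -- `(X₀, Y₀)`: 5 · 2 + 4 · 3/2 = 16.
    refine ⟨fun P => if (P.1 = X₀ ∧ P.2 ≠ Y₀) ∨ (P.1 ≠ X₀ ∧ P.2 = Y₀) then 3 / 2 else 2,
      fun P => ?_, ?_⟩
    · dsimp only
      split_ifs with hP
      · rcases hP with ⟨h1, h2⟩ | ⟨h1, h2⟩
        · obtain ⟨m, hm1, hm2⟩ := hthird P.2 Y₀ h2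
          refine cellBound_of_vertex_root hp' hp (X := P.2) (Y := P.1) (j := k) (m := m)
            (fun L => (hmem P L).trans mem_good_symm.symm) (hend τ k _ _ (Ek P)) ?_ hm1 ?_
          · rw [h1]
            exact hp'.exists_form_ne_zero hp h2.symm h0'
          · rw [h1]
            exact hp'.form_vertex_eq_zero hm2 hm1 (h0' _)
        · obtain ⟨m, hm1, hm2⟩ := hthird P.1 X₀ h1
          refine cellBound_of_vertex_root hp hp' (X := P.1) (Y := P.2) (j := j) (m := m)
            (hmem P) (hend σ j _ _ (Ej P)) ?_ hm1 ?_
          · rw [h2]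
            exact hp.exists_form_ne_zero hp' h1.symm h0
          · rw [h2]
            exact hp.form_vertex_eq_zero hm2 hm1 (h0 _)
      · exact cellBound_two t _
    · rw [Fintype.sum_prod_type]
      simp only [Fin.sum_univ_three]
      clear * -
      fin_cases X₀ <;> fin_cases Y₀ <;> simp +decide <;> norm_num

/-- The edge missing two triangles saves 2 in each of the three blocks of nine cells indexed by the
edge of the fourth triangle. -/
theorem numTangentComponents_le_of_forall_not_copAt
    (hd : ∀ i j : Fin 4, i ≠ j → Disjoint (triangleSet (t i)) (triangleSet (t j)))
    (hc : ∀ (e : Fin 4 → Fin 3) (i j : Fin 4), i ≠ j → ¬ CopAt t e i j) :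
    numTangentComponents t ≤ 156 := by
  obtain ⟨i, m, j, k, hij, hik, hjk, hj, hk⟩ := exists_edge_missing_two hd hc
  obtain ⟨l, hil, hjl, hkl⟩ : ∃ l, i ≠ l ∧ j ≠ l ∧ k ≠ l := by
    clear * -; revert i j k; decide
  have hex : ∀ q, q = i ∨ q = j ∨ q = k ∨ q = l := by
    clear * - hij hik hil hjk hjl hkl; revert i j k l; decide
  let e₀ : Fin 3 → Fin 4 → Fin 3 := fun n => Function.update (fun _ => n) i m
  have he₀ : ∀ n, e₀ n i = m := fun n => Function.update_self _ _ _
  choose β hβ hsum using fun n => exists_nine_cellBounds hc hij hik hil hjk hjl hkl (e₀ n)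
    (by rwa [he₀]) (by rwa [he₀])
  have key : ∀ e, CellBound t e (if e i = m then β (e l) (e j) (e k) else 2) := by
    intro e
    split_ifs with h
    · have : e = Function.update (Function.update (e₀ (e l)) j (e j)) k (e k) := by
        funext q
        rcases hex q with rfl | rfl | rfl | rfl
        · rw [Function.update_of_ne hik, Function.update_of_ne hij, he₀, h]
        · rw [Function.update_of_ne hjk, Function.update_self]
        · rw [Function.update_self]
        · rw [Function.update_of_ne hkl.symm, Function.update_of_ne hjl.symm]
          exact (Function.update_of_ne hil.symm _ _).symm
      have h1 := hβ (e l) (e j) (e k)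
      rwa [← this] at h1
    · exact cellBound_two t e
  refine numTangentComponents_le key ?_
  let φ : (Fin 4 → Fin 3) ≃ Fin 3 × Fin 3 × Fin 3 × Fin 3 :=
    { toFun := fun e => (e i, e l, e j, e k)
      invFun := fun P q => if q = i then P.1 else if q = l then P.2.1 else if q = j then P.2.2.1
        else P.2.2.2
      left_inv := fun e => by
        funext q
        rcases hex q with rfl | rfl | rfl | rfl <;> simp [*, Ne.symm]
      right_inv := fun P => by
        ext <;> simp [hil.symm, hij.symm, hik.symm, hjl, hkl, hjk.symm] }
  have hφ : ∑ e : Fin 4 → Fin 3, (if e i = m then β (e l) (e j) (e k) else 2) =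
      ∑ P : Fin 3 × Fin 3 × Fin 3 × Fin 3, if P.1 = m then β P.2.1 P.2.2.1 P.2.2.2 else 2 :=
    Fintype.sum_equiv φ _ _ fun e => rfl
  rw [hφ]
  simp only [Fintype.sum_prod_type]
  -- The 27 cells with the special edge pay 3 · 16 = 48, the two other groups 27 · 2 = 54 each, in
  -- total 156.
  have hin : ∀ M : Fin 3, ∑ n, ∑ X, ∑ Y, (if M = m then β n X Y else (2 : ℚ)) ≤
      if M = m then 48 else 54 := by
    intro M
    split_ifs
    · have := Finset.sum_le_sum fun n (_ : n ∈ Finset.univ) => hsum n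
      refine this.trans ?_
      simp; norm_num
    · simp; norm_num
  refine (Finset.sum_le_sum fun M _ => hin M).trans_lt ?_
  rw [Fin.sum_univ_three]
  clear * -
  fin_cases m <;> simp +decide <;> norm_num

end TriTangent

theorem theorem4 (t : Fin 4 → Affine.Triangle ℝ E3) :
    numTangentComponents t ≤ 162 ∧
      ((∀ i j : Fin 4, i ≠ j → Disjoint (triangleSet (t i)) (triangleSet (t j))) →
        numTangentComponents t ≤ 156) := by
  refine ⟨?_, fun h => ?_⟩
  · exact TriTangent.numTangentComponents_le_of_loss (S := ∅) (δ := 0) (by simp) (by norm_num)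
  · by_cases hc : ∃ (e : Fin 4 → Fin 3) (i j : Fin 4), i ≠ j ∧ TriTangent.CopAt t e i j
    · obtain ⟨e, i, j, hij, hc⟩ := hc
      exact TriTangent.numTangentComponents_le_of_copAt h hij hc
    · refine TriTangent.numTangentComponents_le_of_forall_not_copAt h fun e i j hij hc' => hc ?_
      exact ⟨e, i, j, hij, hc'⟩
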